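/- Let $$\mathcal R(s)=\int_{0\swarrow1}\frac{x^{-s}e^{\pi i x^2}}{e^{\pi i x}-e^{-\pi i x}}\,dx\qquad(s\in\mathbb C)$$ be Riemann's auxiliary function, where $0\swarrow1$ is a straight line of slope $1$ that crosses the real axis at a point strictly between $0$ and $1$ and is traversed from the upper right to the lower left, and $x^{-s}$ has its principal value. (The integral converges for every $s$, it does not depend on the crossing point, and $\mathcal R$ is an entire function.) For real $\alpha$ and $T$ let $N(\alpha,T)$ denote the number of zeros $\rho$ of $\mathcal R(s)$, counted with multiplicity, with $\alpha\le\operatorname{Re}\rho\le1$ and $0\le\operatorname{Im}\rho\le T$. There is an absolute constant $C>0$ such that for all real $\alpha$ with $\frac12<\alpha\le1$ and all real $T\ge2$, the number $N(\alpha,T)$ is finite and $$N(\alpha,T)\le C\,T^{\frac32-\alpha}\,(\log T)^3 .$$ -/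

import Mathlib

open scoped ENNReal

noncomputable section

/-- The straight line `0 ↙ 1`: it has direction `-e^{iπ/4}` (it comes from infinity in the first
quadrant and goes to infinity in the third quadrant) and it crosses the real axis at `1/2`,
a point between `0` and `1`. -/
def siegelLine (u : ℝ) : ℂ :=
  1 / 2 - (u : ℂ) * Complex.exp (Real.pi * Complex.I / 4)

/-- The integrand `x^{-s} e^{πix²} / (e^{πix} - e^{-πix})`. The power is the principal one, which
is holomorphic off the non-positive real axis; the line `0 ↙ 1` does not meet this half-axis. -/
def riemannAuxIntegrand (s x : ℂ) : ℂ :=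
  x ^ (-s) * Complex.exp (Real.pi * Complex.I * x ^ 2) /
    (Complex.exp (Real.pi * Complex.I * x) - Complex.exp (-(Real.pi * Complex.I * x)))

/-- Riemann's auxiliary function
`R(s) = ∫_{0 ↙ 1} x^{-s} e^{πix²} / (e^{πix} - e^{-πix}) dx`,
with the contour parametrized by `siegelLine`, whose derivative is `-e^{iπ/4}`. -/
def riemannAux (s : ℂ) : ℂ :=
  ∫ u : ℝ, riemannAuxIntegrand s (siegelLine u) *
    (-Complex.exp (Real.pi * Complex.I / 4))

/-- The zeros `ρ` of `R` in the closed rectangle `[α, 1] × [0, T]`. -/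
def riemannAuxZeros (α T : ℝ) : Set ℂ :=
  {ρ : ℂ | riemannAux ρ = 0 ∧ ρ.re ∈ Set.Icc α 1 ∧ ρ.im ∈ Set.Icc 0 T}

/-- `N(α, T)`: the number of zeros of `R` in `[α, 1] × [0, T]`, counted with multiplicity. It takes
values in `[0, ∞]`, so that a finite upper bound includes the finiteness of the number of zeros. -/
def riemannAuxZeroCount (α T : ℝ) : ℝ≥0∞ :=
  ∑' ρ : riemannAuxZeros α T, ((analyticOrderAt riemannAux (ρ : ℂ) : ℕ∞) : ℝ≥0∞)

end

section Preparation
open Finset ArithmeticFunction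

/-! ### Sums of the Möbius function -/

/-! The proof is a zero-density argument: mollify, take mean squares, and apply Jensen's formula
with circles averaged over their centres.

Crossing the poles of the integrand at 1, …, m turns `riemannAux s` into `∑ n^(-s)` over n ≤ m plus
the integral over the line through m + 1/2. When m + 1/2 is within 1/2 of the saddle point √(t/2π),
with t = Im s, this integral is O(m^(-σ)) (`riemannAux_eq_sum_add_siegelIntegral`,
`exists_norm_siegelIntegral_le`). Fix N and let t run over (A, 9A] with A = 2πN². The sum then
contains all n ≤ N, together with those n in (N, 3N] that satisfy 2πn² < t.

Let M(s) be the sum of μ(d) d^(-s) over d ≤ N, and g = R·M − 1 (`mollifiedError`). On a vertical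
line with σ ≥ 1/2 − 1/log N the mean square of g over the block is O(N^(3-2σ) log² N)
(`exists_integral_norm_sq_mollifiedError_le`). Two arithmetic inputs give this power of the
logarithm: the cancellation in `∑ μ(a)/a` for the terms n ≤ N (`sum_mollifiedCoeff_sq_div_le`), and
the short multiplicative range N < n ≤ 3N for the rest (`sum_mul_eq_mul_inv_le`).

Zeros of R are zeros of 1 − g² = R·M·(2 − R·M), and log|1 − g²| ≤ |g|². Put δ = 1/log N and use
Jensen's formula on circles with centre 3 + it and radius 3 − (α − δ). A zero with real part in [α,
1] and ordinate within √δ of t has weight at least δ/8. Integrating over t counts it with total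
weight of order δ^(3/2). On the other side, |g|² decays like N^(-2σ), so only an arc of length about
(log N)^(-1/2) near the leftmost point matters, and the integral is O(N^(3-2α) (log N)^(3/2)).
Dividing gives O(N^(3-2α) log³ N) zeros in a block. The blocks for N = 2^j add up geometrically
because 3 − 2α ≥ 1, and N² is comparable to T. -/

theorem Nat.exists_coprime_part (q : ℕ) {m : ℕ} (hm : m ≠ 0) :
    ∃ m₁ m₂ : ℕ, m = m₁ * m₂ ∧ q.Coprime m₂ ∧ ∀ p : ℕ, p.Prime → p ∣ m₁ → p ∣ q := by
  induction m using induction_on_primes with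
  | zero => exact absurd rfl hm
  | one => exact ⟨1, 1, rfl, Nat.coprime_one_right q, fun p hp h => by
      simp [Nat.Prime.ne_one hp] at h⟩
  | prime_mul p m hp ih =>
    obtain ⟨m₁, m₂, h, hc, h1⟩ := ih (fun h => hm (by simp [h]))
    by_cases hpq : p ∣ q
    · refine ⟨p * m₁, m₂, by rw [h, mul_assoc], hc, fun r hr hd => ?_⟩
      rcases (Nat.Prime.dvd_mul hr).1 hd with h' | h'
      · rwa [(Nat.prime_dvd_prime_iff_eq hr hp).1 h']
      · exact h1 r hr h'
    · refine ⟨m₁, p * m₂, by rw [h]; ring, ?_, h1⟩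
      exact Nat.Coprime.mul_right ((Nat.Prime.coprime_iff_not_dvd hp).2 hpq).symm hc

/-- The Möbius function restricted to the integers coprime to `q`. -/
noncomputable def moebiusCoprime (q : ℕ) : ArithmeticFunction ℤ :=
  ⟨fun a => if q.Coprime a then moebius a else 0, by simp⟩

theorem moebiusCoprime_apply (q a : ℕ) :
    moebiusCoprime q a = if q.Coprime a then moebius a else 0 := rfl

theorem sum_divisors_moebius (m : ℕ) : ∑ a ∈ m.divisors, moebius a = if m = 1 then 1 else 0 := by
  rw [← coe_mul_zeta_apply, moebius_mul_coe_zeta, one_apply]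

/-- Only divisors coprime to q contribute. They are the divisors of the part of m coprime to q, so
the convolution is 1 or 0 according to whether that part is 1. -/
theorem abs_moebiusCoprime_mul_zeta_le (q m : ℕ) :
    |(moebiusCoprime q * (zeta : ArithmeticFunction ℤ)) m| ≤ 1 := by
  rcases eq_or_ne m 0 with rfl | hm
  · simp
  obtain ⟨m₁, m₂, rfl, hc, h1⟩ := Nat.exists_coprime_part q hm
  have h : (m₁ * m₂).divisors.filter (fun a => q.Coprime a) = m₂.divisors := by
    ext a
    simp only [mem_filter, Nat.mem_divisors]
    constructor
    · rintro ⟨⟨h2, h3⟩, h4⟩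
      refine ⟨?_, right_ne_zero_of_mul hm⟩
      refine Nat.Coprime.dvd_of_dvd_mul_left (Nat.coprime_of_dvd fun p hp ha hb => ?_) h2
      exact hp.one_lt.ne' (Nat.dvd_one.1 (h4 ▸ Nat.dvd_gcd (h1 p hp hb) ha))
    · rintro ⟨h2, -⟩
      exact ⟨⟨Dvd.dvd.mul_left h2 _, hm⟩, Nat.Coprime.coprime_dvd_right h2 hc⟩
  rw [coe_mul_zeta_apply]
  simp only [moebiusCoprime_apply]
  rw [← sum_filter, h, sum_divisors_moebius]
  split_ifs <;> simp

/-- The classical argument: x times the sum is `∑ μ(a)⌊x/a⌋`, which counts values of the bounded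
convolution with 1, plus fractional parts. Each of the two is at most x in absolute value.
Uniformity in q is essential later. -/
theorem abs_sum_moebiusCoprime_div_le (q x : ℕ) :
    |∑ a ∈ Ioc 0 x, (moebiusCoprime q a : ℝ) / a| ≤ 2 := by
  rcases Nat.eq_zero_or_pos x with rfl | hx
  · simp
  have hx' : (0 : ℝ) < x := by exact_mod_cast hx
  have h1 : |∑ a ∈ Ioc 0 x, (moebiusCoprime q a : ℝ) * ((x / a : ℕ) : ℝ)| ≤ x := by
    have := sum_Ioc_mul_zeta_eq_sum (moebiusCoprime q) x
    have h : (∑ a ∈ Ioc 0 x, (moebiusCoprime q a : ℝ) * ((x / a : ℕ) : ℝ)) =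
        ((∑ n ∈ Ioc 0 x, (moebiusCoprime q * (zeta : ArithmeticFunction ℤ)) n : ℤ) : ℝ) := by
      rw [this]; push_cast; rfl
    rw [h]
    have h2 : |∑ n ∈ Ioc 0 x, (moebiusCoprime q * (zeta : ArithmeticFunction ℤ)) n| ≤ x := by
      refine (abs_sum_le_sum_abs _ _).trans ?_
      refine (sum_le_sum fun n _ => abs_moebiusCoprime_mul_zeta_le q n).trans ?_
      simp
    exact_mod_cast h2
  have h2 : |∑ a ∈ Ioc 0 x, (moebiusCoprime q a : ℝ) * ((x : ℝ) / a - ((x / a : ℕ) : ℝ))| ≤ x := by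
    refine (abs_sum_le_sum_abs _ _).trans ?_
    have : ∀ a ∈ Ioc 0 x, |(moebiusCoprime q a : ℝ) * ((x : ℝ) / a - ((x / a : ℕ) : ℝ))| ≤ 1 := by
      intro a ha
      have ha0 : 0 < a := (mem_Ioc.1 ha).1
      rw [abs_mul]
      have h3 : |(moebiusCoprime q a : ℝ)| ≤ 1 := by
        rw [moebiusCoprime_apply]
        split_ifs
        · exact_mod_cast abs_moebius_le_one
        · simp
      have h4 : |(x : ℝ) / a - ((x / a : ℕ) : ℝ)| ≤ 1 := by
        have e1 : ((x / a : ℕ) : ℝ) ≤ (x : ℝ) / a := Nat.cast_div_le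
        have e2 : (x : ℝ) / a < ((x / a : ℕ) : ℝ) + 1 := by
          have := Nat.lt_floor_add_one ((x : ℝ) / a)
          rwa [Nat.floor_div_eq_div] at this
        rw [abs_le]; constructor <;> linarith
      exact mul_le_one₀ h3 (abs_nonneg _) h4
    refine (sum_le_sum this).trans ?_
    simp
  have h3 : (x : ℝ) * ∑ a ∈ Ioc 0 x, (moebiusCoprime q a : ℝ) / a =
      ∑ a ∈ Ioc 0 x, (moebiusCoprime q a : ℝ) * ((x / a : ℕ) : ℝ) +
      ∑ a ∈ Ioc 0 x, (moebiusCoprime q a : ℝ) * ((x : ℝ) / a - ((x / a : ℕ) : ℝ)) := by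
    rw [mul_sum, ← sum_add_distrib]
    exact sum_congr rfl fun a _ => by ring
  have h4 := abs_add_le (∑ a ∈ Ioc 0 x, (moebiusCoprime q a : ℝ) * ((x / a : ℕ) : ℝ))
    (∑ a ∈ Ioc 0 x, (moebiusCoprime q a : ℝ) * ((x : ℝ) / a - ((x / a : ℕ) : ℝ)))
  rw [← h3, abs_mul, abs_of_pos hx'] at h4
  have h5 : (x : ℝ) * |∑ a ∈ Ioc 0 x, (moebiusCoprime q a : ℝ) / a| ≤ x * 2 := by linarith
  exact le_of_mul_le_mul_left h5 hx'

/-- If q and a share a factor, q·a is not squarefree and both sides vanish. -/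
theorem moebius_mul_eq (q a : ℕ) : moebius (q * a) = moebius q * moebiusCoprime q a := by
  rw [moebiusCoprime_apply]
  split_ifs with h
  · exact isMultiplicative_moebius.map_mul_of_coprime h
  · rw [mul_zero, moebius_eq_zero_of_not_squarefree]
    exact fun hs => h (Nat.coprime_of_squarefree_mul hs)

theorem abs_sum_moebius_mul_div_le (q x : ℕ) :
    |∑ a ∈ Ioc 0 x, (moebius (q * a) : ℝ) / a| ≤ 2 := by
  have h : ∑ a ∈ Ioc 0 x, (moebius (q * a) : ℝ) / a =
      moebius q * ∑ a ∈ Ioc 0 x, (moebiusCoprime q a : ℝ) / a := by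
    rw [mul_sum]
    exact sum_congr rfl fun a _ => by rw [moebius_mul_eq]; push_cast; ring
  rw [h, abs_mul]
  have h1 : |(moebius q : ℝ)| ≤ 1 := by exact_mod_cast abs_moebius_le_one
  nlinarith [abs_sum_moebiusCoprime_div_le q x, abs_nonneg (moebius q : ℝ),
    abs_nonneg (∑ a ∈ Ioc 0 x, (moebiusCoprime q a : ℝ) / a)]

/-- Möbius detection of gcd(a, b) = 1, after which the double sum splits into squares. -/
theorem sum_coprime_eq_sum_moebius (u : ℕ → ℝ) (Y : ℕ) :
    ∑ a ∈ Ioc 0 Y, ∑ b ∈ Ioc 0 Y, (if a.Coprime b then u a * u b else 0) =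
      ∑ e ∈ Ioc 0 Y, (moebius e : ℝ) * (∑ a ∈ Ioc 0 (Y / e), u (e * a)) ^ 2 := by
  have key : ∀ e ∈ Ioc 0 Y, ∑ a ∈ Ioc 0 (Y / e), u (e * a) =
      ∑ a ∈ Ioc 0 Y, if e ∣ a then u a else 0 := by
    intro e he
    have he0 : 0 < e := (mem_Ioc.1 he).1
    rw [← sum_filter]
    refine sum_nbij' (fun a => e * a) (fun a => a / e) ?_ ?_ ?_ ?_ ?_
    · intro a ha
      simp only [mem_Ioc, mem_filter] at ha ⊢
      refine ⟨⟨Nat.mul_pos he0 ha.1, ?_⟩, dvd_mul_right _ _⟩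
      rw [mul_comm]; exact (Nat.le_div_iff_mul_le he0).1 ha.2
    · intro a ha
      simp only [mem_Ioc, mem_filter] at ha ⊢
      exact ⟨Nat.div_pos (Nat.le_of_dvd ha.1.1 ha.2) he0, Nat.div_le_div_right ha.1.2⟩
    · intro a _; exact Nat.mul_div_cancel_left a he0
    · intro a ha
      simp only [mem_filter] at ha
      exact Nat.mul_div_cancel' ha.2
    · intro a _; rfl
  have h2 : ∀ e ∈ Ioc 0 Y, (moebius e : ℝ) * (∑ a ∈ Ioc 0 (Y / e), u (e * a)) ^ 2 =
      ∑ a ∈ Ioc 0 Y, ∑ b ∈ Ioc 0 Y,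
        (if e ∣ a.gcd b then (moebius e : ℝ) else 0) * (u a * u b) := by
    intro e he
    rw [key e he, sq, sum_mul_sum, mul_sum]
    refine sum_congr rfl fun a _ => ?_
    rw [mul_sum]
    refine sum_congr rfl fun b _ => ?_
    by_cases h1 : e ∣ a <;> by_cases h2 : e ∣ b <;> simp [Nat.dvd_gcd_iff, h1, h2]
  rw [sum_congr rfl h2]
  conv_rhs => rw [sum_comm]
  refine sum_congr rfl fun a ha => ?_
  conv_rhs => rw [sum_comm]
  refine sum_congr rfl fun b _ => ?_
  have ha' := mem_Ioc.1 ha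
  rw [← sum_mul, ← sum_filter]
  have h3 : (Ioc 0 Y).filter (fun e => e ∣ a.gcd b) = (a.gcd b).divisors := by
    ext e
    have hg : a.gcd b ≠ 0 := (Nat.gcd_pos_of_pos_left b ha'.1).ne'
    simp only [mem_filter, mem_Ioc, Nat.mem_divisors]
    refine ⟨fun h => ⟨h.2, hg⟩, fun h => ⟨⟨Nat.pos_of_dvd_of_pos h.1 (Nat.pos_of_ne_zero hg), ?_⟩, h.1⟩⟩
    exact (Nat.le_of_dvd ha'.1 (h.1.trans (Nat.gcd_dvd_left a b))).trans ha'.2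
  rw [h3]
  have h4 := sum_divisors_moebius (a.gcd b)
  have h5 : ∑ e ∈ (a.gcd b).divisors, (moebius e : ℝ) = if a.gcd b = 1 then 1 else 0 := by
    exact_mod_cast h4
  rw [h5]
  by_cases hc : a.Coprime b
  · rw [if_pos hc, if_pos hc, one_mul]
  · rw [if_neg hc, if_neg hc, zero_mul]

/-! ### Solutions of `d₁ n₁ = d₂ n₂` -/

/-- With g = gcd(d₁, d₂) and h = gcd(n₁, n₂), the solutions are exactly d₁ = ga, d₂ = gb, n₁ = hb,
n₂ = ha with a, b coprime. -/
theorem sum_mul_eq_mul (A B : Finset ℕ) (K : ℕ) (hA : A ⊆ Ioc 0 K) (hB : B ⊆ Ioc 0 K)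
    (F : ℕ → ℕ → ℕ → ℕ → ℝ) :
    ∑ x ∈ A ×ˢ B, ∑ y ∈ A ×ˢ B, (if x.1 * x.2 = y.1 * y.2 then F x.1 x.2 y.1 y.2 else 0) =
      ∑ g ∈ Ioc 0 K, ∑ h ∈ Ioc 0 K, ∑ a ∈ Ioc 0 K, ∑ b ∈ Ioc 0 K,
        if a.Coprime b ∧ (g * a ∈ A ∧ g * b ∈ A) ∧ h * b ∈ B ∧ h * a ∈ B then
          F (g * a) (h * b) (g * b) (h * a) else 0 := by
  have l : ∑ x ∈ A ×ˢ B, ∑ y ∈ A ×ˢ B,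
      (if x.1 * x.2 = y.1 * y.2 then F x.1 x.2 y.1 y.2 else 0) =
      ∑ z ∈ ((A ×ˢ B) ×ˢ (A ×ˢ B)).filter (fun z => z.1.1 * z.1.2 = z.2.1 * z.2.2),
        F z.1.1 z.1.2 z.2.1 z.2.2 := by
    rw [sum_filter]
    exact (sum_product' (A ×ˢ B) (A ×ˢ B) (fun x y =>
      if x.1 * x.2 = y.1 * y.2 then F x.1 x.2 y.1 y.2 else 0)).symm
  have r : (∑ g ∈ Ioc 0 K, ∑ h ∈ Ioc 0 K, ∑ a ∈ Ioc 0 K, ∑ b ∈ Ioc 0 K,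
        if a.Coprime b ∧ (g * a ∈ A ∧ g * b ∈ A) ∧ h * b ∈ B ∧ h * a ∈ B then
          F (g * a) (h * b) (g * b) (h * a) else 0) =
      ∑ z ∈ ((Ioc 0 K ×ˢ Ioc 0 K) ×ˢ (Ioc 0 K ×ˢ Ioc 0 K)).filter (fun z =>
        z.2.1.Coprime z.2.2 ∧ (z.1.1 * z.2.1 ∈ A ∧ z.1.1 * z.2.2 ∈ A) ∧
          z.1.2 * z.2.2 ∈ B ∧ z.1.2 * z.2.1 ∈ B),
        F (z.1.1 * z.2.1) (z.1.2 * z.2.2) (z.1.1 * z.2.2) (z.1.2 * z.2.1) := by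
    rw [sum_filter, sum_product, sum_product]
    refine sum_congr rfl fun g _ => sum_congr rfl fun h _ => ?_
    rw [sum_product]
  rw [l, r]
  have fact : ∀ z ∈ ((A ×ˢ B) ×ˢ (A ×ˢ B)).filter (fun z => z.1.1 * z.1.2 = z.2.1 * z.2.2),
      ∃ g h a b : ℕ, 0 < g ∧ 0 < h ∧ 0 < a ∧ 0 < b ∧ a.Coprime b ∧
        z = ((g * a, h * b), (g * b, h * a)) := by
    rintro ⟨⟨d₁, n₁⟩, ⟨d₂, n₂⟩⟩ hz
    simp only [mem_filter, mem_product] at hz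
    obtain ⟨⟨⟨h1, h2⟩, h3, h4⟩, h5⟩ := hz
    have p1 := (mem_Ioc.1 (hA h1)).1
    have p2 := (mem_Ioc.1 (hB h2)).1
    have p3 := (mem_Ioc.1 (hA h3)).1
    have p4 := (mem_Ioc.1 (hB h4)).1
    obtain ⟨g, a, b, hg, hab, rfl, rfl⟩ := Nat.exists_coprime' (Nat.gcd_pos_of_pos_left d₂ p1)
    have ha : 0 < a := Nat.pos_of_mul_pos_right p1
    have hb : 0 < b := Nat.pos_of_mul_pos_right p3
    have h6 : a * n₁ = b * n₂ := by
      have : g * (a * n₁) = g * (b * n₂) := by linarith [h5]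
      exact Nat.eq_of_mul_eq_mul_left hg this
    obtain ⟨h, rfl⟩ : b ∣ n₁ :=
      Nat.Coprime.dvd_of_dvd_mul_left hab.symm (h6 ▸ dvd_mul_right b n₂)
    have h7 : n₂ = a * h := by
      have : b * n₂ = b * (a * h) := by rw [← h6]; ring
      exact Nat.eq_of_mul_eq_mul_left hb this
    subst h7
    exact ⟨g, h, a, b, hg, Nat.pos_of_mul_pos_left p2, ha, hb, hab, by
      simp only [mul_comm]⟩
  have gcd1 : ∀ g a b : ℕ, a.Coprime b → (g * a).gcd (g * b) = g := fun g a b h => by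
    rw [Nat.gcd_mul_left, h.gcd_eq_one, mul_one]
  have gcd2 : ∀ g a b : ℕ, a.Coprime b → (g * b).gcd (g * a) = g := fun g a b h =>
    gcd1 g b a h.symm
  refine sum_nbij' (fun z => ((z.1.1.gcd z.2.1, z.1.2.gcd z.2.2),
      (z.1.1 / z.1.1.gcd z.2.1, z.2.1 / z.1.1.gcd z.2.1)))
    (fun z => ((z.1.1 * z.2.1, z.1.2 * z.2.2), (z.1.1 * z.2.2, z.1.2 * z.2.1))) ?_ ?_ ?_ ?_ ?_
  · intro z hz
    obtain ⟨g, h, a, b, hg, hh, ha, hb, hab, rfl⟩ := fact z hz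
    simp only [mem_filter, mem_product] at hz
    simp only [gcd1 g a b hab, gcd2 h a b hab, Nat.mul_div_cancel_left _ hg, mem_filter,
      mem_product]
    have b1 := (mem_Ioc.1 (hA hz.1.1.1)).2
    have b2 := (mem_Ioc.1 (hB hz.1.1.2)).2
    have b3 := (mem_Ioc.1 (hA hz.1.2.1)).2
    refine ⟨⟨⟨mem_Ioc.2 ⟨hg, (Nat.le_mul_of_pos_right g ha).trans b1⟩,
      mem_Ioc.2 ⟨hh, (Nat.le_mul_of_pos_right h hb).trans b2⟩⟩,
      mem_Ioc.2 ⟨ha, (Nat.le_mul_of_pos_left a hg).trans b1⟩,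
      mem_Ioc.2 ⟨hb, (Nat.le_mul_of_pos_left b hg).trans b3⟩⟩, hab,
      ⟨hz.1.1.1, hz.1.2.1⟩, hz.1.1.2, hz.1.2.2⟩
  · rintro ⟨⟨g, h⟩, ⟨a, b⟩⟩ hz
    simp only [mem_filter, mem_product] at hz ⊢
    exact ⟨⟨⟨hz.2.2.1.1, hz.2.2.2.1⟩, hz.2.2.1.2, hz.2.2.2.2⟩, by ring⟩
  · intro z hz
    obtain ⟨g, h, a, b, hg, hh, ha, hb, hab, rfl⟩ := fact z hz
    simp only [gcd1 g a b hab, gcd2 h a b hab, Nat.mul_div_cancel_left _ hg]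
  · rintro ⟨⟨g, h⟩, ⟨a, b⟩⟩ hz
    simp only [mem_filter, mem_product, mem_Ioc] at hz
    simp only [gcd1 g a b hz.2.1, gcd2 h a b hz.2.1, Nat.mul_div_cancel_left _ hz.1.1.1.1]
  · intro z hz
    obtain ⟨g, h, a, b, hg, hh, ha, hb, hab, rfl⟩ := fact z hz
    simp only [gcd1 g a b hab, gcd2 h a b hab, Nat.mul_div_cancel_left _ hg]

theorem sum_Ioc_inv_le (N : ℕ) : ∑ k ∈ Ioc 0 N, (1 : ℝ) / k ≤ 1 + Real.log N := by
  have h := harmonic_le_one_add_log N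
  rw [harmonic_eq_sum_Icc] at h
  push_cast at h
  have e : Ioc 0 N = Icc 1 N := by ext; simp [Nat.succ_le_iff]
  rw [e]
  simpa [one_div] using h

theorem sum_Ioc_inv_sq_le (N : ℕ) : ∑ k ∈ Ioc 0 N, (1 : ℝ) / (k : ℝ) ^ 2 ≤ 2 := by
  have : ∑ k ∈ Ioc 0 N, (1 : ℝ) / (k : ℝ) ^ 2 ≤ 2 - 1 / N := by
    induction N with
    | zero => simp
    | succ n ih =>
      rw [← Finset.insert_Ioc_right_eq_Ioc_add_one (Nat.zero_le n), sum_insert (by simp)]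
      rcases Nat.eq_zero_or_pos n with rfl | hn
      · norm_num
      · have hn' : (0 : ℝ) < n := by exact_mod_cast hn
        have h2 : 1 / ((n + 1 : ℕ) : ℝ) ^ 2 ≤ 1 / (n : ℝ) - 1 / ((n + 1 : ℕ) : ℝ) := by
          push_cast
          rw [div_sub_div _ _ (by positivity) (by positivity), div_le_div_iff₀ (by positivity) (by positivity)]
          nlinarith
        linarith
  have h0 : (0 : ℝ) ≤ 1 / N := by positivity
  linarith

theorem sum_sq_fiber {ι : Type*} (I : Finset ι) (f : ι → ℕ) (S : Finset ℕ)
    (hS : ∀ x ∈ I, f x ∈ S) (c : ι → ℝ) (w : ℕ → ℝ) :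
    ∑ k ∈ S, (∑ x ∈ I with f x = k, c x) ^ 2 * w k =
      ∑ x ∈ I, ∑ y ∈ I, (if f x = f y then c x * c y * w (f x) else 0) := by
  rw [← sum_fiberwise_of_maps_to hS]
  refine sum_congr rfl fun k _ => ?_
  rw [sq, sum_mul_sum, sum_mul]
  refine sum_congr rfl fun x hx => ?_
  rw [sum_mul, sum_filter]
  refine sum_congr rfl fun y _ => ?_
  have hx' := (mem_filter.1 hx).2
  rw [hx']
  simp only [eq_comm]

/-- The coefficients of the product of `∑_{d ≤ N} μ(d) d^{-s}` and `∑_{n ≤ N} n^{-s}`. -/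
noncomputable def mollifiedCoeff (N k : ℕ) : ℝ :=
  ∑ x ∈ Ioc 0 N ×ˢ Ioc 0 N with x.1 * x.2 = k, (moebius x.1 : ℝ)

/-- Absolute values alone would cost log⁴ N. For fixed g and h the sum over coprime a, b becomes a
sum of squares of the bounded sums `∑ μ(gea)/a`, weighted by 1/e², hence is O(1). Only the two
harmonic sums over g and h remain. -/
theorem sum_mollifiedCoeff_sq_div_le (N : ℕ) :
    ∑ k ∈ Ioc 0 (N ^ 2), mollifiedCoeff N k ^ 2 / k ≤ 8 * (1 + Real.log N) ^ 2 := by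
  have hmaps : ∀ x ∈ Ioc 0 N ×ˢ Ioc 0 N, x.1 * x.2 ∈ Ioc 0 (N ^ 2) := by
    intro x hx
    simp only [mem_product, mem_Ioc] at hx ⊢
    exact ⟨Nat.mul_pos hx.1.1 hx.2.1, by rw [sq]; exact Nat.mul_le_mul hx.1.2 hx.2.2⟩
  have h1 := sum_sq_fiber (Ioc 0 N ×ˢ Ioc 0 N) (fun x => x.1 * x.2) (Ioc 0 (N ^ 2)) hmaps
    (fun x => (moebius x.1 : ℝ)) (fun k => 1 / (k : ℝ))
  have h2 := sum_mul_eq_mul (Ioc 0 N) (Ioc 0 N) N subset_rfl subset_rfl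
    (fun d₁ n₁ d₂ _ => (moebius d₁ : ℝ) * moebius d₂ * (1 / ((d₁ * n₁ : ℕ) : ℝ)))
  simp only [mollifiedCoeff, div_eq_mul_one_div (_ ^ 2)]
  rw [h1, h2]
  have inner : ∀ g ∈ Ioc 0 N, ∀ h ∈ Ioc 0 N, (∑ a ∈ Ioc 0 N, ∑ b ∈ Ioc 0 N,
      if a.Coprime b ∧ (g * a ∈ Ioc 0 N ∧ g * b ∈ Ioc 0 N) ∧ h * b ∈ Ioc 0 N ∧ h * a ∈ Ioc 0 N then
        (moebius (g * a) : ℝ) * moebius (g * b) * (1 / ((g * a * (h * b) : ℕ) : ℝ)) else 0) ≤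
      8 * ((1 / g) * (1 / h)) := by
    intro g hg h hh
    have hg0 := (mem_Ioc.1 hg).1
    have hh0 := (mem_Ioc.1 hh).1
    -- The four membership conditions together say precisely that a and b are at most N / max(g, h).
    set Y := N / max g h with hY
    have hm : 0 < max g h := lt_max_of_lt_left hg0
    have hcond : ∀ a : ℕ, a ∈ Ioc 0 N → (a ∈ Ioc 0 Y ↔ g * a ∈ Ioc 0 N ∧ h * a ∈ Ioc 0 N) := by
      intro a ha
      have ha0 := (mem_Ioc.1 ha).1
      simp only [mem_Ioc, hY, Nat.le_div_iff_mul_le hm, ha0, true_and, Nat.mul_pos hg0 ha0,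
        Nat.mul_pos hh0 ha0]
      rcases le_total g h with hle | hle
      · rw [max_eq_right hle, mul_comm a]
        exact ⟨fun h1 => ⟨(Nat.mul_le_mul_right a hle).trans h1, h1⟩, fun h1 => h1.2⟩
      · rw [max_eq_left hle, mul_comm a]
        exact ⟨fun h1 => ⟨h1, (Nat.mul_le_mul_right a hle).trans h1⟩, fun h1 => h1.1⟩
    have hYN : Ioc 0 N ∩ Ioc 0 Y = Ioc 0 Y := by
      rw [inter_eq_right]
      exact Ioc_subset_Ioc_right (Nat.div_le_self _ _)
    have e1 : (∑ a ∈ Ioc 0 N, ∑ b ∈ Ioc 0 N,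
      if a.Coprime b ∧ (g * a ∈ Ioc 0 N ∧ g * b ∈ Ioc 0 N) ∧ h * b ∈ Ioc 0 N ∧ h * a ∈ Ioc 0 N then
        (moebius (g * a) : ℝ) * moebius (g * b) * (1 / ((g * a * (h * b) : ℕ) : ℝ)) else 0) =
      ∑ a ∈ Ioc 0 N, if a ∈ Ioc 0 Y then ∑ b ∈ Ioc 0 N, if b ∈ Ioc 0 Y then
        (if a.Coprime b then (moebius (g * a) : ℝ) / a * (moebius (g * b) / b) else 0) *
          ((1 / g) * (1 / h)) else 0 else 0 := by
      refine sum_congr rfl fun a ha => ?_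
      by_cases h1 : a ∈ Ioc 0 Y
      · rw [if_pos h1]
        refine sum_congr rfl fun b hb => ?_
        have h1' := (hcond a ha).1 h1
        by_cases h2 : b ∈ Ioc 0 Y
        · have h2' := (hcond b hb).1 h2
          rw [if_pos h2]
          by_cases hc : a.Coprime b
          · rw [if_pos hc, if_pos ⟨hc, ⟨h1'.1, h2'.1⟩, h2'.2, h1'.2⟩]
            push_cast
            simp only [div_eq_mul_inv, mul_inv]
            ring
          · rw [if_neg hc, if_neg (fun h => hc h.1), zero_mul]
        · rw [if_neg h2, if_neg]
          exact fun h => h2 ((hcond b hb).2 ⟨h.2.1.2, h.2.2.1⟩)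
      · rw [if_neg h1]
        refine sum_eq_zero fun b _ => if_neg ?_
        exact fun h => h1 ((hcond a ha).2 ⟨h.2.1.1, h.2.2.2⟩)
    rw [e1]
    simp only [sum_ite_mem, hYN]
    simp only [← sum_mul]
    refine mul_le_mul_of_nonneg_right ?_ (by positivity)
    rw [sum_coprime_eq_sum_moebius (fun a => (moebius (g * a) : ℝ) / a)]
    have h3 : ∀ e ∈ Ioc 0 Y, (moebius e : ℝ) *
        (∑ a ∈ Ioc 0 (Y / e), (moebius (g * (e * a)) : ℝ) / ((e * a : ℕ) : ℝ)) ^ 2 ≤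
        4 * (1 / (e : ℝ) ^ 2) := by
      intro e he
      have he0 : (0 : ℝ) < e := by exact_mod_cast (mem_Ioc.1 he).1
      have h4 : ∑ a ∈ Ioc 0 (Y / e), (moebius (g * (e * a)) : ℝ) / ((e * a : ℕ) : ℝ) =
          (1 / e) * ∑ a ∈ Ioc 0 (Y / e), (moebius (g * e * a) : ℝ) / a := by
        rw [mul_sum]
        refine sum_congr rfl fun a _ => ?_
        rw [mul_assoc g e a]
        push_cast
        simp only [div_eq_mul_inv, mul_inv]
        ring
      rw [h4, mul_pow]
      have h5 : (∑ a ∈ Ioc 0 (Y / e), (moebius (g * e * a) : ℝ) / a) ^ 2 ≤ 4 := by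
        have := abs_le.1 (abs_sum_moebius_mul_div_le (g * e) (Y / e))
        nlinarith
      have h6 : (moebius e : ℝ) ≤ 1 := by exact_mod_cast (abs_le.1 (abs_moebius_le_one (n := e))).2
      calc _ ≤ 1 * ((1 / (e : ℝ)) ^ 2 * (∑ a ∈ Ioc 0 (Y / e), (moebius (g * e * a) : ℝ) / a) ^ 2) :=
            mul_le_mul_of_nonneg_right h6 (by positivity)
        _ ≤ 1 * ((1 / (e : ℝ)) ^ 2 * 4) := by gcongr
        _ = _ := by ring
    refine (sum_le_sum h3).trans ?_
    rw [← mul_sum]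
    linarith [sum_Ioc_inv_sq_le Y]
  refine (sum_le_sum fun g hg => sum_le_sum fun h hh => inner g hg h hh).trans ?_
  simp only [← mul_sum, ← sum_mul]
  have h3 := sum_Ioc_inv_le N
  have h4 : 0 ≤ ∑ k ∈ Ioc 0 N, (1 : ℝ) / k := sum_nonneg fun _ _ => by positivity
  rw [sq]
  gcongr

theorem sum_inv_max_sq_le (K : ℕ) :
    ∑ g ∈ Ioc 0 K, ∑ h ∈ Ioc 0 K, (1 : ℝ) / ((max g h : ℕ) : ℝ) ^ 2 ≤ 2 * (1 + Real.log K) := by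
  have h1 : ∀ g ∈ Ioc 0 K, ∑ h ∈ Ioc 0 K, (if h ≤ g then (1 : ℝ) / (g : ℝ) ^ 2 else 0) = 1 / g := by
    intro g hg
    have hg' := mem_Ioc.1 hg
    rw [← sum_filter, sum_const]
    have : (Ioc 0 K).filter (fun h => h ≤ g) = Ioc 0 g := by
      ext h; simp only [mem_filter, mem_Ioc]; omega
    rw [this, Nat.card_Ioc, nsmul_eq_mul, Nat.sub_zero]
    have : (g : ℝ) ≠ 0 := by exact_mod_cast hg'.1.ne'
    field_simp
  have h2 : ∀ g ∈ Ioc 0 K, ∀ h ∈ Ioc 0 K, (1 : ℝ) / ((max g h : ℕ) : ℝ) ^ 2 ≤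
      (if h ≤ g then (1 : ℝ) / (g : ℝ) ^ 2 else 0) + (if g ≤ h then (1 : ℝ) / (h : ℝ) ^ 2 else 0) := by
    intro g _ h _
    rcases le_total g h with hle | hle
    · rw [max_eq_right hle, if_pos hle]
      have : (0 : ℝ) ≤ if h ≤ g then (1 : ℝ) / (g : ℝ) ^ 2 else 0 := by split_ifs <;> positivity
      linarith
    · rw [max_eq_left hle, if_pos hle]
      have : (0 : ℝ) ≤ if g ≤ h then (1 : ℝ) / (h : ℝ) ^ 2 else 0 := by split_ifs <;> positivity
      linarith
  refine (sum_le_sum fun g hg => sum_le_sum fun h hh => h2 g hg h hh).trans ?_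
  simp only [sum_add_distrib]
  rw [sum_congr rfl h1, sum_comm (f := fun (g h : ℕ) => if g ≤ h then (1 : ℝ) / (h : ℝ) ^ 2 else 0),
    sum_congr rfl h1]
  linarith [sum_Ioc_inv_le K]

/-- For given g, h there are at most (3N/max(g, h))² pairs a, b, and the sum of 1/max(g, h)² costs
only one logarithm. -/
theorem card_mul_eq_mul_le (N : ℕ) :
    ∑ x ∈ Ioc 0 N ×ˢ Ioc 0 (3 * N), ∑ y ∈ Ioc 0 N ×ˢ Ioc 0 (3 * N),
      (if x.1 * x.2 = y.1 * y.2 then (1 : ℝ) else 0) ≤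
      18 * N ^ 2 * (1 + Real.log ((3 * N : ℕ) : ℝ)) := by
  rw [sum_mul_eq_mul (Ioc 0 N) (Ioc 0 (3 * N)) (3 * N) (Ioc_subset_Ioc_right (by omega)) subset_rfl
    (fun _ _ _ _ => 1)]
  have inner : ∀ g ∈ Ioc 0 (3 * N), ∀ h ∈ Ioc 0 (3 * N),
      (∑ a ∈ Ioc 0 (3 * N), ∑ b ∈ Ioc 0 (3 * N),
        if a.Coprime b ∧ (g * a ∈ Ioc 0 N ∧ g * b ∈ Ioc 0 N) ∧ h * b ∈ Ioc 0 (3 * N) ∧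
          h * a ∈ Ioc 0 (3 * N) then (1 : ℝ) else 0) ≤
      9 * N ^ 2 * (1 / ((max g h : ℕ) : ℝ) ^ 2) := by
    intro g hg h hh
    have hm : 0 < max g h := lt_max_of_lt_left (mem_Ioc.1 hg).1
    set Y := (3 * N) / max g h with hY
    have hcond : ∀ a : ℕ, 0 < a → g * a ≤ 3 * N → h * a ≤ 3 * N → a ∈ Ioc 0 Y := by
      intro a ha h1 h2
      rw [mem_Ioc, hY, Nat.le_div_iff_mul_le hm]
      refine ⟨ha, ?_⟩
      rcases max_choice g h with e | e <;> rw [e, mul_comm] <;> assumption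
    have hYN : Ioc 0 (3 * N) ∩ Ioc 0 Y = Ioc 0 Y := by
      rw [inter_eq_right]
      exact Ioc_subset_Ioc_right (Nat.div_le_self _ _)
    calc _ ≤ ∑ a ∈ Ioc 0 (3 * N), ∑ b ∈ Ioc 0 (3 * N),
          (if a ∈ Ioc 0 Y then (1 : ℝ) else 0) * (if b ∈ Ioc 0 Y then (1 : ℝ) else 0) := by
          refine sum_le_sum fun a ha => sum_le_sum fun b hb => ?_
          have ha0 := (mem_Ioc.1 ha).1
          have hb0 := (mem_Ioc.1 hb).1
          split_ifs with h1 h2 h3 h3 <;> norm_num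
          · simp only [mem_Ioc] at h1
            exact h3 (hcond b hb0 (by omega) (by omega))
          all_goals
            simp only [mem_Ioc] at h1
            exact h2 (hcond a ha0 (by omega) (by omega))
      _ = (Y : ℝ) * Y := by
          rw [← sum_mul_sum, sum_ite_mem, hYN]; simp
      _ ≤ _ := by
          have h1 : (Y : ℝ) ≤ ((3 * N : ℕ) : ℝ) / ((max g h : ℕ) : ℝ) := Nat.cast_div_le
          have h2 : (Y : ℝ) * Y ≤ (((3 * N : ℕ) : ℝ) / ((max g h : ℕ) : ℝ)) *
            (((3 * N : ℕ) : ℝ) / ((max g h : ℕ) : ℝ)) := by gcongr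
          refine h2.trans (le_of_eq ?_)
          push_cast
          ring
  refine (sum_le_sum fun g hg => sum_le_sum fun h hh => inner g hg h hh).trans ?_
  simp only [← mul_sum]
  have := sum_inv_max_sq_le (3 * N)
  calc _ ≤ 9 * (N : ℝ) ^ 2 * (2 * (1 + Real.log ((3 * N : ℕ) : ℝ))) := by gcongr
    _ = _ := by ring

/-- Each term is at most h/N and there are at most 3N/h of them. The bounded ratio of the window's
ends replaces a logarithm by a constant. -/
theorem sum_inv_window_le {N h : ℕ} (hN : 0 < N) (hh : 0 < h) (K : ℕ) :
    ∑ a ∈ Ioc 0 K, (if h * a ∈ Ioc N (3 * N) then (1 : ℝ) / a else 0) ≤ 3 := by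
  have hN' : (0 : ℝ) < N := by exact_mod_cast hN
  have hh' : (0 : ℝ) < h := by exact_mod_cast hh
  calc _ ≤ ∑ a ∈ Ioc 0 K, (if a ∈ Ioc 0 (3 * N / h) then (h : ℝ) / N else 0) := by
        refine sum_le_sum fun a ha => ?_
        have ha0 := (mem_Ioc.1 ha).1
        by_cases h1 : h * a ∈ Ioc N (3 * N)
        · have h1' := mem_Ioc.1 h1
          rw [if_pos h1, if_pos (mem_Ioc.2 ⟨ha0, (Nat.le_div_iff_mul_le hh).2
            (by rw [mul_comm]; exact h1'.2)⟩)]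
          rw [div_le_div_iff₀ (by exact_mod_cast ha0) hN', one_mul]
          exact_mod_cast h1'.1.le
        · rw [if_neg h1]; split_ifs <;> positivity
    _ ≤ ∑ a ∈ Ioc 0 (3 * N / h), (h : ℝ) / N := by
        rw [sum_ite_mem]
        exact sum_le_sum_of_subset_of_nonneg inter_subset_right fun _ _ _ => by positivity
    _ = ((3 * N / h : ℕ) : ℝ) * (h / N) := by simp
    _ ≤ (((3 * N : ℕ) : ℝ) / h) * (h / N) := by gcongr; exact Nat.cast_div_le
    _ = 3 := by push_cast; field_simp

theorem sum_mul_eq_mul_inv_le {N : ℕ} (hN : 0 < N) :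
    ∑ x ∈ Ioc 0 N ×ˢ Ioc N (3 * N), ∑ y ∈ Ioc 0 N ×ˢ Ioc N (3 * N),
      (if x.1 * x.2 = y.1 * y.2 then 1 / ((x.1 * x.2 : ℕ) : ℝ) else 0) ≤
      9 * (1 + Real.log ((3 * N : ℕ) : ℝ)) ^ 2 := by
  rw [sum_mul_eq_mul (Ioc 0 N) (Ioc N (3 * N)) (3 * N) (Ioc_subset_Ioc_right (by omega))
    (Ioc_subset_Ioc_left (Nat.zero_le _)) (fun d n _ _ => 1 / ((d * n : ℕ) : ℝ))]
  have inner : ∀ g ∈ Ioc 0 (3 * N), ∀ h ∈ Ioc 0 (3 * N),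
      (∑ a ∈ Ioc 0 (3 * N), ∑ b ∈ Ioc 0 (3 * N),
        if a.Coprime b ∧ (g * a ∈ Ioc 0 N ∧ g * b ∈ Ioc 0 N) ∧ h * b ∈ Ioc N (3 * N) ∧
          h * a ∈ Ioc N (3 * N) then 1 / ((g * a * (h * b) : ℕ) : ℝ) else 0) ≤
      9 * ((1 / g) * (1 / h)) := by
    intro g hg h hh
    have hh0 := (mem_Ioc.1 hh).1
    have hw := sum_inv_window_le hN hh0 (3 * N)
    have hw0 : 0 ≤ ∑ a ∈ Ioc 0 (3 * N), (if h * a ∈ Ioc N (3 * N) then (1 : ℝ) / a else 0) :=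
      sum_nonneg fun _ _ => by split_ifs <;> positivity
    calc _ ≤ ∑ a ∈ Ioc 0 (3 * N), ∑ b ∈ Ioc 0 (3 * N),
          (if h * a ∈ Ioc N (3 * N) then (1 : ℝ) / a else 0) *
            (if h * b ∈ Ioc N (3 * N) then (1 : ℝ) / b else 0) * ((1 / g) * (1 / h)) := by
          refine sum_le_sum fun a ha => sum_le_sum fun b hb => ?_
          split_ifs with h1 h2 h3 h3
          · push_cast
            simp only [div_eq_mul_inv, mul_inv]
            apply le_of_eq
            ring
          · exact absurd h1.2.2.1 h3
          · exact absurd h1.2.2.2 h2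
          · exact absurd h1.2.2.2 h2
          all_goals positivity
      _ = (∑ a ∈ Ioc 0 (3 * N), (if h * a ∈ Ioc N (3 * N) then (1 : ℝ) / a else 0)) *
          (∑ b ∈ Ioc 0 (3 * N), (if h * b ∈ Ioc N (3 * N) then (1 : ℝ) / b else 0)) *
            ((1 / g) * (1 / h)) := by
          rw [sum_mul_sum, sum_mul]
          exact sum_congr rfl fun _ _ => by rw [sum_mul]
      _ ≤ 9 * ((1 / g) * (1 / h)) := by
          refine mul_le_mul_of_nonneg_right ?_ (by positivity)
          nlinarith
  refine (sum_le_sum fun g hg => sum_le_sum fun h hh => inner g hg h hh).trans ?_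
  simp only [← mul_sum, ← sum_mul]
  have h3 := sum_Ioc_inv_le (3 * N)
  have h4 : 0 ≤ ∑ k ∈ Ioc 0 (3 * N), (1 : ℝ) / k := sum_nonneg fun _ _ => by positivity
  rw [sq]
  gcongr

/-! ### Mean values of Dirichlet polynomials with cut-offs -/

section MeanValue
open MeasureTheory Complex

theorem integrable_cutoff_exp (τ l A B : ℝ) :
    IntervalIntegrable (fun t : ℝ => if τ < t then cexp (-(t * l) * I) else 0) volume A B := by
  have h : (fun t : ℝ => if τ < t then cexp (-(t * l) * I) else 0) =
      (Set.Ioi τ).indicator (fun t : ℝ => cexp (-(t * l) * I)) := by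
    ext t; simp [Set.indicator_apply]
  rw [h, intervalIntegrable_iff]
  refine Integrable.indicator ?_ measurableSet_Ioi
  rw [← IntegrableOn, ← intervalIntegrable_iff]
  exact Continuous.intervalIntegrable (by fun_prop) _ _

theorem norm_cutoff_exp_le (τ l t : ℝ) : ‖(if τ < t then cexp (-(t * l) * I) else 0)‖ ≤ 1 := by
  split_ifs
  · have : -(t * l) * I = ((-(t * l) : ℝ) : ℂ) * I := by push_cast; ring
    rw [this, norm_exp_ofReal_mul_I]
  · simp

theorem norm_integral_cutoff_exp_le_length {τ l A B : ℝ} (hAB : A ≤ B) :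
    ‖∫ t in A..B, (if τ < t then cexp (-(t * l) * I) else 0)‖ ≤ B - A := by
  refine (intervalIntegral.norm_integral_le_of_norm_le_const
    (fun t _ => norm_cutoff_exp_le τ l t)).trans ?_
  rw [one_mul, abs_of_nonneg (by linarith)]

/-- A cut-off only moves the lower end of integration, so the usual bound for an oscillating
exponential survives, uniformly in τ. -/
theorem norm_integral_cutoff_exp_le {τ l A B : ℝ} (hl : l ≠ 0) (hAB : A ≤ B) :
    ‖∫ t in A..B, (if τ < t then cexp (-(t * l) * I) else 0)‖ ≤ 2 / |l| := by
  have h : (fun t : ℝ => if τ < t then cexp (-(t * l) * I) else 0) =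
      (Set.Ioi τ).indicator (fun t : ℝ => cexp (-(t * l) * I)) := by
    ext t; simp [Set.indicator_apply]
  rw [h, intervalIntegral.integral_of_le hAB, setIntegral_indicator measurableSet_Ioi,
    Set.Ioc_inter_Ioi]
  rcases le_total (A ⊔ τ) B with h1 | h1
  · rw [← intervalIntegral.integral_of_le h1]
    have h2 : (fun t : ℝ => cexp (-(t * l) * I)) = fun t : ℝ => cexp (-(l * I) * t) := by
      ext t; ring_nf
    have hc : -((l : ℂ) * I) ≠ 0 := by simp [hl]
    rw [h2, integral_exp_mul_complex hc, norm_div]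
    have h3 : ∀ x : ℝ, ‖cexp (-(l * I) * x)‖ = 1 := fun x => by
      have : -(l * I) * x = ((-(l * x) : ℝ) : ℂ) * I := by push_cast; ring
      rw [this, norm_exp_ofReal_mul_I]
    have h4 : ‖-((l : ℂ) * I)‖ = |l| := by simp
    rw [h4]
    gcongr
    refine (norm_sub_le _ _).trans ?_
    rw [h3, h3]; norm_num
  · rw [Set.Ioc_eq_empty (not_lt.2 h1)]
    simp only [Measure.restrict_empty, integral_zero_measure, norm_zero]
    positivity

/-- For m < n, log(n/m) ≥ 1 − m/n, and 2/(1 − m/n) = 2 + 2m/(n − m). Replacing m by √(mn) gives a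
symmetric weight, ready for the arithmetic-geometric mean inequality. -/
theorem two_div_abs_log_sub_log_le {m n : ℕ} (hm : 0 < m) (hn : 0 < n) (h : m ≠ n) :
    2 / |Real.log m - Real.log n| ≤ 2 + 2 * (√m * √n * (1 / |(m : ℝ) - n|)) := by
  wlog hlt : m < n generalizing m n with H
  · have := H hn hm h.symm (by omega)
    rwa [abs_sub_comm, abs_sub_comm (n : ℝ), mul_comm (√(n : ℝ))] at this
  have hm' : (0 : ℝ) < m := by exact_mod_cast hm
  have hn' : (0 : ℝ) < n := by exact_mod_cast hn
  have hlt' : (m : ℝ) < n := by exact_mod_cast hlt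
  have h1 : 1 - (m : ℝ) / n ≤ Real.log n - Real.log m := by
    have := Real.one_sub_inv_le_log_of_pos (div_pos hn' hm')
    rwa [inv_div, Real.log_div hn'.ne' hm'.ne'] at this
  have h2 : 0 < 1 - (m : ℝ) / n := by rw [sub_pos, div_lt_one hn']; exact hlt'
  rw [abs_sub_comm, abs_of_pos (h2.trans_le h1), abs_sub_comm, abs_of_pos (sub_pos.2 hlt')]
  have h3 : 2 / (Real.log n - Real.log m) ≤ 2 / (1 - (m : ℝ) / n) := by gcongr
  have h4 : 2 / (1 - (m : ℝ) / n) = 2 + 2 * (m * (1 / ((n : ℝ) - m))) := by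
    have : (n : ℝ) - m ≠ 0 := by linarith
    rw [one_sub_div hn'.ne']
    field_simp
    ring
  have h5 : (m : ℝ) ≤ √m * √n := by
    calc (m : ℝ) = √m * √m := (Real.mul_self_sqrt hm'.le).symm
      _ ≤ √m * √n := by gcongr
  have h6 : 0 < 1 / ((n : ℝ) - m) := by have := sub_pos.2 hlt'; positivity
  rw [h4] at h3
  refine h3.trans ?_
  gcongr

theorem sum_inv_abs_sub_le (m K : ℕ) :
    ∑ n ∈ Ioc 0 K, (if m = n then 0 else 1 / |(m : ℝ) - n|) ≤
      2 * (1 + Real.log ((max m K : ℕ) : ℝ)) := by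
  have h1 : ∀ n ∈ Ioc 0 K, (if m = n then 0 else 1 / |(m : ℝ) - n|) ≤
      ∑ j ∈ Ioc 0 (max m K), ((if m = n + j then (1 : ℝ) / j else 0) +
        (if n = m + j then (1 : ℝ) / j else 0)) := by
    intro n hn
    have hn' := mem_Ioc.1 hn
    have hnn : ∀ j ∈ Ioc 0 (max m K), 0 ≤ ((if m = n + j then (1 : ℝ) / j else 0) +
        (if n = m + j then (1 : ℝ) / j else 0)) := by
      intro j _
      have : (0 : ℝ) ≤ 1 / j := by positivity
      split_ifs <;> linarith
    split_ifs with h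
    · exact sum_nonneg hnn
    rcases Nat.lt_or_gt_of_ne h with hlt | hlt
    · have hj : n - m ∈ Ioc 0 (max m K) := by rw [mem_Ioc]; omega
      refine le_trans ?_ (single_le_sum hnn hj)
      rw [if_neg (by omega), if_pos (by omega), zero_add, Nat.cast_sub hlt.le, abs_sub_comm,
        abs_of_pos (by rw [sub_pos]; exact_mod_cast hlt)]
    · have hj : m - n ∈ Ioc 0 (max m K) := by rw [mem_Ioc]; omega
      refine le_trans ?_ (single_le_sum hnn hj)
      rw [if_pos (by omega), if_neg (by omega), add_zero, Nat.cast_sub hlt.le,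
        abs_of_pos (by rw [sub_pos]; exact_mod_cast hlt)]
  refine (sum_le_sum h1).trans ?_
  rw [sum_comm]
  have h2 : ∀ j ∈ Ioc 0 (max m K), ∑ n ∈ Ioc 0 K, ((if m = n + j then (1 : ℝ) / j else 0) +
        (if n = m + j then (1 : ℝ) / j else 0)) ≤ 2 * (1 / (j : ℝ)) := by
    intro j _
    have hj : (0 : ℝ) ≤ 1 / j := by positivity
    rw [sum_add_distrib, ← sum_filter, ← sum_filter, sum_const, sum_const, nsmul_eq_mul,
      nsmul_eq_mul]
    have c1 : ((Ioc 0 K).filter (fun n => m = n + j)).card ≤ 1 := by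
      rw [card_le_one]; intro a ha b hb; simp only [mem_filter] at ha hb; omega
    have c2 : ((Ioc 0 K).filter (fun n => n = m + j)).card ≤ 1 := by
      rw [card_le_one]; intro a ha b hb; simp only [mem_filter] at ha hb; omega
    have c1' : (((Ioc 0 K).filter (fun n => m = n + j)).card : ℝ) ≤ 1 := by exact_mod_cast c1
    have c2' : (((Ioc 0 K).filter (fun n => n = m + j)).card : ℝ) ≤ 1 := by exact_mod_cast c2
    nlinarith
  refine (sum_le_sum h2).trans ?_
  rw [← mul_sum]
  linarith [sum_Ioc_inv_le (max m K)]

/-- A weak Hilbert inequality, from xy ≤ (x² + y²)/2 and row sums of size log K. The lost logarithm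
is harmless in the application. -/
theorem sum_sum_div_abs_sub_le (K : ℕ) (x : ℕ → ℝ) :
    ∑ m ∈ Ioc 0 K, ∑ n ∈ Ioc 0 K, (if m = n then 0 else x m * x n * (1 / |(m : ℝ) - n|)) ≤
      2 * (1 + Real.log K) * ∑ m ∈ Ioc 0 K, x m ^ 2 := by
  have h1 : ∀ m ∈ Ioc 0 K, ∀ n ∈ Ioc 0 K,
      (if m = n then 0 else x m * x n * (1 / |(m : ℝ) - n|)) ≤
      (x m ^ 2 / 2) * (if m = n then 0 else 1 / |(m : ℝ) - n|) +
      (x n ^ 2 / 2) * (if n = m then 0 else 1 / |(n : ℝ) - m|) := by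
    intro m _ n _
    by_cases h : m = n
    · simp [h]
    · rw [if_neg h, if_neg h, if_neg (Ne.symm h), abs_sub_comm (n : ℝ)]
      have h2 : 0 ≤ 1 / |(m : ℝ) - n| := by positivity
      nlinarith [mul_nonneg (sq_nonneg (x m - x n)) h2]
  refine (sum_le_sum fun m hm => sum_le_sum fun n hn => h1 m hm n hn).trans ?_
  simp only [sum_add_distrib]
  rw [sum_comm (f := fun (m n : ℕ) => (x n ^ 2 / 2) * (if n = m then 0 else 1 / |(n : ℝ) - m|))]
  simp only [← mul_sum]
  have h2 : ∑ m ∈ Ioc 0 K, x m ^ 2 / 2 * ∑ n ∈ Ioc 0 K, (if m = n then 0 else 1 / |(m : ℝ) - n|) ≤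
      ∑ m ∈ Ioc 0 K, x m ^ 2 / 2 * (2 * (1 + Real.log K)) := by
    refine sum_le_sum fun m hm => ?_
    have := sum_inv_abs_sub_le m K
    rw [max_eq_right (mem_Ioc.1 hm).2] at this
    gcongr
  rw [← sum_mul] at h2
  have h3 : (∑ m ∈ Ioc 0 K, x m ^ 2 / 2) = (∑ m ∈ Ioc 0 K, x m ^ 2) / 2 := by
    rw [sum_div]
  rw [h3] at h2
  linarith

theorem sum_sum_fiber {ι : Type*} (I : Finset ι) (k : ι → ℕ) (S : Finset ℕ)
    (hk : ∀ i ∈ I, k i ∈ S) (c : ι → ℝ) (β : ℕ → ℕ → ℝ) :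
    ∑ i ∈ I, ∑ j ∈ I, c i * c j * β (k i) (k j) =
      ∑ m ∈ S, ∑ n ∈ S, (∑ i ∈ I with k i = m, c i) * (∑ j ∈ I with k j = n, c j) * β m n := by
  rw [← sum_fiberwise_of_maps_to hk]
  refine sum_congr rfl fun m _ => ?_
  simp only [sum_mul]
  rw [sum_comm (s := S)]
  refine sum_congr rfl fun i hi => ?_
  rw [← sum_fiberwise_of_maps_to hk]
  refine sum_congr rfl fun n _ => ?_
  rw [mul_sum, sum_mul]
  refine sum_congr rfl fun j hj => ?_
  rw [(mem_filter.1 hi).2, (mem_filter.1 hj).2]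

theorem norm_sq_cutoff_sum {ι : Type*} (I' : Finset ι) (l : ι → ℝ) (c : ι → ℂ) (τ : ι → ℝ) (t : ℝ) :
    ((‖∑ i ∈ I', (if τ i < t then c i * cexp (-(t * l i) * I) else 0)‖ ^ 2 : ℝ) : ℂ) =
      ∑ i ∈ I', ∑ j ∈ I', c i * (starRingEnd ℂ) (c j) *
        (if max (τ i) (τ j) < t then cexp (-(t * ((l i - l j : ℝ) : ℂ)) * I) else 0) := by
  rw [← Complex.normSq_eq_norm_sq, Complex.normSq_eq_conj_mul_self, mul_comm, map_sum, sum_mul_sum]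
  refine sum_congr rfl fun i _ => sum_congr rfl fun j _ => ?_
  by_cases h1 : τ i < t <;> by_cases h2 : τ j < t
  · rw [if_pos h1, if_pos h2, if_pos (max_lt h1 h2), map_mul, ← Complex.exp_conj]
    have : cexp (-(t * ((l i - l j : ℝ) : ℂ)) * I) =
        cexp (-(t * l i) * I) * cexp ((starRingEnd ℂ) (-(t * l j) * I)) := by
      rw [← Complex.exp_add]
      congr 1
      simp only [map_mul, map_neg, Complex.conj_ofReal, Complex.conj_I]
      push_cast; ring
    rw [this]; ring
  · rw [if_pos h1, if_neg h2, if_neg (fun h => h2 ((le_max_right _ _).trans_lt h))]; simp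
  · rw [if_neg h1, if_neg (fun h => h1 ((le_max_left _ _).trans_lt h))]; simp
  · rw [if_neg h1, if_neg (fun h => h1 ((le_max_left _ _).trans_lt h))]; simp

theorem intervalIntegrable_norm_sq_cutoff_sum {ι : Type*} (I' : Finset ι) (l : ι → ℝ) (c : ι → ℂ)
    (τ : ι → ℝ) (A B : ℝ) : IntervalIntegrable
      (fun t => ‖∑ i ∈ I', (if τ i < t then c i * cexp (-(t * l i) * I) else 0)‖ ^ 2)
      volume A B := by
  rw [intervalIntegrable_iff]
  have h : IntegrableOn (fun t => ((‖∑ i ∈ I', (if τ i < t then c i * cexp (-(t * l i) * I)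
      else 0)‖ ^ 2 : ℝ) : ℂ)) (Set.uIoc A B) volume := by
    simp only [norm_sq_cutoff_sum I' l c τ]
    exact integrable_finsetSum _ fun i _ => integrable_finsetSum _ fun j _ =>
      intervalIntegrable_iff.1 ((integrable_cutoff_exp _ _ _ _).const_mul _)
  exact h.re

/-- Expand the square: the diagonal k i = k j gives the length B − A, the constant part of the
off-diagonal bound gives 2K by Cauchy–Schwarz, and the rest is the weak Hilbert inequality. Indices
with equal k are grouped by absolute value, since their cut-offs may differ; cancellation within a
coefficient survives only if it is carried out before indexing. -/
theorem integral_norm_sq_cutoff_sum_le {ι : Type*} (I' : Finset ι) (k : ι → ℕ) (K : ℕ)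
    (hk : ∀ i ∈ I', k i ∈ Ioc 0 K) (c : ι → ℂ) (τ : ι → ℝ) {A B : ℝ} (hAB : A ≤ B) :
    ∫ t in A..B, ‖∑ i ∈ I', (if τ i < t then c i * cexp (-(t * Real.log (k i)) * I) else 0)‖ ^ 2 ≤
      ∑ m ∈ Ioc 0 K, (∑ i ∈ I' with k i = m, ‖c i‖) ^ 2 *
        (B - A + 2 * K + 4 * (1 + Real.log K) * m) := by
  set β : ℕ → ℕ → ℝ := fun m n => if m = n then B - A else
    2 + 2 * (√m * √n * (1 / |(m : ℝ) - n|)) with hβ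
  set C : ℕ → ℝ := fun m => ∑ i ∈ I' with k i = m, ‖c i‖ with hC
  have h1 : ((∫ t in A..B, ‖∑ i ∈ I', (if τ i < t then c i * cexp (-(t * Real.log (k i)) * I)
      else 0)‖ ^ 2 : ℝ) : ℂ) = ∑ i ∈ I', ∑ j ∈ I', c i * (starRingEnd ℂ) (c j) *
        ∫ t in A..B, (if max (τ i) (τ j) < t then
          cexp (-(t * ((Real.log (k i) - Real.log (k j) : ℝ) : ℂ)) * I) else 0) := by
    rw [← intervalIntegral.integral_ofReal]
    simp only [norm_sq_cutoff_sum I' (fun i => Real.log (k i)) c τ]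
    rw [intervalIntegral.integral_finsetSum]
    · refine sum_congr rfl fun i _ => ?_
      rw [intervalIntegral.integral_finsetSum]
      · refine sum_congr rfl fun j _ => ?_
        rw [intervalIntegral.integral_const_mul]
      · intro j _
        exact (integrable_cutoff_exp _ _ _ _).const_mul _
    · intro i _
      rw [intervalIntegrable_iff]
      exact integrable_finsetSum _ fun j _ =>
        intervalIntegrable_iff.1 ((integrable_cutoff_exp _ _ _ _).const_mul _)
  have h2 : ∫ t in A..B, ‖∑ i ∈ I', (if τ i < t then c i * cexp (-(t * Real.log (k i)) * I)
      else 0)‖ ^ 2 ≤ ∑ i ∈ I', ∑ j ∈ I', ‖c i‖ * ‖c j‖ * β (k i) (k j) := by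
    refine (le_abs_self _).trans ?_
    rw [← Real.norm_eq_abs, ← Complex.norm_real, h1]
    refine (norm_sum_le _ _).trans (sum_le_sum fun i hi => ?_)
    refine (norm_sum_le _ _).trans (sum_le_sum fun j hj => ?_)
    rw [norm_mul, norm_mul, RCLike.norm_conj]
    gcongr
    simp only [hβ]
    have hi' := (mem_Ioc.1 (hk i hi)).1
    have hj' := (mem_Ioc.1 (hk j hj)).1
    split_ifs with h
    · exact norm_integral_cutoff_exp_le_length hAB
    · refine (norm_integral_cutoff_exp_le ?_ hAB).trans (two_div_abs_log_sub_log_le hi' hj' h)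
      rw [sub_ne_zero]
      intro he
      have := Real.log_injOn_pos (Set.mem_Ioi.2 (by exact_mod_cast hi'))
        (Set.mem_Ioi.2 (by exact_mod_cast hj')) he
      exact h (by exact_mod_cast this)
  rw [sum_sum_fiber I' k _ hk (fun i => ‖c i‖) β] at h2
  refine h2.trans ?_
  have hC0 : ∀ m, 0 ≤ C m := fun m => sum_nonneg fun _ _ => norm_nonneg _
  have h3 : ∀ m ∈ Ioc 0 K, ∀ n ∈ Ioc 0 K, C m * C n * β m n ≤
      (if m = n then C m * C n * (B - A) else 0) + 2 * (C m * C n) +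
      2 * (if m = n then 0 else (√m * C m) * (√n * C n) * (1 / |(m : ℝ) - n|)) := by
    intro m _ n _
    have := mul_nonneg (hC0 m) (hC0 n)
    simp only [hβ]
    split_ifs
    · linarith
    · apply le_of_eq; ring
  have h4 := sum_sum_div_abs_sub_le K (fun m => √m * C m)
  have h5 : (∑ m ∈ Ioc 0 K, C m) ^ 2 ≤ K * ∑ m ∈ Ioc 0 K, C m ^ 2 := by
    have := sq_sum_le_card_mul_sum_sq (s := Ioc 0 K) (f := C)
    simpa using this
  have h6 : ∑ m ∈ Ioc 0 K, ∑ n ∈ Ioc 0 K, (if m = n then C m * C n * (B - A) else 0) =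
      ∑ m ∈ Ioc 0 K, C m ^ 2 * (B - A) := by
    refine sum_congr rfl fun m hm => ?_
    rw [sum_ite_eq, if_pos hm, sq]
  refine (sum_le_sum fun m hm => sum_le_sum fun n hn => h3 m hm n hn).trans ?_
  simp only [sum_add_distrib, ← mul_sum]
  have h9 : ∑ i ∈ Ioc 0 K, C i * ∑ j ∈ Ioc 0 K, C j = (∑ m ∈ Ioc 0 K, C m) ^ 2 := by
    rw [sq, sum_mul]
  rw [h6, h9]
  have h7 : ∑ m ∈ Ioc 0 K, (√(m : ℝ) * C m) ^ 2 = ∑ m ∈ Ioc 0 K, C m ^ 2 * m := by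
    refine sum_congr rfl fun m _ => ?_
    rw [mul_pow, Real.sq_sqrt (Nat.cast_nonneg m), mul_comm]
  rw [h7] at h4
  have h8 : ∑ m ∈ Ioc 0 K, C m ^ 2 * (B - A + 2 * K + 4 * (1 + Real.log K) * m) =
      ∑ m ∈ Ioc 0 K, C m ^ 2 * (B - A) + 2 * (K * ∑ m ∈ Ioc 0 K, C m ^ 2) +
      2 * (2 * (1 + Real.log K) * ∑ m ∈ Ioc 0 K, C m ^ 2 * m) := by
    simp only [mul_sum]
    rw [← sum_add_distrib, ← sum_add_distrib]
    exact sum_congr rfl fun m _ => by ring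
  rw [h8]
  linarith

end MeanValue

/-! ### The integrand on lines of slope one -/

section Line
open MeasureTheory Complex

/-- The point `p + v + i v` of the line of slope one through the real number `p`. -/
def diagPoint (p v : ℝ) : ℂ := ⟨p + v, v⟩

@[simp] theorem diagPoint_re (p v : ℝ) : (diagPoint p v).re = p + v := rfl
@[simp] theorem diagPoint_im (p v : ℝ) : (diagPoint p v).im = v := rfl

theorem exp_pi_div_four : cexp (Real.pi * I / 4) = ⟨√2 / 2, √2 / 2⟩ := by
  have : (Real.pi * I / 4 : ℂ) = ((Real.pi / 4 : ℝ) : ℂ) * I := by push_cast; ring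
  rw [this, Complex.exp_mul_I, ← Complex.ofReal_cos, ← Complex.ofReal_sin, Real.cos_pi_div_four,
    Real.sin_pi_div_four]
  apply Complex.ext <;> simp

theorem line_eq_diagPoint (p u : ℝ) :
    (p : ℂ) - u * cexp (Real.pi * I / 4) = diagPoint p (-(u * (√2 / 2))) := by
  rw [exp_pi_div_four]
  apply Complex.ext <;> simp [sub_eq_add_neg]

theorem diagPoint_mem_slitPlane {p : ℝ} (hp : 0 < p) (v : ℝ) : diagPoint p v ∈ slitPlane := by
  rw [mem_slitPlane_iff]
  by_cases h : v = 0
  · left; simp [h, hp]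
  · right; simpa using h

theorem normSq_diagPoint (p v : ℝ) : ‖diagPoint p v‖ ^ 2 = (p + v) ^ 2 + v ^ 2 := by
  rw [← Complex.normSq_eq_norm_sq, Complex.normSq_apply]; simp; ring

theorem div_two_le_norm_diagPoint (p v : ℝ) : p / 2 ≤ ‖diagPoint p v‖ := by
  have := normSq_diagPoint p v
  refine le_of_sq_le_sq ?_ (norm_nonneg _)
  rw [this]
  nlinarith [sq_nonneg (p + 2 * v)]

theorem norm_diagPoint_le {p : ℝ} (hp : 0 ≤ p) (v : ℝ) : ‖diagPoint p v‖ ≤ p + 2 * |v| := by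
  refine (Complex.norm_le_abs_re_add_abs_im _).trans ?_
  simp only [diagPoint_re, diagPoint_im]
  have := abs_add_le p v
  rw [abs_of_nonneg hp] at this
  linarith

theorem norm_log_diagPoint_le {a b p : ℝ} (ha : 0 < a) (hp : p ∈ Set.Icc a b) (v : ℝ) :
    ‖log (diagPoint p v)‖ ≤ b + 2 / a + Real.pi + 2 * |v| := by
  have hp0 : 0 < p := ha.trans_le hp.1
  have h1 := div_two_le_norm_diagPoint p v
  have h2 := norm_diagPoint_le hp0.le v
  have hpos : 0 < ‖diagPoint p v‖ := lt_of_lt_of_le (by linarith) h1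
  refine (Complex.norm_le_abs_re_add_abs_im _).trans ?_
  rw [Complex.log_re, Complex.log_im]
  have h3 := Complex.abs_arg_le_pi (diagPoint p v)
  have h4 : |Real.log ‖diagPoint p v‖| ≤ p + 2 * |v| + 2 / a := by
    have h6 : ‖diagPoint p v‖⁻¹ ≤ 2 / a := by
      rw [inv_le_comm₀ hpos (by positivity), inv_div]
      exact le_trans (by linarith [hp.1]) h1
    rw [abs_le]
    constructor
    · have h5 := Real.one_sub_inv_le_log_of_pos hpos
      have : 0 ≤ |v| := abs_nonneg v
      linarith
    · have h5 := Real.log_le_sub_one_of_pos hpos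
      have : 0 < 2 / a := by positivity
      linarith
  linarith [hp.2]

theorem norm_cpow_neg_le {x s : ℂ} (hx : x ≠ 0) {R K : ℝ} (hs : ‖s‖ ≤ R) (hK : ‖log x‖ ≤ K) :
    ‖x ^ (-s)‖ ≤ Real.exp (R * K) := by
  rw [cpow_def_of_ne_zero hx]
  refine (Complex.norm_exp_le_exp_norm _).trans (Real.exp_le_exp.2 ?_)
  rw [norm_mul, norm_neg, mul_comm]
  have := norm_nonneg s
  have := norm_nonneg (log x)
  gcongr
  linarith

theorem norm_exp_pi_sq_diagPoint (p v : ℝ) :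
    ‖cexp (Real.pi * I * diagPoint p v ^ 2)‖ = Real.exp (-(2 * Real.pi * (p + v) * v)) := by
  rw [Complex.norm_exp]
  congr 1
  simp [sq, mul_assoc]
  ring

/-- A Gaussian bound for the numerator, with an extra factor `‖log x‖` for the derivative. -/
theorem exists_norm_numerator_le {a : ℝ} (ha : 0 < a) (b R : ℝ) :
    ∃ C : ℝ, 0 < C ∧ ∀ p ∈ Set.Icc a b, ∀ v : ℝ, ∀ s : ℂ, ‖s‖ ≤ R →
      (1 + ‖log (diagPoint p v)‖) * ‖diagPoint p v ^ (-s)‖ *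
        ‖cexp (Real.pi * I * diagPoint p v ^ 2)‖ ≤ C * Real.exp (-v ^ 2) := by
  set K := b + 2 / a + Real.pi with hK
  -- The coefficient of |v| in the exponent: 2(R + 1) from the logarithm, 2π|b| from the cross term
  -- of x². One of the two available v² absorbs it by completing the square; the other is the
  -- Gaussian that remains.
  set Q := 2 * (R + 1) + 2 * Real.pi * |b| with hQ
  refine ⟨Real.exp ((R + 1) * K + Q ^ 2 / 4), Real.exp_pos _, ?_⟩
  intro p hp v s hs
  have hp0 : 0 < p := ha.trans_le hp.1
  have hx : diagPoint p v ≠ 0 := slitPlane_ne_zero (diagPoint_mem_slitPlane hp0 v)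
  have h1 := norm_log_diagPoint_le ha hp v
  have h2 := norm_cpow_neg_le hx hs h1
  have h3 : 1 + ‖log (diagPoint p v)‖ ≤ Real.exp (K + 2 * |v|) := by
    have := Real.add_one_le_exp (K + 2 * |v|)
    linarith
  rw [norm_exp_pi_sq_diagPoint]
  calc _ ≤ Real.exp (K + 2 * |v|) * Real.exp (R * (K + 2 * |v|)) *
        Real.exp (-(2 * Real.pi * (p + v) * v)) := by gcongr
    _ = Real.exp ((R + 1) * (K + 2 * |v|) - 2 * Real.pi * (p + v) * v) := by
      rw [← Real.exp_add, ← Real.exp_add]; congr 1; ring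
    _ ≤ Real.exp ((R + 1) * K + Q ^ 2 / 4 + -v ^ 2) := by
      apply Real.exp_le_exp.2
      have h4 : -(2 * Real.pi * p * v) ≤ 2 * Real.pi * |b| * |v| := by
        have h5 : |2 * Real.pi * p * v| ≤ 2 * Real.pi * |b| * |v| := by
          rw [abs_mul, abs_of_pos (by positivity : 0 < 2 * Real.pi * p)]
          have : p ≤ |b| := hp.2.trans (le_abs_self b)
          gcongr
        exact (neg_le_abs _).trans h5
      have h6 : Q * |v| ≤ v ^ 2 + Q ^ 2 / 4 := by
        nlinarith [sq_nonneg (|v| - Q / 2), sq_abs v]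
      have h7 : v ^ 2 + v ^ 2 ≤ 2 * Real.pi * v ^ 2 := by
        nlinarith [sq_nonneg v, Real.pi_gt_three]
      nlinarith
    _ = _ := by rw [Real.exp_add]

theorem normSq_exp_sub_exp (a b : ℝ) :
    ‖cexp (I * ⟨a, b⟩) - cexp (-(I * ⟨a, b⟩))‖ ^ 2 =
      2 * Real.cosh (2 * b) - 2 * Real.cos (2 * a) := by
  have h : I * (⟨a, b⟩ : ℂ) = ⟨-b, a⟩ := by apply Complex.ext <;> simp
  rw [h, ← Complex.normSq_eq_norm_sq, Complex.normSq_apply]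
  simp only [sub_re, sub_im, exp_re, exp_im, neg_re, neg_im, Real.cos_neg, Real.sin_neg, neg_neg]
  rw [Real.cosh_two_mul, Real.cos_two_mul, Real.cosh_eq, Real.sinh_eq]
  have h1 := Real.sin_sq_add_cos_sq a
  have h2 : Real.sin a ^ 2 = 1 - Real.cos a ^ 2 := by linarith
  have h3 : Real.exp b * Real.exp (-b) = 1 := by rw [← Real.exp_add]; simp
  ring_nf
  rw [h2]
  ring_nf
  nlinarith

theorem norm_denominator_sq (p v : ℝ) :
    ‖cexp (Real.pi * I * diagPoint p v) - cexp (-(Real.pi * I * diagPoint p v))‖ ^ 2 =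
      2 * Real.cosh (2 * (Real.pi * v)) - 2 * Real.cos (2 * (Real.pi * (p + v))) := by
  rw [← normSq_exp_sub_exp]
  have : Real.pi * I * diagPoint p v = I * ⟨Real.pi * (p + v), Real.pi * v⟩ := by
    apply Complex.ext <;> simp [diagPoint]
  rw [this]

theorem one_add_sq_div_two_le_cosh (x : ℝ) : 1 + x ^ 2 / 2 ≤ Real.cosh x := by
  have h1 : Real.cosh x = 1 + 2 * Real.sinh (|x| / 2) ^ 2 := by
    rw [← Real.cosh_abs, show |x| = 2 * (|x| / 2) by ring, Real.cosh_two_mul, Real.cosh_sq]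
    simp only [mul_div_cancel_left₀ _ (two_ne_zero' ℝ)]
    ring
  have h2 : |x| / 2 ≤ Real.sinh (|x| / 2) := Real.self_le_sinh_iff.2 (by positivity)
  have h3 : (|x| / 2) ^ 2 ≤ Real.sinh (|x| / 2) ^ 2 := by gcongr
  rw [h1]
  have : x ^ 2 = |x| ^ 2 := (sq_abs x).symm
  nlinarith

/-- On a half-integer line the cosine changes sign, so the square of the norm is 2 cosh(2πv) + 2
cos(2πv), and the quadratic terms of the two lower bounds cancel. -/
theorem two_le_norm_denominator (n : ℕ) (v : ℝ) :
    2 ≤ ‖cexp (Real.pi * I * diagPoint (n + 1 / 2) v) -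
      cexp (-(Real.pi * I * diagPoint (n + 1 / 2) v))‖ := by
  refine le_of_sq_le_sq ?_ (norm_nonneg _)
  rw [norm_denominator_sq]
  have h1 : Real.cos (2 * (Real.pi * (n + 1 / 2 + v))) = -Real.cos (2 * Real.pi * v) := by
    have : 2 * (Real.pi * (n + 1 / 2 + v)) = 2 * Real.pi * v + Real.pi + n * (2 * Real.pi) := by ring
    rw [this, Real.cos_add_nat_mul_two_pi, Real.cos_add_pi]
  rw [h1]
  have h2 := one_add_sq_div_two_le_cosh (2 * (Real.pi * v))
  have h3 := Real.one_sub_sq_div_two_le_cos (x := 2 * Real.pi * v)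
  nlinarith

theorem two_le_norm_denominator_of_one_le (p : ℝ) {v : ℝ} (hv : 1 ≤ |v|) :
    2 ≤ ‖cexp (Real.pi * I * diagPoint p v) - cexp (-(Real.pi * I * diagPoint p v))‖ := by
  refine le_of_sq_le_sq ?_ (norm_nonneg _)
  rw [norm_denominator_sq]
  have h2 := one_add_sq_div_two_le_cosh (2 * (Real.pi * v))
  have h3 := Real.cos_le_one (2 * (Real.pi * (p + v)))
  have h4 : 1 ≤ v ^ 2 := by rw [← sq_abs]; nlinarith
  nlinarith [Real.pi_gt_three, mul_le_mul h4 (by nlinarith [Real.pi_gt_three] : (9:ℝ) ≤ Real.pi ^ 2) (by norm_num) (by positivity)]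

end Line

/-! ### The integral over a half-integer line is an entire function -/

section Line
open MeasureTheory Complex

/-- The integral of Riemann's integrand over the line of slope one through the real number `p`. -/
noncomputable def siegelIntegral (p : ℝ) (s : ℂ) : ℂ :=
  ∫ u : ℝ, riemannAuxIntegrand s (p - u * cexp (Real.pi * I / 4)) * (-cexp (Real.pi * I / 4))

theorem riemannAux_eq_siegelIntegral (s : ℂ) : riemannAux s = siegelIntegral (1 / 2) s := by
  simp only [riemannAux, siegelIntegral, siegelLine]
  push_cast
  rfl

theorem norm_exp_pi_div_four : ‖cexp (Real.pi * I / 4)‖ = 1 := by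
  have : (Real.pi * I / 4 : ℂ) = ((Real.pi / 4 : ℝ) : ℂ) * I := by push_cast; ring
  rw [this, norm_exp_ofReal_mul_I]

theorem exists_norm_integrand_le (n : ℕ) (R : ℝ) :
    ∃ C : ℝ, 0 < C ∧ ∀ v : ℝ, ∀ s : ℂ, ‖s‖ ≤ R →
      (1 + ‖log (diagPoint (n + 1 / 2) v)‖) * ‖riemannAuxIntegrand s (diagPoint (n + 1 / 2) v)‖ ≤
        C * Real.exp (-v ^ 2) := by
  obtain ⟨C, hC, h⟩ := exists_norm_numerator_le (a := n + 1 / 2) (by positivity) (n + 1 / 2) R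
  refine ⟨C, hC, fun v s hs => ?_⟩
  have h1 := h (n + 1 / 2) ⟨le_rfl, le_rfl⟩ v s hs
  have h2 := two_le_norm_denominator n v
  rw [riemannAuxIntegrand, norm_div, norm_mul, ← mul_div_assoc, ← mul_assoc]
  refine (div_le_self (by positivity) (by linarith)).trans h1

theorem exp_neg_sq_eq (u : ℝ) : Real.exp (-(-(u * (√2 / 2))) ^ 2) = Real.exp (-(1 / 2) * u ^ 2) := by
  congr 1
  have : √2 ^ 2 = 2 := Real.sq_sqrt (by norm_num)
  ring_nf
  rw [this]; ring

theorem continuous_diagPoint (p : ℝ) : Continuous (diagPoint p) := by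
  have : diagPoint p = fun v : ℝ => (p : ℂ) + v * (1 + I) := by
    ext v; apply Complex.ext <;> simp
  rw [this]; fun_prop

theorem continuous_integrand (n : ℕ) (s : ℂ) :
    Continuous fun v => riemannAuxIntegrand s (diagPoint (n + 1 / 2) v) := by
  have hc := continuous_diagPoint (n + 1 / 2)
  unfold riemannAuxIntegrand
  refine Continuous.div ?_ (by fun_prop) ?_
  · refine Continuous.mul ?_ (by fun_prop)
    exact hc.cpow continuous_const fun v => diagPoint_mem_slitPlane (by positivity) v
  · intro v h
    have := two_le_norm_denominator n v
    rw [h, norm_zero] at this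
    linarith

theorem siegelIntegral_eq (p : ℝ) (s : ℂ) : siegelIntegral p s =
    ∫ u : ℝ, riemannAuxIntegrand s (diagPoint p (-(u * (√2 / 2)))) *
      (-cexp (Real.pi * I / 4)) := by
  simp only [siegelIntegral, line_eq_diagPoint]

theorem differentiable_siegelIntegral (n : ℕ) : Differentiable ℂ (siegelIntegral (n + 1 / 2)) := by
  intro s₀
  obtain ⟨C, hC, h⟩ := exists_norm_integrand_le n (‖s₀‖ + 1)
  have hfun : siegelIntegral (n + 1 / 2) = fun s => ∫ u : ℝ,
      riemannAuxIntegrand s (diagPoint (n + 1 / 2) (-(u * (√2 / 2)))) *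
      (-cexp (Real.pi * I / 4)) := by
    ext s; exact siegelIntegral_eq _ s
  rw [hfun]
  set x : ℝ → ℂ := fun u => diagPoint (n + 1 / 2) (-(u * (√2 / 2))) with hx
  have hxc : Continuous x := (continuous_diagPoint _).comp (by fun_prop)
  have hxs : ∀ u, x u ∈ slitPlane := fun u => diagPoint_mem_slitPlane (by positivity) _
  have hcont : ∀ s, Continuous fun u => riemannAuxIntegrand s (x u) * (-cexp (Real.pi * I / 4)) :=
    fun s => ((continuous_integrand n s).comp (by fun_prop)).mul continuous_const
  have hbd : Integrable fun u : ℝ => C * Real.exp (-(1 / 2) * u ^ 2) :=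
    (integrable_exp_neg_mul_sq (by norm_num)).const_mul C
  refine (hasDerivAt_integral_of_dominated_loc_of_deriv_le (μ := volume)
    (F := fun s u => riemannAuxIntegrand s (x u) * (-cexp (Real.pi * I / 4)))
    (F' := fun s u => -log (x u) * (riemannAuxIntegrand s (x u) * (-cexp (Real.pi * I / 4))))
    (bound := fun u : ℝ => C * Real.exp (-(1 / 2) * u ^ 2))
    (Metric.ball_mem_nhds s₀ one_pos) ?_ ?_ ?_ ?_ hbd ?_).2.differentiableAt
  · exact Filter.Eventually.of_forall fun s => (hcont s).aestronglyMeasurable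
  · refine hbd.mono' (hcont s₀).aestronglyMeasurable (Filter.Eventually.of_forall fun u => ?_)
    have h1 := h (-(u * (√2 / 2))) s₀ (by linarith)
    rw [exp_neg_sq_eq] at h1
    rw [norm_mul, norm_neg, norm_exp_pi_div_four, mul_one]
    refine le_trans ?_ h1
    exact le_mul_of_one_le_left (norm_nonneg _) (by linarith [norm_nonneg (log (x u))])
  · refine Continuous.aestronglyMeasurable ?_
    exact (hxc.clog hxs).neg.mul (hcont s₀)
  · refine Filter.Eventually.of_forall fun u s hs => ?_
    have hs' : ‖s‖ ≤ ‖s₀‖ + 1 := by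
      have h2 : ‖s - s₀‖ < 1 := by simpa [dist_eq_norm] using hs
      have := norm_le_norm_add_norm_sub' s s₀
      linarith
    have h1 := h (-(u * (√2 / 2))) s hs'
    rw [exp_neg_sq_eq] at h1
    rw [norm_mul, norm_mul, norm_neg, norm_neg, norm_exp_pi_div_four, mul_one]
    refine le_trans ?_ h1
    gcongr
    simp [hx]
  · refine Filter.Eventually.of_forall fun u s _ => ?_
    have hne : x u ≠ 0 := slitPlane_ne_zero (hxs u)
    have h1 : HasDerivAt (fun s : ℂ => x u ^ (-s)) (x u ^ (-s) * log (x u) * -1) s :=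
      (hasDerivAt_neg s).const_cpow (Or.inl hne)
    unfold riemannAuxIntegrand
    refine (((h1.mul_const (cexp (Real.pi * I * x u ^ 2))).div_const
      (cexp (Real.pi * I * x u) - cexp (-(Real.pi * I * x u)))).mul_const
        (-cexp (Real.pi * I / 4))).congr_deriv ?_
    ring

theorem differentiable_riemannAux : Differentiable ℂ riemannAux := by
  have h := differentiable_siegelIntegral 0
  have e : riemannAux = siegelIntegral ((0 : ℕ) + 1 / 2) := by
    ext s; rw [riemannAux_eq_siegelIntegral]; norm_num
  rw [e]; exact h

end Line

/-! ### A residue theorem in a horizontal strip -/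

section Shift
open MeasureTheory Complex Filter Topology

theorem integrable_one_div_sq_add_sq {c : ℝ} (hc : 0 < c) :
    Integrable fun x : ℝ => (1 : ℝ) / (x ^ 2 + c ^ 2) := by
  have h : (fun x : ℝ => (1 : ℝ) / (x ^ 2 + c ^ 2)) =
      fun x => (1 / c ^ 2) * (1 + (x / c) ^ 2)⁻¹ := by
    ext x
    have : 0 < x ^ 2 + c ^ 2 := by positivity
    field_simp
    ring
  rw [h]
  exact (integrable_inv_one_add_sq.comp_div hc.ne').const_mul _

theorem integral_one_div_sq_add_sq {c : ℝ} (hc : 0 < c) :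
    ∫ x : ℝ, (1 : ℝ) / (x ^ 2 + c ^ 2) = Real.pi / c := by
  have h : ∀ x : ℝ, (1 : ℝ) / (x ^ 2 + c ^ 2) = (1 / c ^ 2) * (1 + (x / c) ^ 2)⁻¹ := by
    intro x
    have : 0 < x ^ 2 + c ^ 2 := by positivity
    field_simp
    ring
  simp only [h]
  rw [integral_const_mul, Measure.integral_comp_div (fun x : ℝ => (1 + x ^ 2)⁻¹),
    integral_univ_inv_one_add_sq, abs_of_pos hc, smul_eq_mul]
  field_simp

/-- The residue theorem for a horizontal strip and a simple pole at the origin. -/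
theorem integral_sub_integral_eq_residue {c : ℝ} (hc : 0 < c) {H : ℂ → ℂ}
    (hH : ∀ z : ℂ, |z.im| ≤ c → DifferentiableAt ℂ H z) {B : ℝ → ℝ} (hB : Tendsto B atTop (𝓝 0))
    (hdec : ∀ A : ℝ, 2 ≤ A → ∀ z : ℂ, |z.im| ≤ c → |z.re| = A → ‖H z / z‖ ≤ B A)
    (h1 : Integrable fun r : ℝ => H (r - c * I) / (r - c * I))
    (h2 : Integrable fun r : ℝ => H (r + c * I) / (r + c * I)) :
    (∫ r : ℝ, H (r - c * I) / (r - c * I)) - (∫ r : ℝ, H (r + c * I) / (r + c * I)) =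
      2 * Real.pi * I * H 0 := by
  have hD : ∀ z : ℂ, |z.im| ≤ c → DifferentiableAt ℂ (dslope H 0) z := by
    intro z hz
    by_cases h0 : z = 0
    · have hopen : {z : ℂ | |z.im| < c} ∈ 𝓝 (0 : ℂ) :=
        (isOpen_lt (by fun_prop) continuous_const).mem_nhds (by simpa using hc)
      have := (Complex.differentiableOn_dslope hopen).2
        (fun z hz => (hH z (le_of_lt hz)).differentiableWithinAt)
      rw [h0]
      exact this.differentiableAt hopen
    · exact (differentiableAt_dslope_of_ne h0).2 (hH z hz)
  have hval : ∀ z : ℂ, z ≠ 0 → dslope H 0 z = H z / z - H 0 * (1 / z) := by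
    intro z hz
    rw [dslope_of_ne _ hz, slope_def_field]
    simp only [sub_zero]; ring
  have hne : ∀ (r : ℝ) (y : ℝ), y ≠ 0 → (r : ℂ) + y * I ≠ 0 := by
    intro r y hy h
    have := congrArg Complex.im h
    simp at this
    exact hy this
  -- Neither 1/(r − ci) nor 1/(r + ci) is absolutely integrable, but their difference 2ci/(r² + c²)
  -- is. Subtracting H(0) times it removes the pole, and the remainder is a difference of boundary
  -- values of (H(z) − H(0))/z, holomorphic in the strip.
  set G : ℝ → ℂ := fun r => H (r - c * I) / (r - c * I) - H (r + c * I) / (r + c * I) -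
    H 0 * (2 * c * I) * ((1 / (r ^ 2 + c ^ 2) : ℝ) : ℂ) with hG
  have hint : Integrable fun r : ℝ => ((1 / (r ^ 2 + c ^ 2) : ℝ) : ℂ) :=
    (integrable_one_div_sq_add_sq hc).ofReal
  have hGi : Integrable G := (h1.sub h2).sub (hint.const_mul _)
  have hGint : ∫ r, G r = (∫ r : ℝ, H (r - c * I) / (r - c * I)) -
      (∫ r : ℝ, H (r + c * I) / (r + c * I)) - 2 * Real.pi * I * H 0 := by
    have : ∫ r : ℝ, ((1 / (r ^ 2 + c ^ 2) : ℝ) : ℂ) = ((Real.pi / c : ℝ) : ℂ) := by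
      rw [← integral_one_div_sq_add_sq hc]; exact integral_ofReal
    simp only [hG]
    have e1 := integral_sub (h1.sub h2) (hint.const_mul (H 0 * (2 * c * I)))
    simp only [Pi.sub_apply] at e1
    rw [e1, integral_sub h1 h2, integral_const_mul, this]
    have hc' : (c : ℂ) ≠ 0 := by exact_mod_cast hc.ne'
    push_cast
    field_simp
  have hlim := intervalIntegral_tendsto_integral hGi tendsto_neg_atTop_atBot tendsto_id
  have hGD : ∀ r : ℝ, G r = dslope H 0 (r + ((-c : ℝ) : ℂ) * I) - dslope H 0 (r + (c : ℂ) * I) := by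
    intro r
    rw [hval _ (hne r _ (by linarith)), hval _ (hne r c hc.ne')]
    have e1 : (r : ℂ) + ((-c : ℝ) : ℂ) * I = r - c * I := by push_cast; ring
    rw [e1]
    have n1 : (r : ℂ) - c * I ≠ 0 := by rw [← e1]; exact hne r _ (by linarith)
    have n2 := hne r c hc.ne'
    have n3 : ((r : ℂ) ^ 2 + (c : ℂ) ^ 2) ≠ 0 := by
      have : ((r : ℂ) ^ 2 + (c : ℂ) ^ 2) = ((r ^ 2 + c ^ 2 : ℝ) : ℂ) := by push_cast; ring
      rw [this]
      have : 0 < r ^ 2 + c ^ 2 := by positivity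
      exact_mod_cast this.ne'
    have key : (2 * c * I) * ((1 / (r ^ 2 + c ^ 2) : ℝ) : ℂ) =
        1 / (r - c * I) - 1 / (r + c * I) := by
      push_cast
      rw [div_sub_div _ _ n1 n2, mul_one_div, div_eq_div_iff n3 (mul_ne_zero n1 n2)]
      have : I ^ 2 = -1 := I_sq
      linear_combination (-(2 * c ^ 3 * I) : ℂ) * this
    simp only [hG]
    rw [mul_assoc (H 0), key]
    ring
  have hDc : ∀ y : ℝ, |y| ≤ c → Continuous fun r : ℝ => dslope H 0 ((r : ℂ) + y * I) := by
    intro y hy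
    rw [continuous_iff_continuousAt]
    intro r
    have : ContinuousAt (dslope H 0) ((r : ℂ) + y * I) := (hD _ (by simpa using hy)).continuousAt
    exact ContinuousAt.comp (f := fun r : ℝ => (r : ℂ) + y * I) this (by fun_prop)
  have hrect : ∀ A : ℝ, 0 ≤ A → ∫ r in (-A)..A, G r =
      I • (∫ y in (-c)..c, dslope H 0 (((-A : ℝ) : ℂ) + y * I)) -
      I • (∫ y in (-c)..c, dslope H 0 ((A : ℂ) + y * I)) := by
    intro A hA
    have h := Complex.integral_boundary_rect_eq_zero_of_differentiableOn (dslope H 0)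
      (⟨-A, -c⟩ : ℂ) (⟨A, c⟩ : ℂ) (by
        intro z hz
        have hz' := (mem_reProdIm.1 hz).2
        rw [Set.uIcc_of_le (by simpa using by linarith)] at hz'
        exact (hD z (abs_le.2 hz')).differentiableWithinAt)
    simp only at h
    simp only [hGD]
    rw [intervalIntegral.integral_sub]
    · linear_combination h
    · exact (hDc (-c) (by rw [abs_neg, abs_of_pos hc])).intervalIntegrable _ _
    · exact (hDc c (by rw [abs_of_pos hc])).intervalIntegrable _ _
  have hzero : Tendsto (fun A : ℝ => ∫ r in (-A)..A, G r) atTop (𝓝 0) := by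
    have hb : Tendsto (fun A : ℝ => 2 * ((B A + ‖H 0‖ * A⁻¹) * (2 * c))) atTop (𝓝 0) := by
      have := ((hB.add (tendsto_inv_atTop_zero.const_mul ‖H 0‖)).mul_const (2 * c)).const_mul 2
      simpa using this
    refine squeeze_zero_norm' ?_ hb
    filter_upwards [eventually_ge_atTop 2] with A hA
    rw [hrect A (by linarith)]
    have hbound : ∀ A' : ℝ, |A'| = A → ‖I • (∫ y in (-c)..c, dslope H 0 ((A' : ℂ) + y * I))‖ ≤
        (B A + ‖H 0‖ * A⁻¹) * (2 * c) := by
      intro A' hA'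
      rw [norm_smul, norm_I, one_mul]
      have : ∀ y ∈ Set.uIoc (-c) c, ‖dslope H 0 ((A' : ℂ) + y * I)‖ ≤ B A + ‖H 0‖ * A⁻¹ := by
        intro y hy
        rw [Set.uIoc_of_le (by linarith)] at hy
        have hre : ((A' : ℂ) + y * I).re = A' := by simp
        have him : ((A' : ℂ) + y * I).im = y := by simp
        have hnorm : A ≤ ‖(A' : ℂ) + y * I‖ := by
          have := abs_re_le_norm ((A' : ℂ) + y * I)
          rwa [hre, hA'] at this
        have hz : (A' : ℂ) + y * I ≠ 0 := by
          intro h; rw [h, norm_zero] at hnorm; linarith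
        rw [hval _ hz]
        refine (norm_sub_le _ _).trans (add_le_add ?_ ?_)
        · exact hdec A hA _ (by rw [him]; exact abs_le.2 ⟨hy.1.le, hy.2⟩) (by rw [hre, hA'])
        · rw [norm_mul, one_div, norm_inv]
          gcongr
      refine (intervalIntegral.norm_integral_le_of_norm_le_const this).trans ?_
      rw [sub_neg_eq_add, abs_of_pos (by linarith)]
      apply le_of_eq; ring
    refine (norm_sub_le _ _).trans ?_
    have b1 := hbound (-A) (by rw [abs_neg, abs_of_pos (by linarith)])
    have b2 := hbound A (abs_of_pos (by linarith))
    linarith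
  have := tendsto_nhds_unique hlim hzero
  rw [hGint] at this
  exact sub_eq_zero.1 this

end Shift

/-! ### Moving the line of integration across the integers -/

section Shift
open MeasureTheory Complex Filter Topology

theorem add_mul_eq_diagPoint (m : ℝ) (z : ℂ) : (m : ℂ) + cexp (Real.pi * I / 4) * z =
    diagPoint (m - √2 * z.im) (√2 / 2 * (z.re + z.im)) := by
  rw [exp_pi_div_four]
  apply Complex.ext <;> simp <;> ring

/-- The entire function `sin (π y) / y`. -/
noncomputable def sinPiDiv (y : ℂ) : ℂ := dslope (fun y : ℂ => sin (Real.pi * y)) 0 y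

theorem mul_sinPiDiv (y : ℂ) : y * sinPiDiv y = sin (Real.pi * y) := by
  have := sub_smul_dslope (fun y : ℂ => sin (Real.pi * y)) 0 y
  simpa [sinPiDiv] using this

theorem differentiable_sinPiDiv : Differentiable ℂ sinPiDiv := by
  intro y
  have := (Complex.differentiableOn_dslope (f := fun y : ℂ => sin (Real.pi * y)) (c := 0)
    (s := Set.univ) univ_mem).2 (by fun_prop)
  exact this.differentiableAt univ_mem

theorem sinPiDiv_zero : sinPiDiv 0 = Real.pi := by
  rw [sinPiDiv, dslope_same]
  have h : HasDerivAt (fun y : ℂ => sin (Real.pi * y)) (cos (Real.pi * 0) * (Real.pi * 1)) 0 :=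
    ((hasDerivAt_id (0 : ℂ)).const_mul (Real.pi : ℂ)).csin
  rw [h.deriv]; simp

/-- The only zeros are the nonzero integers, where |Re y − Im y| is at least 1. -/
theorem sinPiDiv_ne_zero {y : ℂ} (hy : |y.re - y.im| < 1) : sinPiDiv y ≠ 0 := by
  intro h
  have h1 := mul_sinPiDiv y
  rw [h, mul_zero, eq_comm, Complex.sin_eq_zero_iff] at h1
  obtain ⟨k, hk⟩ := h1
  have hpi : (Real.pi : ℂ) ≠ 0 := by exact_mod_cast Real.pi_ne_zero
  have h2 : y = k := mul_left_cancel₀ hpi (by rw [hk]; ring)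
  rw [h2] at hy
  simp only [intCast_re, intCast_im, sub_zero] at hy
  have h3 : |k| < 1 := by exact_mod_cast hy
  rw [Int.abs_lt_one_iff.1 h3, Int.cast_zero] at h2
  rw [h2, sinPiDiv_zero] at h
  exact hpi h

theorem denominator_eq (x : ℂ) :
    cexp (Real.pi * I * x) - cexp (-(Real.pi * I * x)) = 2 * I * sin (Real.pi * x) := by
  have h := Complex.two_sin (Real.pi * x)
  have e1 : -(Real.pi * x) * I = -(Real.pi * I * x) := by ring
  have e2 : Real.pi * x * I = Real.pi * I * x := by ring
  rw [e1, e2] at h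
  have : I ^ 2 = -1 := I_sq
  linear_combination (-I) * h + (cexp (Real.pi * I * x) - cexp (-(Real.pi * I * x))) * this

theorem exp_pi_mul_I_mul_sq (m : ℕ) : cexp (Real.pi * I * (m : ℂ) ^ 2) = (-1) ^ m := by
  have : Real.pi * I * (m : ℂ) ^ 2 = ((m ^ 2 : ℕ) : ℂ) * (Real.pi * I) := by push_cast; ring
  rw [this, Complex.exp_nat_mul, Complex.exp_pi_mul_I]
  rcases Nat.even_or_odd m with h | h
  · rw [h.neg_one_pow, (h.pow_of_ne_zero two_ne_zero).neg_one_pow]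
  · rw [h.neg_one_pow, h.pow.neg_one_pow]

theorem siegelIntegral_eq_strip (m κ : ℝ) (s : ℂ) : siegelIntegral (m - √2 * κ) s =
    -∫ r : ℝ, riemannAuxIntegrand s (m + cexp (Real.pi * I / 4) * (r + κ * I)) *
      cexp (Real.pi * I / 4) := by
  have h := integral_sub_left_eq_self (fun r : ℝ => riemannAuxIntegrand s
    (m + cexp (Real.pi * I / 4) * (r + κ * I)) * cexp (Real.pi * I / 4)) volume (-κ)
  rw [← h, ← integral_neg, siegelIntegral]
  congr 1
  ext u
  rw [mul_neg]
  congr 3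
  rw [line_eq_diagPoint, add_mul_eq_diagPoint]
  simp only [add_re, add_im, ofReal_re, ofReal_im, mul_re, mul_im, I_re, I_im]
  congr 1 <;> ring

theorem integrable_integrand (n : ℕ) (s : ℂ) {a b : ℝ} (ha : a ≠ 0) :
    Integrable fun r : ℝ => riemannAuxIntegrand s (diagPoint (n + 1 / 2) (a * (r + b))) := by
  obtain ⟨C, hC, h⟩ := exists_norm_integrand_le n ‖s‖
  have h1 : Integrable fun v : ℝ => riemannAuxIntegrand s (diagPoint (n + 1 / 2) v) := by
    have hb : Integrable fun v : ℝ => C * Real.exp (-1 * v ^ 2) :=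
      (integrable_exp_neg_mul_sq one_pos).const_mul C
    refine hb.mono' (continuous_integrand n s).aestronglyMeasurable
      (Eventually.of_forall fun v => ?_)
    have h2 := h v s le_rfl
    rw [neg_one_mul]
    refine le_trans ?_ h2
    exact le_mul_of_one_le_left (norm_nonneg _) (by linarith [norm_nonneg (log (diagPoint (n + 1 / 2) v))])
  exact (h1.comp_mul_left' ha).comp_add_right b

/-- The difference is the residue of the integrand at n + 1, its only pole between the two lines.
The factors (−1)^(n+1) from e^{πix²} and from the sine cancel. -/
theorem siegelIntegral_sub (n : ℕ) (s : ℂ) :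
    siegelIntegral (n + 1 / 2) s - siegelIntegral ((n + 1 : ℕ) + 1 / 2) s =
      ((n + 1 : ℕ) : ℂ) ^ (-s) := by
  set ω : ℂ := cexp (Real.pi * I / 4) with hω
  set m : ℝ := ((n + 1 : ℕ) : ℝ) with hm
  -- In the coordinate x = m + ωz the line Im z = κ crosses the real axis at m − √2 κ, so Im z =
  -- ±√2/4 are the lines through m ∓ 1/2.
  set c : ℝ := √2 / 4 with hc
  have h2 : √2 * √2 = 2 := Real.mul_self_sqrt (by norm_num)
  have hs0 : 0 < √2 := by positivity
  have hc0 : 0 < c := by positivity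
  have hω0 : ω ≠ 0 := Complex.exp_ne_zero _
  have hm1 : 1 ≤ m := by rw [hm]; push_cast; linarith [Nat.cast_nonneg (α := ℝ) n]
  set H : ℂ → ℂ := fun z => (m + ω * z) ^ (-s) * cexp (Real.pi * I * (m + ω * z) ^ 2) /
    ((-1) ^ (n + 1) * (2 * I) * sinPiDiv (ω * z)) with hH
  have hp : ∀ z : ℂ, |z.im| ≤ c → m - √2 * z.im ∈ Set.Icc (m - 1 / 2) (m + 1 / 2) := by
    intro z hz
    have := abs_le.1 hz
    constructor <;> nlinarith
  have hmem : ∀ z : ℂ, |z.im| ≤ c → (m : ℂ) + ω * z ∈ slitPlane := by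
    intro z hz
    rw [add_mul_eq_diagPoint]
    exact diagPoint_mem_slitPlane (by linarith [(hp z hz).1]) _
  have hSne : ∀ z : ℂ, |z.im| ≤ c → sinPiDiv (ω * z) ≠ 0 := by
    intro z hz
    apply sinPiDiv_ne_zero
    have e := add_mul_eq_diagPoint 0 z
    rw [ofReal_zero, zero_add] at e
    rw [hω, e, diagPoint_re, diagPoint_im, add_sub_cancel_right]
    have := abs_le.1 hz
    rw [abs_lt]
    constructor <;> nlinarith
  have hne1 : ((-1 : ℂ) ^ (n + 1)) ≠ 0 := pow_ne_zero _ (by norm_num)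
  have hdiff : ∀ z : ℂ, |z.im| ≤ c → DifferentiableAt ℂ H z := by
    intro z hz
    have d1 : DifferentiableAt ℂ (fun z : ℂ => (m : ℂ) + ω * z) z := by fun_prop
    refine DifferentiableAt.div ?_ ?_ ?_
    · exact (d1.cpow (differentiableAt_const _) (hmem z hz)).mul (by fun_prop)
    · exact (differentiableAt_const _).mul
        ((differentiable_sinPiDiv _).comp z (by fun_prop : DifferentiableAt ℂ (fun z => ω * z) z))
    · exact mul_ne_zero (mul_ne_zero hne1 (mul_ne_zero two_ne_zero I_ne_zero)) (hSne z hz)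
  have hval : ∀ z : ℂ, |z.im| ≤ c → z ≠ 0 → H z / z = riemannAuxIntegrand s (m + ω * z) * ω := by
    intro z hz hz0
    rw [riemannAuxIntegrand, denominator_eq]
    have e : (Real.pi : ℂ) * (m + ω * z) = Real.pi * (ω * z) + ((n + 1 : ℕ) : ℂ) * Real.pi := by
      rw [hm]; push_cast; ring
    rw [e, Complex.sin_antiperiodic.add_nat_mul_eq, ← mul_sinPiDiv]
    have := hSne z hz
    simp only [hH]
    have hI := I_ne_zero
    field_simp
  obtain ⟨C, hC, hbd⟩ := exists_norm_numerator_le (a := m - 1 / 2) (by linarith) (m + 1 / 2) ‖s‖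
  have hres := integral_sub_integral_eq_residue hc0 hdiff
    (B := fun A => C * Real.exp (-((A - 1) / 2))) (by
      have h3 : Tendsto (fun A : ℝ => -((A - 1) / 2)) atTop atBot := by
        apply tendsto_neg_atTop_atBot.comp
        apply Tendsto.atTop_div_const (by norm_num)
        exact tendsto_atTop_add_const_right _ _ tendsto_id
      have := (Real.tendsto_exp_atBot.comp h3).const_mul C
      simpa using this) (by
      intro A hA z hz hzA
      have hz0 : z ≠ 0 := by
        rintro rfl
        simp at hzA
        linarith
      rw [hval z hz hz0, norm_mul, hω, norm_exp_pi_div_four, mul_one, ← hω, add_mul_eq_diagPoint]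
      set v := √2 / 2 * (z.re + z.im) with hv
      have hv1 : √2 / 2 * (A - c) ≤ |v| := by
        rw [hv, abs_mul, abs_of_pos (by positivity : 0 < √2 / 2)]
        have : A - c ≤ |z.re + z.im| := by
          have := abs_sub_abs_le_abs_sub z.re (-z.im)
          rw [abs_neg, sub_neg_eq_add] at this
          linarith
        gcongr
      have hs1 : 1.4 < √2 := by
        rw [Real.lt_sqrt (by norm_num)]; norm_num
      have hs2 : √2 < 1.5 := by
        rw [Real.sqrt_lt' (by norm_num)]; norm_num
      have hv2 : 1 ≤ |v| := by
        refine le_trans ?_ hv1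
        have : (1.6 : ℝ) ≤ A - c := by rw [hc]; linarith
        nlinarith
      have hv3 : (A - 1) / 2 ≤ v ^ 2 := by
        rw [← sq_abs]
        have h5 : 0.7 * (A - 0.5) ≤ |v| := by
          refine le_trans ?_ hv1
          have : A - 0.5 ≤ A - c := by rw [hc]; linarith
          have h6 : (0.7 : ℝ) ≤ √2 / 2 := by linarith
          have : (0:ℝ) ≤ A - c := by rw [hc]; linarith
          nlinarith
        nlinarith
      have h4 := hbd _ (hp z hz) v s le_rfl
      have h5 := two_le_norm_denominator_of_one_le (m - √2 * z.im) hv2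
      rw [riemannAuxIntegrand, norm_div, norm_mul]
      refine (div_le_self (by positivity) (by linarith)).trans ?_
      have h6 : ‖diagPoint (m - √2 * z.im) v ^ (-s)‖ *
          ‖cexp (Real.pi * I * diagPoint (m - √2 * z.im) v ^ 2)‖ ≤ C * Real.exp (-v ^ 2) := by
        have h7 := mul_nonneg (norm_nonneg (log (diagPoint (m - √2 * z.im) v)))
          (mul_nonneg (norm_nonneg (diagPoint (m - √2 * z.im) v ^ (-s)))
            (norm_nonneg (cexp (Real.pi * I * diagPoint (m - √2 * z.im) v ^ 2))))
        nlinarith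
      refine h6.trans ?_
      gcongr)
  have hfun : ∀ κ : ℝ, |κ| ≤ c → κ ≠ 0 → (fun r : ℝ => H (r + κ * I) / (r + κ * I)) = fun r : ℝ =>
      riemannAuxIntegrand s (m + ω * (r + κ * I)) * ω := by
    intro κ hκ hκ0
    ext r
    apply hval
    · simpa using hκ
    · intro h
      have := congrArg Complex.im h
      simp at this
      exact hκ0 this
  have hcc : |c| ≤ c := (abs_of_pos hc0).le
  have hcc' : |-c| ≤ c := by rw [abs_neg]; exact hcc
  have f1 := hfun c hcc hc0.ne'
  have f2 := hfun (-c) hcc' (by linarith)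
  have e2 : ∀ r : ℝ, (r : ℂ) + ((-c : ℝ) : ℂ) * I = r - c * I := fun r => by push_cast; ring
  have hint : ∀ κ : ℝ, ∀ k : ℕ, m - √2 * κ = k + 1 / 2 →
      Integrable fun r : ℝ => riemannAuxIntegrand s (m + ω * (r + κ * I)) * ω := by
    intro κ k hk
    refine Integrable.mul_const ?_ _
    have := integrable_integrand k s (a := √2 / 2) (b := κ) (by positivity)
    refine this.congr (Eventually.of_forall fun r => ?_)
    simp only
    rw [add_mul_eq_diagPoint]
    simp [hk]
  have k1 : m - √2 * c = n + 1 / 2 := by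
    rw [hm, hc]; push_cast; linarith
  have k2 : m - √2 * (-c) = ((n + 1 : ℕ) : ℝ) + 1 / 2 := by
    rw [hc, ← hm]; linarith
  have i1 := hint c n k1
  have i2 := hint (-c) (n + 1) k2
  simp only [e2] at f2 i2
  have hfin := hres (by rw [f2]; exact i2) (by rw [f1]; exact i1)
  rw [f1, f2] at hfin
  have s1 := siegelIntegral_eq_strip m c s
  have s2 := siegelIntegral_eq_strip m (-c) s
  simp only [e2] at s2
  rw [k1] at s1
  rw [k2] at s2
  rw [s1, s2, sub_neg_eq_add, neg_add_eq_sub, hfin]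
  simp only [hH, mul_zero, add_zero, sinPiDiv_zero, hm, ofReal_natCast]
  rw [exp_pi_mul_I_mul_sq]
  have hpi : (Real.pi : ℂ) ≠ 0 := by exact_mod_cast Real.pi_ne_zero
  have hI := I_ne_zero
  field_simp

theorem riemannAux_eq_sum_add_siegelIntegral (n : ℕ) (s : ℂ) :
    riemannAux s = ∑ k ∈ Ioc 0 n, (k : ℂ) ^ (-s) + siegelIntegral (n + 1 / 2) s := by
  induction n with
  | zero => rw [riemannAux_eq_siegelIntegral]; norm_num
  | succ n ih =>
    rw [ih, ← Finset.insert_Ioc_right_eq_Ioc_add_one (Nat.zero_le n), sum_insert (by simp),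
      ← siegelIntegral_sub]
    ring

end Shift

/-! ### Estimate of the integral near the saddle point -/

section Saddle
open MeasureTheory Complex Filter Topology

theorem hasDerivAt_arg_diagPoint {p : ℝ} (hp : 0 < p) (v : ℝ) :
    HasDerivAt (fun v => arg (diagPoint p v)) (p / ((p + v) ^ 2 + v ^ 2)) v := by
  have hx : diagPoint p = fun v : ℝ => (p : ℂ) + v * (1 + I) := by
    ext v; apply Complex.ext <;> simp
  have h1 : HasDerivAt (diagPoint p) (1 + I) v := by
    rw [hx]
    have := ((hasDerivAt_id v).ofReal_comp.mul_const (1 + I)).const_add (p : ℂ)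
    simpa using this
  have h2 := h1.clog_real (diagPoint_mem_slitPlane hp v)
  have h3 := (imCLM.hasFDerivAt (x := log (diagPoint p v))).comp_hasDerivAt v h2
  have h4 : imCLM ((1 + I) / diagPoint p v) = p / ((p + v) ^ 2 + v ^ 2) := by
    rw [imCLM_apply, div_im, Complex.normSq_apply]
    simp only [diagPoint_re, diagPoint_im, add_re, add_im, one_re, one_im, I_re, I_im]
    rw [← sub_div]
    congr 1 <;> ring
  rw [h4] at h3
  have h5 : imCLM ∘ (fun t => log (diagPoint p t)) = fun v => arg (diagPoint p v) := by
    ext t; simp [log_im]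
  rwa [h5] at h3

/-- Up to the factor 2π the left side is log|x^(-s) e^{πix²}| with |x|^(-σ) left out, at height t =
2πξ². It vanishes at v = 0, and as p is within 1/2 of the saddle point ξ its slope there is bounded;
half of the quadratic term is kept for convergence. -/
theorem saddle_exponent_le {p ξ : ℝ} (hp : 1 / 2 ≤ p) (hξ : 0 < ξ) (h : |p - ξ| ≤ 1 / 2) (v : ℝ) :
    ξ ^ 2 * arg (diagPoint p v) - (p + v) * v ≤ 3 / 2 * |v| - v ^ 2 / 2 := by
  have hp0 : 0 < p := by linarith
  have hh := abs_le.1 h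
  have hq : ∀ v : ℝ, 0 < (p + v) ^ 2 + v ^ 2 := by
    intro v
    have := div_two_le_norm_diagPoint p v
    rw [← normSq_diagPoint]
    have : 0 < ‖diagPoint p v‖ := by linarith
    positivity
  -- The derivative is p + v − ξ²p/|x|². It suffices that it is at least −3/2 for v > 0, where |x| ≥
  -- p, and at most 3/2 for v < 0, where |x| ≤ p as long as p + v ≥ 0.
  set φ : ℝ → ℝ := fun v => (p + v) * v - v ^ 2 / 2 - ξ ^ 2 * arg (diagPoint p v) with hφ
  have hd : ∀ v, HasDerivAt φ (p + v - ξ ^ 2 * (p / ((p + v) ^ 2 + v ^ 2))) v := by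
    intro v
    have h1 : HasDerivAt (fun v : ℝ => (p + v) * v - v ^ 2 / 2) (p + v) v := by
      have := (((hasDerivAt_id v).const_add p).mul (hasDerivAt_id v)).sub
        (((hasDerivAt_id v).pow 2).div_const 2)
      refine this.congr_deriv ?_
      simp
    exact h1.sub ((hasDerivAt_arg_diagPoint hp0 v).const_mul _)
  have h0 : φ 0 = 0 := by
    have : diagPoint p 0 = (p : ℂ) := by apply Complex.ext <;> simp
    simp [hφ, this, arg_ofReal_of_nonneg hp0.le]
  have key : -(3 / 2 * |v|) ≤ φ v := by
    rcases le_total 0 v with hv | hv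
    · have hmono : MonotoneOn (fun v => φ v + 3 / 2 * v) (Set.Ici 0) := by
        have hd' : ∀ v, HasDerivAt (fun v => φ v + 3 / 2 * v)
            (p + v - ξ ^ 2 * (p / ((p + v) ^ 2 + v ^ 2)) + 3 / 2 * 1) v := fun v =>
          (hd v).add ((hasDerivAt_id v).const_mul _)
        refine monotoneOn_of_deriv_nonneg (convex_Ici 0)
          (fun v _ => (hd' v).continuousAt.continuousWithinAt)
          (fun v _ => (hd' v).differentiableAt.differentiableWithinAt) ?_
        intro v hv
        rw [interior_Ici] at hv
        have hv' : 0 < v := hv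
        rw [(hd' v).deriv]
        have h1 : ξ ^ 2 * (p / ((p + v) ^ 2 + v ^ 2)) ≤ p + 3 / 2 := by
          rw [mul_div_assoc', div_le_iff₀ (hq v)]
          have h2 : ξ ^ 2 ≤ (p + 1 / 2) ^ 2 := by nlinarith
          have h3 : (p + 3 / 2) * p ^ 2 ≤ (p + 3 / 2) * ((p + v) ^ 2 + v ^ 2) := by
            have : p ^ 2 ≤ (p + v) ^ 2 + v ^ 2 := by nlinarith
            gcongr
          nlinarith
        linarith
      have := hmono (Set.mem_Ici.2 le_rfl) (Set.mem_Ici.2 hv) hv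
      simp only [h0] at this
      rw [abs_of_nonneg hv]
      linarith
    · have hanti : AntitoneOn (fun v => φ v - 3 / 2 * v) (Set.Iic 0) := by
        have hd' : ∀ v, HasDerivAt (fun v => φ v - 3 / 2 * v)
            (p + v - ξ ^ 2 * (p / ((p + v) ^ 2 + v ^ 2)) - 3 / 2 * 1) v := fun v =>
          (hd v).sub ((hasDerivAt_id v).const_mul _)
        refine antitoneOn_of_deriv_nonpos (convex_Iic 0)
          (fun v _ => (hd' v).continuousAt.continuousWithinAt)
          (fun v _ => (hd' v).differentiableAt.differentiableWithinAt) ?_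
        intro v hv
        rw [interior_Iic] at hv
        have hv' : v < 0 := hv
        rw [(hd' v).deriv]
        have h1 : p + v - 3 / 2 ≤ ξ ^ 2 * (p / ((p + v) ^ 2 + v ^ 2)) := by
          rcases le_total (p + v) 0 with hpv | hpv
          · have : 0 ≤ ξ ^ 2 * (p / ((p + v) ^ 2 + v ^ 2)) := by
              have := hq v; positivity
            linarith
          · rw [mul_div_assoc', le_div_iff₀ (hq v)]
            rcases le_total (p + v - 3 / 2) 0 with h5 | h5
            · have : 0 ≤ ξ ^ 2 * p := by positivity
              nlinarith [hq v]
            · have h4 : (p + v) ^ 2 + v ^ 2 ≤ p ^ 2 := by nlinarith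
              have h6 : (p - 1 / 2) ^ 2 ≤ ξ ^ 2 := by
                apply pow_le_pow_left₀ <;> linarith
              calc (p + v - 3 / 2) * ((p + v) ^ 2 + v ^ 2) ≤ (p - 1) * p ^ 2 := by
                    have : p + v - 3 / 2 ≤ p - 1 := by linarith
                    have h7 := hq v
                    gcongr
                    linarith
                _ ≤ (p - 1 / 2) ^ 2 * p := by nlinarith
                _ ≤ _ := by gcongr
        linarith
      have := hanti (Set.mem_Iic.2 hv) (Set.mem_Iic.2 le_rfl) hv
      simp only [h0] at this
      rw [abs_of_nonpos hv]
      linarith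
  simp only [hφ] at key
  linarith

theorem exists_norm_siegelIntegral_le : ∃ C : ℝ, 0 < C ∧ ∀ (n : ℕ) (s : ℂ) (ξ : ℝ), 0 ≤ s.re →
    s.re ≤ 6 → 0 < ξ → s.im = 2 * Real.pi * ξ ^ 2 → |(n + 1 / 2 : ℝ) - ξ| ≤ 1 / 2 →
    ‖siegelIntegral (n + 1 / 2) s‖ ≤ C * (n + 1 / 2 : ℝ) ^ (-s.re) := by
  -- The factor 64 = 2⁶ comes from |x| ≥ p/2 and σ ≤ 6. The 20 bounds 3π|v| − (π − 1)v².
  refine ⟨64 * Real.exp 20 * ∫ u : ℝ, Real.exp (-(1 / 2) * u ^ 2), ?_, ?_⟩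
  · rw [integral_gaussian]; positivity
  intro n s ξ h0 h6 hξ him hn
  set p : ℝ := n + 1 / 2 with hp
  have hp2 : 1 / 2 ≤ p := by rw [hp]; linarith [Nat.cast_nonneg (α := ℝ) n]
  have hp0 : 0 < p := by linarith
  have hpt : ∀ v : ℝ, ‖riemannAuxIntegrand s (diagPoint p v)‖ ≤
      p ^ (-s.re) * (64 * Real.exp 20) * Real.exp (-v ^ 2) := by
    intro v
    have hx0 : diagPoint p v ≠ 0 := slitPlane_ne_zero (diagPoint_mem_slitPlane hp0 v)
    have hden := two_le_norm_denominator n v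
    have h1 : ‖diagPoint p v‖ ^ (-s.re) ≤ p ^ (-s.re) * 64 := by
      have h2 := div_two_le_norm_diagPoint p v
      calc ‖diagPoint p v‖ ^ (-s.re) ≤ (p / 2) ^ (-s.re) :=
            Real.rpow_le_rpow_of_nonpos (by positivity) h2 (by linarith)
        _ = p ^ (-s.re) * 2 ^ s.re := by
            rw [Real.div_rpow hp0.le (by norm_num), Real.rpow_neg (by norm_num : (0 : ℝ) ≤ 2)]
            field_simp
        _ ≤ p ^ (-s.re) * 64 := by
            have : (2 : ℝ) ^ s.re ≤ 2 ^ (6 : ℝ) :=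
              Real.rpow_le_rpow_of_exponent_le (by norm_num) h6
            have e : (2 : ℝ) ^ (6 : ℝ) = 64 := by norm_num
            rw [e] at this
            gcongr
    have h3 : Real.exp (-(arg (diagPoint p v) * (-s).im)) *
        Real.exp (-(2 * Real.pi * (p + v) * v)) ≤ Real.exp 20 * Real.exp (-v ^ 2) := by
      rw [← Real.exp_add, ← Real.exp_add]
      apply Real.exp_le_exp.2
      have h4 := saddle_exponent_le hp2 hξ hn v
      have h5 : 2 * Real.pi * (ξ ^ 2 * arg (diagPoint p v) - (p + v) * v) ≤
          2 * Real.pi * (3 / 2 * |v| - v ^ 2 / 2) := by gcongr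
      have h6 : 2 * Real.pi * (3 / 2 * |v| - v ^ 2 / 2) ≤ 20 - v ^ 2 := by
        have e1 := Real.pi_gt_three
        have e2 := Real.pi_lt_d2
        rw [← sq_abs]
        nlinarith [sq_nonneg (|v| - 2.3625), abs_nonneg v, sq_nonneg (|v|)]
      rw [neg_im, him]
      linarith
    rw [riemannAuxIntegrand, norm_div, norm_mul]
    refine (div_le_self (by positivity) (by linarith)).trans ?_
    rw [norm_cpow_of_ne_zero hx0, norm_exp_pi_sq_diagPoint, neg_re, div_eq_mul_inv, ← Real.exp_neg,
      mul_assoc]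
    calc _ ≤ (p ^ (-s.re) * 64) * (Real.exp 20 * Real.exp (-v ^ 2)) := by gcongr
      _ = _ := by ring
  rw [siegelIntegral_eq]
  have hbd : Integrable fun u : ℝ => p ^ (-s.re) * (64 * Real.exp 20) *
      Real.exp (-(1 / 2) * u ^ 2) := (integrable_exp_neg_mul_sq (by norm_num)).const_mul _
  refine (norm_integral_le_of_norm_le hbd (Eventually.of_forall fun u => ?_)).trans ?_
  · rw [norm_mul, norm_neg, norm_exp_pi_div_four, mul_one]
    have := hpt (-(u * (√2 / 2)))
    rwa [exp_neg_sq_eq] at this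
  · rw [integral_const_mul]
    apply le_of_eq; ring

end Saddle

/-! ### Coefficient sums that enter the mean squares -/

section Profile

/-- Immediate for σ ≥ 1/2. To the left of 1/2 one has m ≤ N·N², and (N²)^(1-2σ) ≤ N^(4/log N) = e⁴:
moving 1/log N past the critical line costs only a constant. -/
theorem rpow_one_sub_two_mul_le {N m : ℕ} (hN : 3 ≤ N) {σ : ℝ} (hσ : 1 / 2 - 1 / Real.log N ≤ σ)
    (h1 : N < m) (h2 : m ≤ 3 * N ^ 2) :
    (m : ℝ) ^ (1 - 2 * σ) ≤ Real.exp 4 * (N : ℝ) ^ (1 - 2 * σ) := by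
  have hN0 : (0 : ℝ) < N := by exact_mod_cast (by omega : 0 < N)
  have hNm : (N : ℝ) ≤ m := by exact_mod_cast h1.le
  have hL : 0 < Real.log N := Real.log_pos (by exact_mod_cast (by omega : 1 < N))
  rcases le_total (1 / 2) σ with h | h
  · have h3 : (m : ℝ) ^ (1 - 2 * σ) ≤ (N : ℝ) ^ (1 - 2 * σ) :=
      Real.rpow_le_rpow_of_nonpos hN0 hNm (by linarith)
    have h4 : 1 ≤ Real.exp 4 := Real.one_le_exp (by norm_num)
    have h5 : 0 ≤ (N : ℝ) ^ (1 - 2 * σ) := by positivity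
    nlinarith
  · have hm : (m : ℝ) ≤ N * (N : ℝ) ^ 2 := by
      have : m ≤ N * N ^ 2 := h2.trans (Nat.mul_le_mul_right _ hN)
      exact_mod_cast this
    have he : 0 ≤ 1 - 2 * σ := by linarith
    calc (m : ℝ) ^ (1 - 2 * σ) ≤ (N * (N : ℝ) ^ 2) ^ (1 - 2 * σ) := by gcongr
      _ = ((N : ℝ) ^ 2) ^ (1 - 2 * σ) * (N : ℝ) ^ (1 - 2 * σ) := by
          rw [Real.mul_rpow (by positivity) (by positivity), mul_comm]
      _ ≤ Real.exp 4 * (N : ℝ) ^ (1 - 2 * σ) := by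
          gcongr
          rw [Real.rpow_def_of_pos (by positivity), Real.log_pow]
          apply Real.exp_le_exp.2
          have : Real.log N * (1 - 2 * σ) ≤ 2 := by
            have h3 : 1 - 2 * σ ≤ 2 / Real.log N := by
              have : 2 / Real.log N = 2 * (1 / Real.log N) := by ring
              linarith
            calc Real.log N * (1 - 2 * σ) ≤ Real.log N * (2 / Real.log N) := by gcongr
              _ = 2 := by field_simp
          push_cast
          linarith

theorem one_le_log_of_three_le {N : ℕ} (hN : 3 ≤ N) : 1 ≤ Real.log N := by
  rw [Real.le_log_iff_exp_le (by exact_mod_cast (by omega : 0 < N))]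
  have : (3 : ℝ) ≤ N := by exact_mod_cast hN
  linarith [Real.exp_one_lt_d9]

theorem log_three_le : Real.log 3 ≤ 2 := by
  rw [Real.log_le_iff_le_exp (by norm_num)]
  have := Real.add_one_le_exp (2 : ℝ)
  linarith

theorem one_add_log_three_mul_le {N : ℕ} (hN : 3 ≤ N) :
    1 + Real.log ((3 * N : ℕ) : ℝ) ≤ 4 * Real.log N := by
  have h := one_le_log_of_three_le hN
  have hN0 : (N : ℝ) ≠ 0 := by exact_mod_cast (by omega : N ≠ 0)
  push_cast
  rw [Real.log_mul (by norm_num) hN0]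
  linarith [log_three_le]

theorem one_add_log_three_mul_sq_le {N : ℕ} (hN : 3 ≤ N) :
    1 + Real.log ((3 * N ^ 2 : ℕ) : ℝ) ≤ 5 * Real.log N := by
  have h := one_le_log_of_three_le hN
  have hN0 : (N : ℝ) ≠ 0 := by exact_mod_cast (by omega : N ≠ 0)
  push_cast
  rw [Real.log_mul (by norm_num) (pow_ne_zero _ hN0), Real.log_pow]
  push_cast
  linarith [log_three_le]

/-- Since Q lives on m > N, a factor N^(1-2σ) comes out of m^(1-2σ). The terms of size N² are paired
with `∑ Q²/m`, and the term proportional to m log N with `∑ Q²`; both yield N² log² N. The constant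
is 80 = (54 + 6) + 4·5. -/
theorem sum_profile_le {N : ℕ} (hN : 3 ≤ N) {σ : ℝ} (hσ : 1 / 2 - 1 / Real.log N ≤ σ)
    {Q : ℕ → ℝ} (hQ0 : ∀ m ≤ N, Q m = 0) {C : ℝ}
    (h1 : ∑ m ∈ Ioc 0 (3 * N ^ 2), Q m ^ 2 / m ≤ C * Real.log N ^ 2)
    (h2 : ∑ m ∈ Ioc 0 (3 * N ^ 2), Q m ^ 2 ≤ C * (N ^ 2 * Real.log N)) {W : ℝ} (hW0 : 0 ≤ W)
    (hW : W ≤ 54 * N ^ 2) :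
    ∑ m ∈ Ioc 0 (3 * N ^ 2), (Q m * (m : ℝ) ^ (-σ)) ^ 2 * (W + 2 * ((3 * N ^ 2 : ℕ) : ℝ) +
      4 * (1 + Real.log ((3 * N ^ 2 : ℕ) : ℝ)) * m) ≤
      80 * Real.exp 4 * C * ((N : ℝ) ^ (3 - 2 * σ) * Real.log N ^ 2) := by
  have hL := one_le_log_of_three_le hN
  have hN0 : (0 : ℝ) < N := by exact_mod_cast (by omega : 0 < N)
  have hlog := one_add_log_three_mul_sq_le hN
  have hterm : ∀ m ∈ Ioc 0 (3 * N ^ 2), (Q m * (m : ℝ) ^ (-σ)) ^ 2 *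
      (W + 2 * ((3 * N ^ 2 : ℕ) : ℝ) + 4 * (1 + Real.log ((3 * N ^ 2 : ℕ) : ℝ)) * m) ≤
      Real.exp 4 * (N : ℝ) ^ (1 - 2 * σ) *
        (60 * N ^ 2 * (Q m ^ 2 / m) + 20 * Real.log N * Q m ^ 2) := by
    intro m hm
    have hm' := mem_Ioc.1 hm
    have hm0 : (0 : ℝ) < m := by exact_mod_cast hm'.1
    rcases le_or_gt m N with hmN | hmN
    · rw [hQ0 m hmN]; simp
    · have e : (Q m * (m : ℝ) ^ (-σ)) ^ 2 = (m : ℝ) ^ (1 - 2 * σ) * (Q m ^ 2 / m) := by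
        rw [mul_pow, ← Real.rpow_natCast ((m : ℝ) ^ (-σ)), ← Real.rpow_mul hm0.le,
          Real.rpow_sub hm0, Real.rpow_one, Nat.cast_ofNat, show -σ * 2 = -(2 * σ) by ring,
          Real.rpow_neg hm0.le]
        field_simp
      rw [e]
      have h3 := rpow_one_sub_two_mul_le hN hσ hmN hm'.2
      calc _ ≤ (Real.exp 4 * (N : ℝ) ^ (1 - 2 * σ)) * (Q m ^ 2 / m) *
            (54 * N ^ 2 + 2 * (3 * N ^ 2) + 4 * (5 * Real.log N) * m) := by
            push_cast at hlog ⊢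
            have : 0 ≤ 1 + Real.log (3 * (N : ℝ) ^ 2) := by
              have : 0 ≤ Real.log (3 * (N : ℝ) ^ 2) := Real.log_nonneg (by
                have : (3 : ℝ) ≤ N := by exact_mod_cast hN
                nlinarith)
              linarith
            gcongr
        _ = _ := by field_simp; ring
  refine (sum_le_sum hterm).trans ?_
  rw [← mul_sum, sum_add_distrib, ← mul_sum, ← mul_sum]
  have e2 : (N : ℝ) ^ (3 - 2 * σ) = (N : ℝ) ^ (1 - 2 * σ) * (N : ℝ) ^ 2 := by
    rw [← Real.rpow_natCast, ← Real.rpow_add hN0]; congr 1; push_cast; ring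
  rw [e2]
  calc _ ≤ Real.exp 4 * (N : ℝ) ^ (1 - 2 * σ) * (60 * N ^ 2 * (C * Real.log N ^ 2) +
        20 * Real.log N * (C * (N ^ 2 * Real.log N))) := by gcongr
    _ = _ := by ring

/-- The number of factorisations `k = d n` with `d ∈ A` and `n ∈ B`. -/
noncomputable def pairCount (A B : Finset ℕ) (k : ℕ) : ℝ :=
  ∑ x ∈ A ×ˢ B with x.1 * x.2 = k, (1 : ℝ)

theorem pairCount_nonneg (A B : Finset ℕ) (k : ℕ) : 0 ≤ pairCount A B k :=
  sum_nonneg fun _ _ => zero_le_one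

theorem pairCount_mono {A B B' : Finset ℕ} (h : B ⊆ B') (k : ℕ) :
    pairCount A B k ≤ pairCount A B' k := by
  refine sum_le_sum_of_subset_of_nonneg ?_ fun _ _ _ => zero_le_one
  exact filter_subset_filter _ (product_subset_product_right h)

theorem abs_mollifiedCoeff_le (N k : ℕ) :
    |mollifiedCoeff N k| ≤ pairCount (Ioc 0 N) (Ioc 0 N) k := by
  refine (abs_sum_le_sum_abs _ _).trans (sum_le_sum fun x _ => ?_)
  exact_mod_cast abs_moebius_le_one

theorem sum_pairCount_sq_le {N : ℕ} (hN : 3 ≤ N) :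
    ∑ k ∈ Ioc 0 (3 * N ^ 2), pairCount (Ioc 0 N) (Ioc 0 (3 * N)) k ^ 2 ≤
      144 * (N ^ 2 * Real.log N) := by
  have hmaps : ∀ x ∈ Ioc 0 N ×ˢ Ioc 0 (3 * N), x.1 * x.2 ∈ Ioc 0 (3 * N ^ 2) := by
    intro x hx
    simp only [mem_product, mem_Ioc] at hx ⊢
    refine ⟨Nat.mul_pos hx.1.1 hx.2.1, ?_⟩
    calc x.1 * x.2 ≤ N * (3 * N) := Nat.mul_le_mul hx.1.2 hx.2.2
      _ = 3 * N ^ 2 := by ring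
  have h := sum_sq_fiber (Ioc 0 N ×ˢ Ioc 0 (3 * N)) (fun x => x.1 * x.2) _ hmaps
    (fun _ => 1) (fun _ => 1)
  simp only [mul_one] at h
  simp only [pairCount]
  rw [h]
  refine (card_mul_eq_mul_le N).trans ?_
  have := one_add_log_three_mul_le hN
  calc 18 * (N : ℝ) ^ 2 * (1 + Real.log ((3 * N : ℕ) : ℝ)) ≤
      18 * (N : ℝ) ^ 2 * (4 * Real.log N) := by gcongr
    _ ≤ _ := by
      have := one_le_log_of_three_le hN
      have : 0 ≤ (N : ℝ) ^ 2 * Real.log N := by positivity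
      linarith

theorem sum_pairCount_sq_div_le {N : ℕ} (hN : 3 ≤ N) :
    ∑ k ∈ Ioc 0 (3 * N ^ 2), pairCount (Ioc 0 N) (Ioc N (3 * N)) k ^ 2 / k ≤
      144 * Real.log N ^ 2 := by
  have hmaps : ∀ x ∈ Ioc 0 N ×ˢ Ioc N (3 * N), x.1 * x.2 ∈ Ioc 0 (3 * N ^ 2) := by
    intro x hx
    simp only [mem_product, mem_Ioc] at hx ⊢
    refine ⟨Nat.mul_pos hx.1.1 (by omega), ?_⟩
    calc x.1 * x.2 ≤ N * (3 * N) := Nat.mul_le_mul hx.1.2 hx.2.2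
      _ = 3 * N ^ 2 := by ring
  have h := sum_sq_fiber (Ioc 0 N ×ˢ Ioc N (3 * N)) (fun x => x.1 * x.2) _ hmaps
    (fun _ => 1) (fun k => 1 / (k : ℝ))
  simp only [mul_one, one_mul] at h
  simp only [pairCount, div_eq_mul_one_div (_ ^ 2)]
  rw [h]
  refine (sum_mul_eq_mul_inv_le (by omega)).trans ?_
  have h1 := one_add_log_three_mul_le hN
  have h2 : 0 ≤ 1 + Real.log ((3 * N : ℕ) : ℝ) := by
    have := Real.log_natCast_nonneg (3 * N)
    linarith
  calc 9 * (1 + Real.log ((3 * N : ℕ) : ℝ)) ^ 2 ≤ 9 * (4 * Real.log N) ^ 2 := by gcongr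
    _ = _ := by ring

/-- For k ≤ N no factorisation is cut off, so the coefficient is the full convolution of μ with 1.
-/
theorem mollifiedCoeff_eq {N k : ℕ} (hk : 0 < k) (hkN : k ≤ N) :
    mollifiedCoeff N k = if k = 1 then 1 else 0 := by
  have h : mollifiedCoeff N k = ∑ x ∈ k.divisorsAntidiagonal, (moebius x.1 : ℝ) := by
    refine sum_congr ?_ fun _ _ => rfl
    ext x
    simp only [mem_filter, mem_product, mem_Ioc, Nat.mem_divisorsAntidiagonal]
    constructor
    · rintro ⟨-, h⟩; exact ⟨h, hk.ne'⟩
    · rintro ⟨h, -⟩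
      have h1 : 0 < x.1 := Nat.pos_of_ne_zero (by rintro h0; simp [h0] at h; omega)
      have h2 : 0 < x.2 := Nat.pos_of_ne_zero (by rintro h0; simp [h0] at h; omega)
      refine ⟨⟨⟨h1, ?_⟩, h2, ?_⟩, h⟩
      · exact (Nat.le_mul_of_pos_right _ h2).trans (h.le.trans hkN)
      · exact (Nat.le_mul_of_pos_left _ h1).trans (h.le.trans hkN)
  rw [h, Nat.sum_divisorsAntidiagonal (fun d _ => (moebius d : ℝ))]
  exact_mod_cast sum_divisors_moebius k

theorem pairCount_le (N k : ℕ) : pairCount (Ioc 0 N) (Ioc 0 N) k ≤ k := by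
  rw [pairCount, sum_const, nsmul_eq_mul, mul_one]
  have : #{x ∈ Ioc 0 N ×ˢ Ioc 0 N | x.1 * x.2 = k} ≤ #(Ioc 0 k) := by
    refine card_le_card_of_injOn (fun x => x.1) ?_ ?_
    · intro x hx
      simp only [coe_filter, mem_product, mem_Ioc, Set.mem_ofPred_eq, coe_Ioc, Set.mem_Ioc] at hx ⊢
      exact ⟨hx.1.1.1, (Nat.le_mul_of_pos_right _ hx.1.2.1).trans hx.2.le⟩
    · intro x hx y hy hxy
      simp only [coe_filter, mem_product, mem_Ioc, Set.mem_ofPred_eq] at hx hy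
      have h1 : x.1 * x.2 = x.1 * y.2 := by
        rw [hx.2]; rw [show x.1 = y.1 from hxy]; exact hy.2.symm
      exact Prod.ext hxy (Nat.eq_of_mul_eq_mul_left hx.1.1.1 h1)
  rw [Nat.card_Ioc, Nat.sub_zero] at this
  exact_mod_cast this

theorem sum_inv_sqrt_le (N : ℕ) : ∑ d ∈ Ioc 0 N, 1 / √(d : ℝ) ≤ 2 * √N := by
  induction N with
  | zero => simp
  | succ n ih =>
    rw [← Finset.insert_Ioc_right_eq_Ioc_add_one (Nat.zero_le n), sum_insert (by simp)]
    have h1 : 1 / √((n + 1 : ℕ) : ℝ) ≤ 2 * √((n + 1 : ℕ) : ℝ) - 2 * √(n : ℝ) := by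
      have h2 : 0 < √((n + 1 : ℕ) : ℝ) := by positivity
      have h3 : 0 ≤ √(n : ℝ) := by positivity
      have h4 : √((n + 1 : ℕ) : ℝ) ^ 2 = n + 1 := by
        rw [Real.sq_sqrt (by positivity)]; push_cast; rfl
      have h5 : √(n : ℝ) ^ 2 = n := Real.sq_sqrt (by positivity)
      rw [div_le_iff₀ h2]
      nlinarith [sq_nonneg (√((n + 1 : ℕ) : ℝ) - √(n : ℝ))]
    linarith

/-- Lowering σ from 1/2 to 1/2 − 1/log N multiplies each term with d ≤ N by at most e. -/
theorem sum_rpow_neg_le {N : ℕ} (hN : 3 ≤ N) {σ : ℝ} (hσ : 1 / 2 - 1 / Real.log N ≤ σ) :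
    ∑ d ∈ Ioc 0 N, (d : ℝ) ^ (-σ) ≤ Real.exp 1 * (2 * √N) := by
  have hL := one_le_log_of_three_le hN
  have : ∀ d ∈ Ioc 0 N, (d : ℝ) ^ (-σ) ≤ Real.exp 1 * (1 / √d) := by
    intro d hd
    have hd' := mem_Ioc.1 hd
    have hd0 : (0 : ℝ) < d := by exact_mod_cast hd'.1
    have e : (d : ℝ) ^ (-σ) = (d : ℝ) ^ (1 / 2 - σ) * (1 / √d) := by
      rw [Real.sqrt_eq_rpow, one_div ((d : ℝ) ^ (1 / 2 : ℝ)), ← Real.rpow_neg hd0.le,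
        ← Real.rpow_add hd0]
      congr 1; ring
    rw [e]
    gcongr
    rw [Real.rpow_def_of_pos hd0]
    apply Real.exp_le_exp.2
    have h1 : 0 ≤ Real.log d := Real.log_natCast_nonneg d
    have h2 : Real.log d ≤ Real.log N := Real.log_le_log hd0 (by exact_mod_cast hd'.2)
    calc Real.log d * (1 / 2 - σ) ≤ Real.log d * (1 / Real.log N) := by
          gcongr; linarith
      _ ≤ Real.log N * (1 / Real.log N) := by gcongr
      _ = 1 := by field_simp
  refine (sum_le_sum this).trans ?_
  rw [← mul_sum]
  gcongr
  exact sum_inv_sqrt_le N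

end Profile

/-! ### The mollifier and the mean squares of the pieces -/

section Mollified
open MeasureTheory Complex

/-- The mollifier `∑_{d ≤ N} μ(d) d^{-s}`. -/
noncomputable def mollifier (N : ℕ) (s : ℂ) : ℂ :=
  ∑ d ∈ Ioc 0 N, ((moebius d : ℤ) : ℂ) * (d : ℂ) ^ (-s)

theorem natCast_cpow_line {k : ℕ} (hk : 0 < k) (σ t : ℝ) :
    (k : ℂ) ^ (-(σ + t * I)) = ((k : ℝ) ^ (-σ) : ℝ) * cexp (-(t * Real.log k) * I) := by
  have hk0 : (k : ℂ) ≠ 0 := by exact_mod_cast hk.ne'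
  have hkr : (0 : ℝ) < k := by exact_mod_cast hk
  rw [cpow_def_of_ne_zero hk0, Real.rpow_def_of_pos hkr, Complex.ofReal_exp, ← Complex.exp_add,
    ← Complex.natCast_log]
  congr 1
  push_cast
  ring

theorem natCast_mul_cpow {a b : ℕ} (s : ℂ) :
    ((a * b : ℕ) : ℂ) ^ s = (a : ℂ) ^ s * (b : ℂ) ^ s := by
  push_cast
  exact Complex.natCast_mul_natCast_cpow a b s

theorem norm_natCast_cpow_neg {k : ℕ} (hk : 0 < k) (s : ℂ) :
    ‖(k : ℂ) ^ (-s)‖ = (k : ℝ) ^ (-s.re) := by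
  rw [Complex.norm_natCast_cpow_of_pos hk, neg_re]

/-- `∑_{n ≤ N} n^{-s}` times the mollifier, minus one, as a Dirichlet polynomial. -/
theorem mollifier_mul_sum_sub_one {N : ℕ} (hN : 0 < N) (s : ℂ) :
    mollifier N s * ∑ n ∈ Ioc 0 N, (n : ℂ) ^ (-s) - 1 =
      ∑ k ∈ Ioc N (N ^ 2), (mollifiedCoeff N k : ℂ) * (k : ℂ) ^ (-s) := by
  have hmaps : ∀ x ∈ Ioc 0 N ×ˢ Ioc 0 N, x.1 * x.2 ∈ Ioc 0 (N ^ 2) := by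
    intro x hx
    simp only [mem_product, mem_Ioc] at hx ⊢
    exact ⟨Nat.mul_pos hx.1.1 hx.2.1, by rw [sq]; exact Nat.mul_le_mul hx.1.2 hx.2.2⟩
  have h1 : mollifier N s * ∑ n ∈ Ioc 0 N, (n : ℂ) ^ (-s) =
      ∑ k ∈ Ioc 0 (N ^ 2), (mollifiedCoeff N k : ℂ) * (k : ℂ) ^ (-s) := by
    rw [mollifier, sum_mul_sum, ← sum_product', ← sum_fiberwise_of_maps_to hmaps]
    refine sum_congr rfl fun k _ => ?_
    rw [mollifiedCoeff]
    push_cast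
    rw [sum_mul]
    refine sum_congr rfl fun x hx => ?_
    rw [← (mem_filter.1 hx).2, natCast_mul_cpow]
    ring
  have hNN : N ≤ N ^ 2 := Nat.le_self_pow two_ne_zero N
  have h2 : Ioc 0 (N ^ 2) = Ioc 0 N ∪ Ioc N (N ^ 2) :=
    (Ioc_union_Ioc_eq_Ioc (Nat.zero_le N) hNN).symm
  have h3 : ∑ k ∈ Ioc 0 N, (mollifiedCoeff N k : ℂ) * (k : ℂ) ^ (-s) = 1 := by
    have : ∀ k ∈ Ioc 0 N, (mollifiedCoeff N k : ℂ) * (k : ℂ) ^ (-s) = if k = 1 then 1 else 0 := by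
      intro k hk
      have hk' := mem_Ioc.1 hk
      rw [mollifiedCoeff_eq hk'.1 hk'.2]
      by_cases h : k = 1 <;> simp [h]
    rw [sum_congr rfl this, sum_ite_eq' , if_pos (mem_Ioc.2 ⟨one_pos, hN⟩)]
  rw [h1, h2, sum_union, h3]
  · ring
  · rw [disjoint_left]
    intro k h4 h5
    have := (mem_Ioc.1 h4).2
    have := (mem_Ioc.1 h5).1
    omega

/-- The terms with `N < n ≤ 3 N` that enter Riemann's auxiliary function at height `t`. -/
noncomputable def tailSum (N : ℕ) (σ t : ℝ) : ℂ :=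
  ∑ n ∈ Ioc N (3 * N), if 2 * Real.pi * (n : ℝ) ^ 2 < t then (n : ℂ) ^ (-(σ + t * I)) else 0

/-- On the block N < √(t/2π) ≤ 3N, so the Dirichlet sum stopping at the saddle point is the sum to N
plus part of (N, 3N]. The remainder is the integral over the line nearest to the saddle. -/
theorem exists_norm_riemannAux_sub_le : ∃ C : ℝ, 0 < C ∧ ∀ N : ℕ, 0 < N → ∀ σ t : ℝ, 0 ≤ σ → σ ≤ 6 →
    t ∈ Set.Ioc (2 * Real.pi * N ^ 2) (9 * (2 * Real.pi * N ^ 2)) →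
    ‖riemannAux (σ + t * I) - (∑ n ∈ Ioc 0 N, (n : ℂ) ^ (-(σ + t * I)) + tailSum N σ t)‖ ≤
      C * (N : ℝ) ^ (-σ) := by
  obtain ⟨C, hC, h⟩ := exists_norm_siegelIntegral_le
  refine ⟨64 * C, by positivity, ?_⟩
  intro N hN σ t h0 h6 ht
  have hN0 : (0 : ℝ) < N := by exact_mod_cast hN
  have hN1 : (1 : ℝ) ≤ N := by exact_mod_cast hN
  have hpi := Real.pi_pos
  set ξ : ℝ := √(t / (2 * Real.pi)) with hξ
  have ht0 : 0 < t := lt_trans (by positivity) ht.1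
  have hξ2 : ξ ^ 2 = t / (2 * Real.pi) := Real.sq_sqrt (by positivity)
  have hξt : t = 2 * Real.pi * ξ ^ 2 := by rw [hξ2]; field_simp
  have hξ0 : 0 < ξ := by positivity
  have hξN : (N : ℝ) < ξ := by
    rw [hξ, Real.lt_sqrt hN0.le, lt_div_iff₀ (by positivity)]
    linarith [ht.1]
  have hξ3 : ξ ≤ 3 * N := by
    rw [hξ, Real.sqrt_le_left (by positivity), div_le_iff₀ (by positivity)]
    linarith [ht.2]
  have hlt : ∀ n : ℕ, 2 * Real.pi * (n : ℝ) ^ 2 < t ↔ (n : ℝ) < ξ := by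
    intro n
    rw [hξ, Real.lt_sqrt (Nat.cast_nonneg n), lt_div_iff₀ (by positivity), mul_comm]
  -- Ceiling minus one, not floor: m < ξ ≤ m + 1 matches the strict inequality in `tailSum` and
  -- places m + 1/2 within 1/2 of ξ.
  obtain ⟨m, hm⟩ : ∃ m : ℕ, ⌈ξ⌉₊ = m + 1 :=
    ⟨⌈ξ⌉₊ - 1, by have := Nat.ceil_pos.2 hξ0; omega⟩
  have hltm : ∀ n : ℕ, (n : ℝ) < ξ ↔ n ≤ m := by
    intro n
    rw [← Nat.lt_ceil, hm, Nat.lt_succ_iff]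
  have hm1 : (m : ℝ) < ξ := (hltm m).2 le_rfl
  have hm2 : ξ ≤ m + 1 := by
    have := Nat.le_ceil ξ
    rw [hm] at this
    exact_mod_cast this
  have hNm : N ≤ m := (hltm N).1 hξN
  have hm3 : m ≤ 3 * N := by
    have : (m : ℝ) < ((3 * N : ℕ) : ℝ) := by push_cast; linarith
    exact_mod_cast this.le
  have hsum : ∑ n ∈ Ioc 0 N, (n : ℂ) ^ (-(σ + t * I)) + tailSum N σ t =
      ∑ n ∈ Ioc 0 m, (n : ℂ) ^ (-(σ + t * I)) := by
    rw [← Ioc_union_Ioc_eq_Ioc (Nat.zero_le N) hNm, sum_union]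
    · congr 1
      rw [tailSum, ← sum_filter]
      refine sum_congr ?_ fun _ _ => rfl
      ext n
      rw [mem_filter, hlt, hltm, mem_Ioc, mem_Ioc]
      omega
    · rw [disjoint_left]
      intro k h4 h5
      have := (mem_Ioc.1 h4).2
      have := (mem_Ioc.1 h5).1
      omega
  rw [hsum, riemannAux_eq_sum_add_siegelIntegral m, add_sub_cancel_left]
  have hb := h m (σ + t * I) ξ (by simpa using h0) (by simpa using h6) hξ0 (by simp [← hξt])
    (by rw [abs_le]; constructor <;> linarith)
  simp only [add_re, ofReal_re, mul_re, I_re, mul_zero, ofReal_im, I_im, mul_one, sub_self,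
    add_zero] at hb
  refine hb.trans ?_
  have hp : (m + 1 / 2 : ℝ) ^ (-σ) ≤ (N : ℝ) ^ (-σ) * 64 := by
    have hNm' : (N : ℝ) ≤ m := by exact_mod_cast hNm
    calc (m + 1 / 2 : ℝ) ^ (-σ) ≤ (N : ℝ) ^ (-σ) :=
          Real.rpow_le_rpow_of_nonpos hN0 (by linarith) (by linarith)
      _ ≤ _ := by
        have : 0 ≤ (N : ℝ) ^ (-σ) := by positivity
        linarith
  calc C * (m + 1 / 2 : ℝ) ^ (-σ) ≤ C * ((N : ℝ) ^ (-σ) * 64) := by gcongr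
    _ = _ := by ring

theorem norm_mollifier_le (N : ℕ) (s : ℂ) :
    ‖mollifier N s‖ ≤ ∑ d ∈ Ioc 0 N, (d : ℝ) ^ (-s.re) := by
  refine (norm_sum_le _ _).trans (sum_le_sum fun d hd => ?_)
  rw [norm_mul, norm_natCast_cpow_neg (mem_Ioc.1 hd).1]
  have h1 : ‖((moebius d : ℤ) : ℂ)‖ ≤ 1 := by
    rw [Complex.norm_intCast]; exact_mod_cast abs_moebius_le_one
  have : 0 ≤ (d : ℝ) ^ (-s.re) := by positivity
  nlinarith

theorem differentiable_mollifier (N : ℕ) : Differentiable ℂ (mollifier N) := by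
  unfold mollifier
  refine Differentiable.fun_sum fun d hd => ?_
  have hd0 : (d : ℂ) ≠ 0 := by exact_mod_cast (mem_Ioc.1 hd).1.ne'
  refine (differentiable_const _).mul ?_
  intro s
  exact (differentiableAt_id.neg).const_cpow (Or.inl hd0)

/-- Here the index is the integer k itself and the cut-off is the vacuous 0 < t, so the mean value
bound sees |`mollifiedCoeff`| and keeps the Möbius cancellation. -/
theorem integral_norm_sq_main_le {N : ℕ} (hN : 3 ≤ N) {σ : ℝ}
    (hσ : 1 / 2 - 1 / Real.log N ≤ σ) :
    IntervalIntegrable (fun t : ℝ => ‖mollifier N (σ + t * I) *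
      ∑ n ∈ Ioc 0 N, (n : ℂ) ^ (-(σ + t * I)) - 1‖ ^ 2) volume (2 * Real.pi * N ^ 2)
        (9 * (2 * Real.pi * N ^ 2)) ∧
    ∫ t in (2 * Real.pi * N ^ 2)..(9 * (2 * Real.pi * N ^ 2)),
      ‖mollifier N (σ + t * I) * ∑ n ∈ Ioc 0 N, (n : ℂ) ^ (-(σ + t * I)) - 1‖ ^ 2 ≤
      80 * Real.exp 4 * 144 * ((N : ℝ) ^ (3 - 2 * σ) * Real.log N ^ 2) := by
  have hN0 : 0 < N := by omega
  have hL := one_le_log_of_three_le hN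
  set A := 2 * Real.pi * (N : ℝ) ^ 2 with hA
  have hA0 : 0 < A := by positivity
  set c : ℕ → ℂ := fun k => (mollifiedCoeff N k : ℂ) * ((k : ℝ) ^ (-σ) : ℝ) with hc
  have heq : Set.EqOn (fun t : ℝ => ‖mollifier N (σ + t * I) *
      ∑ n ∈ Ioc 0 N, (n : ℂ) ^ (-(σ + t * I)) - 1‖ ^ 2) (fun t : ℝ => ‖∑ k ∈ Ioc N (N ^ 2),
      (if (0 : ℝ) < t then c k * cexp (-(t * Real.log k) * I) else 0)‖ ^ 2)
      (Set.uIoc A (9 * A)) := by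
    intro t ht
    rw [Set.uIoc_of_le (by linarith)] at ht
    have ht0 : 0 < t := hA0.trans ht.1
    simp only [mollifier_mul_sum_sub_one hN0, if_pos ht0, hc]
    congr 2
    refine sum_congr rfl fun k hk => ?_
    rw [natCast_cpow_line (by have := (mem_Ioc.1 hk).1; omega)]
    ring
  have hk : ∀ k ∈ Ioc N (N ^ 2), k ∈ Ioc 0 (3 * N ^ 2) := by
    intro k hk
    rw [mem_Ioc] at hk ⊢
    omega
  constructor
  · exact (intervalIntegrable_norm_sq_cutoff_sum (Ioc N (N ^ 2)) (fun k => Real.log k) c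
      (fun _ => 0) A (9 * A)).congr heq.symm
  rw [intervalIntegral.integral_congr_ae (Filter.Eventually.of_forall fun t ht => heq ht)]
  refine (integral_norm_sq_cutoff_sum_le (Ioc N (N ^ 2)) (fun k => k) (3 * N ^ 2) hk c
    (fun _ => 0) (by linarith : A ≤ 9 * A)).trans ?_
  set Q : ℕ → ℝ := fun m => if N < m ∧ m ≤ N ^ 2 then |mollifiedCoeff N m| else 0 with hQ
  have hQnn : ∀ m, 0 ≤ Q m := fun m => by simp only [hQ]; split_ifs <;> positivity
  have hQle : ∀ m, Q m ≤ pairCount (Ioc 0 N) (Ioc 0 (3 * N)) m := by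
    intro m
    simp only [hQ]
    split_ifs
    · exact (abs_mollifiedCoeff_le N m).trans
        (pairCount_mono (Ioc_subset_Ioc_right (by omega)) m)
    · exact pairCount_nonneg _ _ _
  have hprof := sum_profile_le hN hσ (Q := Q) (C := 144) (W := 9 * A - A)
    (fun m hm => if_neg (by omega)) ?_ ?_ (by linarith) ?_
  · refine le_trans (le_of_eq (sum_congr rfl fun m hm => ?_)) hprof
    congr 2
    simp only [hQ]
    by_cases h : N < m ∧ m ≤ N ^ 2
    · rw [if_pos h]
      have : (Ioc N (N ^ 2)).filter (fun k => k = m) = {m} := by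
        ext k; simp only [mem_filter, mem_Ioc, mem_singleton]; grind
      rw [this, sum_singleton, hc]
      simp only [norm_mul, Complex.norm_real, Real.norm_eq_abs]
      rw [abs_of_nonneg (by positivity : 0 ≤ (m : ℝ) ^ (-σ))]
    · rw [if_neg h, zero_mul]
      apply sum_eq_zero
      intro k hk
      simp only [mem_filter, mem_Ioc] at hk
      grind
  · have h1 := sum_mollifiedCoeff_sq_div_le N
    have h2 : ∑ m ∈ Ioc 0 (3 * N ^ 2), Q m ^ 2 / m ≤
        ∑ m ∈ Ioc 0 (N ^ 2), mollifiedCoeff N m ^ 2 / m := by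
      rw [← sum_subset (Ioc_subset_Ioc_right (by omega : N ^ 2 ≤ 3 * N ^ 2))]
      · refine sum_le_sum fun m _ => ?_
        simp only [hQ]
        split_ifs
        · rw [sq_abs]
        · rw [zero_pow two_ne_zero, zero_div]; positivity
      · intro m hm hm'
        simp only [hQ]
        rw [mem_Ioc] at hm hm'
        rw [if_neg (by omega)]; simp
    refine h2.trans (h1.trans ?_)
    have : (1 + Real.log N) ^ 2 ≤ (2 * Real.log N) ^ 2 := by gcongr; linarith
    nlinarith [sq_nonneg (Real.log N)]
  · refine le_trans (sum_le_sum fun m _ => ?_) (sum_pairCount_sq_le hN)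
    have := hQnn m
    have := hQle m
    gcongr
  · have := Real.pi_lt_d2
    rw [hA]
    nlinarith [sq_nonneg (N : ℝ)]

theorem mollifier_mul_tailSum (N : ℕ) (σ t : ℝ) : mollifier N (σ + t * I) * tailSum N σ t =
    ∑ x ∈ Ioc 0 N ×ˢ Ioc N (3 * N), (if 2 * Real.pi * (x.2 : ℝ) ^ 2 < t then
      (((moebius x.1 : ℤ) : ℂ) * (((x.1 * x.2 : ℕ) : ℝ) ^ (-σ) : ℝ)) *
        cexp (-(t * Real.log ((x.1 * x.2 : ℕ) : ℝ)) * I) else 0) := by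
  rw [mollifier, tailSum, sum_mul_sum, ← sum_product']
  refine sum_congr rfl fun x hx => ?_
  have hx' := mem_product.1 hx
  have h1 := (mem_Ioc.1 hx'.1).1
  have h2 := (mem_Ioc.1 hx'.2).1
  split_ifs
  · rw [mul_assoc, mul_assoc, ← natCast_cpow_line (Nat.mul_pos h1 (by omega)), natCast_mul_cpow]
  · simp

/-- The cut-off depends on n and not only on the product dn, so pairs are the indices and μ is
estimated trivially. The restriction N < n ≤ 3N makes up for this. -/
theorem integral_norm_sq_tail_le {N : ℕ} (hN : 3 ≤ N) {σ : ℝ}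
    (hσ : 1 / 2 - 1 / Real.log N ≤ σ) :
    IntervalIntegrable (fun t : ℝ => ‖mollifier N (σ + t * I) * tailSum N σ t‖ ^ 2) volume
      (2 * Real.pi * N ^ 2) (9 * (2 * Real.pi * N ^ 2)) ∧
    ∫ t in (2 * Real.pi * N ^ 2)..(9 * (2 * Real.pi * N ^ 2)),
      ‖mollifier N (σ + t * I) * tailSum N σ t‖ ^ 2 ≤
      80 * Real.exp 4 * 144 * ((N : ℝ) ^ (3 - 2 * σ) * Real.log N ^ 2) := by
  set A := 2 * Real.pi * (N : ℝ) ^ 2 with hA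
  have hA0 : 0 ≤ A := by positivity
  simp only [mollifier_mul_tailSum]
  have hmaps : ∀ x ∈ Ioc 0 N ×ˢ Ioc N (3 * N), x.1 * x.2 ∈ Ioc 0 (3 * N ^ 2) := by
    intro x hx
    simp only [mem_product, mem_Ioc] at hx ⊢
    refine ⟨Nat.mul_pos hx.1.1 (by omega), ?_⟩
    calc x.1 * x.2 ≤ N * (3 * N) := Nat.mul_le_mul hx.1.2 hx.2.2
      _ = 3 * N ^ 2 := by ring
  set c : ℕ × ℕ → ℂ := fun x => ((moebius x.1 : ℤ) : ℂ) * (((x.1 * x.2 : ℕ) : ℝ) ^ (-σ) : ℝ)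
    with hc
  constructor
  · exact intervalIntegrable_norm_sq_cutoff_sum (Ioc 0 N ×ˢ Ioc N (3 * N))
      (fun x => Real.log ((x.1 * x.2 : ℕ) : ℝ)) c (fun x => 2 * Real.pi * (x.2 : ℝ) ^ 2) A (9 * A)
  refine (integral_norm_sq_cutoff_sum_le (Ioc 0 N ×ˢ Ioc N (3 * N)) (fun x => x.1 * x.2)
    (3 * N ^ 2) hmaps c (fun x => 2 * Real.pi * (x.2 : ℝ) ^ 2) (by linarith : A ≤ 9 * A)).trans ?_
  set Q : ℕ → ℝ := pairCount (Ioc 0 N) (Ioc N (3 * N)) with hQ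
  have hprof := sum_profile_le hN hσ (Q := Q) (C := 144) (W := 9 * A - A) ?_
    (sum_pairCount_sq_div_le hN) ?_ (by linarith) ?_
  · refine le_trans (sum_le_sum fun m hm => ?_) hprof
    have h0 : 0 ≤ 9 * A - A + 2 * ((3 * N ^ 2 : ℕ) : ℝ) +
        4 * (1 + Real.log ((3 * N ^ 2 : ℕ) : ℝ)) * m := by
      have := Real.log_natCast_nonneg (3 * N ^ 2)
      have : 0 ≤ 9 * A - A := by linarith
      positivity
    refine mul_le_mul_of_nonneg_right ?_ h0
    refine pow_le_pow_left₀ (sum_nonneg fun _ _ => norm_nonneg _) ?_ 2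
    rw [hQ, pairCount, sum_mul]
    refine sum_le_sum fun x hx => ?_
    rw [hc]
    simp only [norm_mul, Complex.norm_real, Real.norm_eq_abs, (mem_filter.1 hx).2]
    rw [abs_of_nonneg (by positivity : 0 ≤ (m : ℝ) ^ (-σ))]
    gcongr
    rw [Complex.norm_intCast]; exact_mod_cast abs_moebius_le_one
  · intro m hm
    rw [hQ, pairCount, sum_eq_zero]
    intro x hx
    simp only [mem_filter, mem_product, mem_Ioc] at hx
    have : x.2 ≤ x.1 * x.2 := Nat.le_mul_of_pos_left _ hx.1.1.1
    omega
  · refine le_trans (sum_le_sum fun m _ => ?_) (sum_pairCount_sq_le hN)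
    have := pairCount_nonneg (Ioc 0 N) (Ioc N (3 * N)) m
    have := pairCount_mono (A := Ioc 0 N) (Ioc_subset_Ioc_left (Nat.zero_le N) : Ioc N (3 * N) ⊆ _) m
    rw [hQ]
    gcongr
  · have := Real.pi_lt_d2
    rw [hA]
    nlinarith [sq_nonneg (N : ℝ)]

end Mollified

/-! ### The mollified error: mean square and size at σ = 3 -/

section Mollified
open MeasureTheory Complex

/-- Riemann's auxiliary function times the mollifier, minus one. -/
noncomputable def mollifiedError (N : ℕ) (s : ℂ) : ℂ := riemannAux s * mollifier N s - 1

theorem differentiable_mollifiedError (N : ℕ) : Differentiable ℂ (mollifiedError N) :=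
  (differentiable_riemannAux.mul (differentiable_mollifier N)).sub_const 1

theorem mollifiedError_eq (N : ℕ) (σ t : ℝ) : mollifiedError N (σ + t * I) =
    (mollifier N (σ + t * I) * ∑ n ∈ Ioc 0 N, (n : ℂ) ^ (-(σ + t * I)) - 1) +
    mollifier N (σ + t * I) * tailSum N σ t +
    mollifier N (σ + t * I) * (riemannAux (σ + t * I) -
      (∑ n ∈ Ioc 0 N, (n : ℂ) ^ (-(σ + t * I)) + tailSum N σ t)) := by
  rw [mollifiedError]; ring

/-- Besides the two mean squares there is the saddle remainder, O(N^(-σ)) against a mollifier of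
size O(√N); its square contributes N^(1-2σ) times the block length 16πN². The range 0 ≤ σ ≤ 6
accommodates circles about 3 of radius at most 3. -/
theorem exists_integral_norm_sq_mollifiedError_le : ∃ C : ℝ, 0 < C ∧ ∀ N : ℕ, 3 ≤ N → ∀ σ : ℝ,
    1 / 2 - 1 / Real.log N ≤ σ → 0 ≤ σ → σ ≤ 6 →
    ∫ t in (2 * Real.pi * N ^ 2)..(9 * (2 * Real.pi * N ^ 2)),
      ‖mollifiedError N (σ + t * I)‖ ^ 2 ≤ C * ((N : ℝ) ^ (3 - 2 * σ) * Real.log N ^ 2) := by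
  obtain ⟨C, hC, hR⟩ := exists_norm_riemannAux_sub_le
  set X := 80 * Real.exp 4 * 144 with hX
  set Y := (Real.exp 1 * 2 * C) ^ 2 with hY
  refine ⟨6 * X + 3 * (16 * Real.pi * Y), by positivity, ?_⟩
  intro N hN σ hσ h0 h6
  obtain ⟨i1, b1⟩ := integral_norm_sq_main_le hN hσ
  obtain ⟨i2, b2⟩ := integral_norm_sq_tail_le hN hσ
  have hL := one_le_log_of_three_le hN
  have hN0 : (0 : ℝ) < N := by exact_mod_cast (by omega : 0 < N)
  set A := 2 * Real.pi * (N : ℝ) ^ 2 with hA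
  have hA0 : 0 ≤ A := by positivity
  set P : ℝ → ℂ := fun t => mollifier N (σ + t * I) *
    ∑ n ∈ Ioc 0 N, (n : ℂ) ^ (-(σ + t * I)) - 1 with hP
  set E : ℝ → ℂ := fun t => mollifier N (σ + t * I) * tailSum N σ t with hE
  set D := Y * (N : ℝ) ^ (1 - 2 * σ) with hD
  have hpt : ∀ t ∈ Set.Ioo A (9 * A), ‖mollifiedError N (σ + t * I)‖ ^ 2 ≤
      3 * (‖P t‖ ^ 2 + ‖E t‖ ^ 2 + D) := by
    intro t ht
    rw [mollifiedError_eq]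
    set Z := mollifier N (σ + t * I) * (riemannAux (σ + t * I) -
      (∑ n ∈ Ioc 0 N, (n : ℂ) ^ (-(σ + t * I)) + tailSum N σ t)) with hZ
    have hZ1 : ‖Z‖ ^ 2 ≤ D := by
      have h1 : ‖mollifier N (σ + t * I)‖ ≤ Real.exp 1 * (2 * √N) := by
        refine (norm_mollifier_le N _).trans ?_
        simpa using sum_rpow_neg_le hN hσ
      have h2 := hR N (by omega) σ t h0 h6 ⟨ht.1, ht.2.le⟩
      have h3 : ‖Z‖ ≤ (Real.exp 1 * (2 * √N)) * (C * (N : ℝ) ^ (-σ)) := by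
        rw [hZ, norm_mul]; gcongr
      calc ‖Z‖ ^ 2 ≤ ((Real.exp 1 * (2 * √N)) * (C * (N : ℝ) ^ (-σ))) ^ 2 := by gcongr
        _ = Y * (√N ^ 2 * ((N : ℝ) ^ (-σ)) ^ 2) := by rw [hY]; ring
        _ = D := by
          rw [hD, Real.sq_sqrt hN0.le, ← Real.rpow_natCast ((N : ℝ) ^ (-σ)), ← Real.rpow_mul hN0.le]
          congr 1
          conv_lhs => rw [← Real.rpow_one (N : ℝ), ← Real.rpow_mul hN0.le, ← Real.rpow_add hN0]
          congr 1; push_cast; ring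
    have h4 : ‖P t + E t + Z‖ ≤ ‖P t‖ + ‖E t‖ + ‖Z‖ := norm_add₃_le
    have h5 : ‖P t + E t + Z‖ ^ 2 ≤ (‖P t‖ + ‖E t‖ + ‖Z‖) ^ 2 := by gcongr
    refine h5.trans ?_
    nlinarith [sq_nonneg (‖P t‖ - ‖E t‖), sq_nonneg (‖P t‖ - ‖Z‖), sq_nonneg (‖E t‖ - ‖Z‖)]
  have hcont : Continuous fun t : ℝ => ‖mollifiedError N (σ + t * I)‖ ^ 2 := by
    have := (differentiable_mollifiedError N).continuous
    fun_prop
  have hDi : IntervalIntegrable (fun _ : ℝ => D) volume A (9 * A) := intervalIntegrable_const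
  have hmono := intervalIntegral.integral_mono_on_of_le_Ioo (by linarith : A ≤ 9 * A)
    (hcont.intervalIntegrable A (9 * A)) (((i1.add i2).add hDi).const_mul 3) hpt
  refine hmono.trans ?_
  rw [intervalIntegral.integral_const_mul, intervalIntegral.integral_add (i1.add i2) hDi,
    intervalIntegral.integral_add i1 i2, intervalIntegral.integral_const, smul_eq_mul]
  have e3 : (9 * A - A) * D = 16 * Real.pi * Y * (N : ℝ) ^ (3 - 2 * σ) := by
    have e2 : (N : ℝ) ^ (3 - 2 * σ) = (N : ℝ) ^ (1 - 2 * σ) * (N : ℝ) ^ 2 := by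
      rw [← Real.rpow_natCast, ← Real.rpow_add hN0]; congr 1; push_cast; ring
    rw [e2, hD, hA]; ring
  have e4 : 16 * Real.pi * Y * (N : ℝ) ^ (3 - 2 * σ) ≤
      16 * Real.pi * Y * ((N : ℝ) ^ (3 - 2 * σ) * Real.log N ^ 2) := by
    gcongr
    exact le_mul_of_one_le_right (by positivity) (by nlinarith)
  rw [e3]
  linarith

theorem norm_tailSum_le {N : ℕ} (hN : 0 < N) (t : ℝ) : ‖tailSum N 3 t‖ ≤ 3 * ((N : ℝ) ^ 2)⁻¹ := by
  have hN0 : (0 : ℝ) < N := by exact_mod_cast hN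
  rw [tailSum]
  refine (norm_sum_le _ _).trans ?_
  have h : ∀ n ∈ Ioc N (3 * N), ‖(if 2 * Real.pi * (n : ℝ) ^ 2 < t then
      (n : ℂ) ^ (-(((3 : ℝ) : ℂ) + t * I)) else 0)‖ ≤ ((N : ℝ) ^ 3)⁻¹ := by
    intro n hn
    have hn' := mem_Ioc.1 hn
    split_ifs
    · rw [norm_natCast_cpow_neg (by omega)]
      simp only [add_re, ofReal_re, mul_re, I_re, mul_zero, ofReal_im, I_im, mul_one, sub_self,
        add_zero]
      rw [Real.rpow_neg (by positivity)]
      have : (n : ℝ) ^ (3 : ℝ) = (n : ℝ) ^ 3 := by exact_mod_cast Real.rpow_natCast (n : ℝ) 3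
      rw [this]
      have : (N : ℝ) ≤ n := by exact_mod_cast hn'.1.le
      gcongr
    · rw [norm_zero]; positivity
  refine (sum_le_sum h).trans ?_
  rw [sum_const, Nat.card_Ioc, nsmul_eq_mul]
  have : ((3 * N - N : ℕ) : ℝ) ≤ 3 * N := by
    have : 3 * N - N ≤ 3 * N := Nat.sub_le _ _
    exact_mod_cast this
  calc ((3 * N - N : ℕ) : ℝ) * ((N : ℝ) ^ 3)⁻¹ ≤ (3 * N) * ((N : ℝ) ^ 3)⁻¹ := by gcongr
    _ = _ := by field_simp

theorem norm_mollifier_three_le (N : ℕ) (t : ℝ) : ‖mollifier N (((3 : ℝ) : ℂ) + t * I)‖ ≤ 2 := by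
  refine (norm_mollifier_le N _).trans (le_trans (sum_le_sum fun d hd => ?_) (sum_Ioc_inv_sq_le N))
  have hd0 : (1 : ℝ) ≤ d := by exact_mod_cast (mem_Ioc.1 hd).1
  simp only [add_re, ofReal_re, mul_re, I_re, mul_zero, ofReal_im, I_im, mul_one, sub_self,
    add_zero]
  rw [Real.rpow_neg (by positivity), ← one_div]
  have : (d : ℝ) ^ (3 : ℝ) = (d : ℝ) ^ 3 := by exact_mod_cast Real.rpow_natCast (d : ℝ) 3
  rw [this]
  gcongr
  · norm_num

theorem norm_main_three_le {N : ℕ} (hN : 0 < N) (t : ℝ) :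
    ‖mollifier N (((3 : ℝ) : ℂ) + t * I) * ∑ n ∈ Ioc 0 N, (n : ℂ) ^ (-(((3 : ℝ) : ℂ) + t * I)) - 1‖ ≤
      (N : ℝ)⁻¹ := by
  rw [mollifier_mul_sum_sub_one hN]
  refine (norm_sum_le _ _).trans ?_
  have h : ∀ k ∈ Ioc N (N ^ 2), ‖(mollifiedCoeff N k : ℂ) * (k : ℂ) ^ (-(((3 : ℝ) : ℂ) + t * I))‖ ≤
      ((k : ℝ) ^ 2)⁻¹ := by
    intro k hk
    have hk' := mem_Ioc.1 hk
    have hk0 : (0 : ℝ) < k := by exact_mod_cast (by omega : 0 < k)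
    rw [norm_mul, norm_natCast_cpow_neg (by omega)]
    simp only [add_re, ofReal_re, mul_re, I_re, mul_zero, ofReal_im, I_im, mul_one, sub_self,
      add_zero]
    rw [Real.rpow_neg (by positivity)]
    have : (k : ℝ) ^ (3 : ℝ) = (k : ℝ) ^ 3 := by exact_mod_cast Real.rpow_natCast (k : ℝ) 3
    rw [this, Complex.norm_real, Real.norm_eq_abs]
    calc |mollifiedCoeff N k| * ((k : ℝ) ^ 3)⁻¹ ≤ k * ((k : ℝ) ^ 3)⁻¹ := by
          gcongr
          exact (abs_mollifiedCoeff_le N k).trans (pairCount_le N k)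
      _ = _ := by field_simp
  refine (sum_le_sum h).trans ?_
  have hNN : N ≤ N ^ 2 := Nat.le_self_pow two_ne_zero N
  have := sum_Ioc_inv_sq_le_sub (α := ℝ) hN.ne' hNN
  refine this.trans ?_
  have : (0 : ℝ) ≤ ((N ^ 2 : ℕ) : ℝ)⁻¹ := by positivity
  linarith

theorem exists_norm_mollifiedError_three_le : ∃ N₀ : ℕ, 3 ≤ N₀ ∧ ∀ N : ℕ, N₀ ≤ N → ∀ t : ℝ,
    t ∈ Set.Ioc (2 * Real.pi * N ^ 2) (9 * (2 * Real.pi * N ^ 2)) →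
    ‖mollifiedError N (((3 : ℝ) : ℂ) + t * I)‖ ≤ 1 / 2 := by
  obtain ⟨C, hC, hR⟩ := exists_norm_riemannAux_sub_le
  -- The error is at most (1 + 2·3 + 2C)/N: main part, mollifier times tail, mollifier times saddle
  -- remainder.
  refine ⟨max 3 ⌈2 * (7 + 2 * C)⌉₊, le_max_left _ _, ?_⟩
  intro N hN t ht
  have hN3 : 3 ≤ N := (le_max_left _ _).trans hN
  have hNC : 2 * (7 + 2 * C) ≤ N := by
    refine (Nat.le_ceil _).trans ?_
    exact_mod_cast (le_max_right _ _).trans hN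
  have hN1 : (1 : ℝ) ≤ N := by exact_mod_cast (by omega : 1 ≤ N)
  have h1 := norm_main_three_le (by omega : 0 < N) t
  have h2 := norm_tailSum_le (by omega : 0 < N) t
  have h3 := norm_mollifier_three_le N t
  have h4 := hR N (by omega) 3 t (by norm_num) (by norm_num) ht
  rw [mollifiedError_eq]
  refine norm_add₃_le.trans ?_
  rw [norm_mul (mollifier N _) (tailSum N 3 t), norm_mul (mollifier N _) (riemannAux _ - _)]
  have e1 : ((N : ℝ) ^ 2)⁻¹ ≤ (N : ℝ)⁻¹ := by
    apply inv_anti₀ (by linarith); nlinarith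
  have e2 : (N : ℝ) ^ (-(3 : ℝ)) ≤ (N : ℝ)⁻¹ := by
    rw [← Real.rpow_neg_one]
    exact Real.rpow_le_rpow_of_exponent_le hN1 (by norm_num)
  have g2 : ‖mollifier N (((3 : ℝ) : ℂ) + t * I)‖ * ‖tailSum N 3 t‖ ≤ 2 * (3 * (N : ℝ)⁻¹) := by
    gcongr
    exact h2.trans (by gcongr)
  have g4 := mul_le_mul h3 (h4.trans (by gcongr : C * (N : ℝ) ^ (-(3 : ℝ)) ≤ C * (N : ℝ)⁻¹))
    (norm_nonneg _) (by norm_num)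
  have hfin : (7 + 2 * C) * (N : ℝ)⁻¹ ≤ 1 / 2 := by
    rw [← div_eq_mul_inv, div_le_iff₀ (by linarith)]
    linarith
  linarith

end Mollified

/-! ### Jensen's formula and the counting of zeros -/

section Jensen
open MeasureTheory Complex Metric

theorem Differentiable.analyticOrderAt_ne_top {f : ℂ → ℂ} (hf : Differentiable ℂ f) {c : ℂ}
    (hc : f c ≠ 0) (u : ℂ) : analyticOrderAt f u ≠ ⊤ := by
  have ha : AnalyticOnNhd ℂ f Set.univ := fun z _ => hf.analyticAt z
  refine ha.analyticOrderAt_ne_top_of_isPreconnected isPreconnected_univ (Set.mem_univ c)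
    (Set.mem_univ u) ?_
  rw [(hf.analyticAt c).analyticOrderAt_eq_zero.mpr hc]
  simp

theorem Differentiable.divisor_closedBall_eq {f : ℂ → ℂ} (hf : Differentiable ℂ f) {c : ℂ}
    (hc : f c ≠ 0) {z₀ : ℂ} {r : ℝ} {u : ℂ} (hu : u ∈ closedBall z₀ r) :
    MeromorphicOn.divisor f (closedBall z₀ r) u = analyticOrderNatAt f u := by
  have ha : AnalyticOnNhd ℂ f (closedBall z₀ r) := fun z _ => hf.analyticAt z
  rw [MeromorphicOn.AnalyticOnNhd.divisor_apply ha hu, ← Nat.cast_analyticOrderNatAt (hf.analyticOrderAt_ne_top hc u)]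
  rfl

/-- Jensen's formula as an inequality for a finite set of zeros. -/
theorem Differentiable.sum_analyticOrderNatAt_mul_log_le {f : ℂ → ℂ} (hf : Differentiable ℂ f)
    {c : ℂ} (hc : f c ≠ 0) {r : ℝ} (hr : 0 < r) (Z : Finset ℂ) (hZ : ∀ u ∈ Z, u ∈ closedBall c r) :
    ∑ u ∈ Z, (analyticOrderNatAt f u : ℝ) * Real.log (r * ‖c - u‖⁻¹) ≤
      Real.circleAverage (Real.log ‖f ·‖) c r - Real.log ‖f c‖ := by
  classical
  have ha : AnalyticOnNhd ℂ f (closedBall c |r|) := fun z _ => hf.analyticAt z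
  have hj := ha.circleAverage_log_norm hr.ne' hc
  rw [abs_of_pos hr] at hj
  set D := MeromorphicOn.divisor f (closedBall c r) with hD
  have hfin := D.finiteSupport (isCompact_closedBall c r)
  have hnonneg : ∀ u, 0 ≤ (D u : ℝ) * Real.log (r * ‖c - u‖⁻¹) := by
    intro u
    by_cases hu : u ∈ closedBall c r
    · rw [hD, hf.divisor_closedBall_eq hc hu]
      by_cases h0 : u = c
      · simp [h0]
      · refine mul_nonneg (by simp) (Real.log_nonneg ?_)
        have h1 : 0 < ‖c - u‖ := norm_pos_iff.2 (sub_ne_zero.2 (Ne.symm h0))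
        rw [mem_closedBall, dist_eq_norm', ] at hu
        rw [← div_eq_mul_inv, le_div_iff₀ h1]
        linarith
    · simp [Function.locallyFinsuppWithin.apply_eq_zero_of_notMem D hu]
  rw [hj, add_sub_cancel_right,
    finsum_eq_sum_of_support_subset (s := hfin.toFinset ∪ Z)]
  · refine le_trans (le_of_eq ?_) (Finset.sum_le_sum_of_subset_of_nonneg
      Finset.subset_union_right fun u _ _ => hnonneg u)
    refine Finset.sum_congr rfl fun u hu => ?_
    rw [hD, hf.divisor_closedBall_eq hc (hZ u hu)]
    simp
  · intro u hu
    rw [Finset.coe_union, Set.Finite.coe_toFinset]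
    left
    intro h
    apply hu
    simp [h]

/-- Zeros of a factor of `1 - g ^ 2` are counted by the mean square of `g` on a circle. -/
theorem Differentiable.sum_analyticOrderNatAt_le_circleAverage {f g k : ℂ → ℂ}
    (hf : Differentiable ℂ f) (hg : Differentiable ℂ g) (hk : Differentiable ℂ k)
    (hfk : ∀ z, f z * k z = 1 - g z ^ 2) {c : ℂ} (hc : ‖g c‖ ≤ 1 / 2) {r η : ℝ} (hr : 0 < r)
    (Z : Finset ℂ) (hZ : ∀ u ∈ Z, u ∈ closedBall c r)
    (hη : ∀ u ∈ Z, η ≤ Real.log (r * ‖c - u‖⁻¹)) (hη0 : 0 ≤ η) :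
    (∑ u ∈ Z, (analyticOrderNatAt f u : ℝ)) * η ≤
      Real.circleAverage (fun z => ‖g z‖ ^ 2) c r + 2 * ‖g c‖ ^ 2 := by
  -- Using 1 − g² in place of 1 + g makes the upper bound for log|h| on the circle and the lower
  -- bound at the centre quadratic in g.
  set h : ℂ → ℂ := fun z => 1 - g z ^ 2 with hh
  have hfk' : h = f * k := funext fun z => (hfk z).symm
  have hd : Differentiable ℂ h := (differentiable_const 1).sub (hg.pow 2)
  have hg2 : ‖g c‖ ^ 2 ≤ 1 / 4 := by nlinarith [norm_nonneg (g c)]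
  have hlow : 1 - ‖g c‖ ^ 2 ≤ ‖h c‖ := by
    have := norm_sub_norm_le (1 : ℂ) (g c ^ 2)
    simpa [hh] using this
  have hc0 : h c ≠ 0 := norm_pos_iff.1 (by linarith)
  have hlogc : -(2 * ‖g c‖ ^ 2) ≤ Real.log ‖h c‖ := by
    refine le_trans ?_ (Real.log_le_log (by linarith) hlow)
    have h1 := Real.one_sub_inv_le_log_of_pos (x := 1 - ‖g c‖ ^ 2) (by linarith)
    refine le_trans ?_ h1
    have h2 : (1 - ‖g c‖ ^ 2)⁻¹ ≤ 1 + 2 * ‖g c‖ ^ 2 := by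
      rw [inv_le_iff_one_le_mul₀ (by linarith)]
      nlinarith [sq_nonneg ‖g c‖]
    linarith
  have hup : Real.circleAverage (Real.log ‖h ·‖) c r ≤
      Real.circleAverage (fun z => ‖g z‖ ^ 2) c r := by
    refine Real.circleAverage_mono ?_ ?_ ?_
    · exact MeromorphicOn.circleIntegrable_log_norm
        fun z _ => (hd.analyticAt z).meromorphicAt
    · exact (by have := hg.continuous; fun_prop : Continuous fun z => ‖g z‖ ^ 2).continuousOn.circleIntegrable'
    · intro z _
      by_cases h0 : ‖h z‖ = 0
      · rw [h0, Real.log_zero]; positivity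
      · have h1 : ‖h z‖ ≤ 1 + ‖g z‖ ^ 2 := by
          rw [← norm_pow, ← norm_one (α := ℂ)]; exact norm_sub_le _ _
        have := Real.log_le_sub_one_of_pos (lt_of_le_of_ne (norm_nonneg _) (Ne.symm h0))
        linarith
  have hj := hd.sum_analyticOrderNatAt_mul_log_le hc0 hr Z hZ
  rw [Finset.sum_mul]
  refine le_trans (Finset.sum_le_sum fun u hu => ?_) (le_trans hj (by linarith))
  have hord : analyticOrderNatAt f u ≤ analyticOrderNatAt h u := by
    have h1 := hd.analyticOrderAt_ne_top hc0 u
    have h2 : analyticOrderAt f u ≤ analyticOrderAt h u := by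
      rw [hfk', analyticOrderAt_mul (hf.analyticAt u) (hk.analyticAt u)]
      exact le_self_add
    exact ENat.toNat_le_toNat h2 h1
  exact mul_le_mul (by exact_mod_cast hord) (hη u hu) hη0 (by positivity)

end Jensen

/-! ### Averaging the circles over their centres -/

section Window
open MeasureTheory Complex Metric

/-- Here |c − ρ|² ≤ (r − δ)² + δ ≤ r²(1 − δ/4), because 2 ≤ r ≤ 3 and δ ≤ 1/2. Near the leftmost
point a circle departs from its vertical tangent quadratically, so a window of height √δ costs only
O(δ) horizontally. -/
theorem le_log_of_mem_window {α δ r t₀ : ℝ} (hα : 1 / 2 < α) (hα1 : α ≤ 1) (hδ : 0 < δ)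
    (hδ1 : δ ≤ 1 / 2) (hr : r = 3 - (α - δ)) {ρ : ℂ} (hρ : α ≤ ρ.re) (hρ1 : ρ.re ≤ 1)
    (ht : |ρ.im - t₀| ≤ √δ) :
    ρ ∈ closedBall ((3 : ℝ) + t₀ * I : ℂ) r ∧
      δ / 8 ≤ Real.log (r * ‖((3 : ℝ) + t₀ * I : ℂ) - ρ‖⁻¹) := by
  set c : ℂ := (3 : ℝ) + t₀ * I with hc
  have hr2 : 2 ≤ r := by linarith
  have hr3 : r ≤ 3 := by linarith
  have hsq : ‖c - ρ‖ ^ 2 = (3 - ρ.re) ^ 2 + (ρ.im - t₀) ^ 2 := by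
    rw [Complex.sq_norm, Complex.normSq_apply]
    simp only [hc, sub_re, sub_im, add_re, add_im, mul_re, mul_im, ofReal_re, ofReal_im, I_re, I_im]
    ring
  have h1 : (ρ.im - t₀) ^ 2 ≤ δ := by
    rw [← sq_abs, ← Real.sq_sqrt hδ.le]
    gcongr
  have h2 : (3 - ρ.re) ^ 2 ≤ (3 - α) ^ 2 := by
    apply pow_le_pow_left₀ <;> linarith
  have h3 : ‖c - ρ‖ ^ 2 ≤ r ^ 2 * (1 - δ / 4) := by
    rw [hsq]
    have h4 : (3 - α) ^ 2 = r ^ 2 - 2 * r * δ + δ ^ 2 := by rw [hr]; ring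
    have h5 : r ^ 2 * δ ≤ 9 * δ := by
      apply mul_le_mul_of_nonneg_right _ hδ.le; nlinarith
    nlinarith
  have hpos : 0 < ‖c - ρ‖ := by
    have : 0 < ‖c - ρ‖ ^ 2 := by rw [hsq]; nlinarith [sq_nonneg (ρ.im - t₀)]
    by_contra h
    have h0 : ‖c - ρ‖ = 0 := le_antisymm (not_lt.1 h) (norm_nonneg _)
    rw [h0] at this; norm_num at this
  refine ⟨?_, ?_⟩
  · rw [mem_closedBall, dist_eq_norm']
    refine abs_le_of_sq_le_sq' (le_trans h3 ?_) (by linarith) |>.2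
    nlinarith [sq_nonneg r]
  · set x := r * ‖c - ρ‖⁻¹ with hx
    have hx0 : 0 < x := by positivity
    have h6 : 2 * Real.log x = Real.log (x ^ 2) := by rw [Real.log_pow]; norm_num
    have h7 := Real.one_sub_inv_le_log_of_pos (x := x ^ 2) (by positivity)
    have h8 : (x ^ 2)⁻¹ ≤ 1 - δ / 4 := by
      rw [hx, mul_pow, mul_inv, inv_pow, inv_inv, inv_mul_le_iff₀ (by positivity)]
      exact h3
    linarith

/-- Fubini: for a fixed angle θ, moving the centre vertically sweeps a segment of the line with real
part 3 + r cos θ, shifted by r sin θ and still inside [A, A']. -/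
theorem integral_circleAverage_le {G : ℂ → ℝ} (hG : Continuous G) (hG0 : ∀ z, 0 ≤ G z)
    {A A' a b r : ℝ} (hab : a ≤ b) (hr : 0 ≤ r) (ha : A + r ≤ a) (hb : b + r ≤ A') {B : ℝ → ℝ}
    (hB : Continuous B)
    (hGB : ∀ θ, ∫ t in A..A', G (((3 + r * Real.cos θ : ℝ) : ℂ) + t * I) ≤ B θ) :
    ∫ t in a..b, Real.circleAverage G ((3 : ℝ) + t * I) r ≤
      (2 * Real.pi)⁻¹ * ∫ θ in 0..(2 * Real.pi), B θ := by
  have hcm : Continuous fun p : ℝ × ℝ => circleMap (((3 : ℝ) : ℂ) + p.1 * I) r p.2 := by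
    unfold circleMap; fun_prop
  simp only [Real.circleAverage_def, smul_eq_mul]
  rw [intervalIntegral.integral_const_mul, intervalIntegral_intervalIntegral_swap]
  swap
  · exact ((hG.comp hcm).continuousOn.integrableOn_compact
      (isCompact_uIcc.prod isCompact_uIcc)).mono_set
      (Set.prod_mono Set.uIoc_subset_uIcc Set.uIoc_subset_uIcc)
  refine mul_le_mul_of_nonneg_left ?_ (by positivity)
  refine intervalIntegral.integral_mono_on (by positivity) ?_ (hB.intervalIntegrable _ _) ?_
  · apply Continuous.intervalIntegrable
    apply intervalIntegral.continuous_parametric_intervalIntegral_of_continuous'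
    exact hG.comp (hcm.comp continuous_swap)
  · intro θ _
    refine le_trans ?_ (hGB θ)
    have h1 : ∀ t : ℝ, circleMap (((3 : ℝ) : ℂ) + t * I) r θ =
        ((3 + r * Real.cos θ : ℝ) : ℂ) + ((t + r * Real.sin θ : ℝ) : ℂ) * I := by
      intro t
      rw [circleMap, Complex.exp_mul_I]
      push_cast; ring
    simp only [h1]
    rw [intervalIntegral.integral_comp_add_right
      (fun t : ℝ => G (((3 + r * Real.cos θ : ℝ) : ℂ) + (t : ℂ) * I)) (r * Real.sin θ)]
    have h2 : |r * Real.sin θ| ≤ r := by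
      rw [abs_mul, abs_of_nonneg hr]
      exact mul_le_of_le_one_right hr (Real.abs_sin_le_one θ)
    rw [abs_le] at h2
    refine intervalIntegral.integral_mono_interval (by linarith) (by linarith) (by linarith)
      (Filter.Eventually.of_forall fun t => hG0 _) ?_
    apply Continuous.intervalIntegrable
    fun_prop

/-- Each point is seen by exactly those t in an interval of length 2s, which lies in the range of
integration because s ≤ 1. -/
theorem sum_mul_le_integral_of_window {ι : Type*} (Z : Finset ι) (w γ : ι → ℝ)
    {a b s η : ℝ} (hs : 0 ≤ s) (hs1 : s ≤ 1) (hγ : ∀ i ∈ Z, γ i ∈ Set.Icc a b) (hab : a ≤ b)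
    {F : ℝ → ℝ} (hF : Continuous F)
    (h : ∀ t ∈ Set.Icc (a - 1) (b + 1), (∑ i ∈ Z with |γ i - t| ≤ s, w i) * η ≤ F t) :
    (∑ i ∈ Z, w i) * (2 * s * η) ≤ ∫ t in (a - 1)..(b + 1), F t := by
  have hset : ∀ i, MeasurableSet (Set.Icc (γ i - s) (γ i + s)) := fun i => measurableSet_Icc
  have h1 : ∀ t, (∑ i ∈ Z with |γ i - t| ≤ s, w i) * η =
      ∑ i ∈ Z, (Set.Icc (γ i - s) (γ i + s)).indicator (fun _ => w i * η) t := by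
    intro t
    rw [Finset.sum_filter, Finset.sum_mul]
    refine Finset.sum_congr rfl fun i _ => ?_
    rw [Set.indicator_apply, ite_mul, zero_mul]
    refine if_congr ?_ rfl rfl
    rw [abs_le, Set.mem_Icc]
    constructor <;> rintro ⟨_, _⟩ <;> constructor <;> linarith
  have hint : ∀ i, IntervalIntegrable
      ((Set.Icc (γ i - s) (γ i + s)).indicator (fun _ => w i * η)) volume (a - 1) (b + 1) := by
    intro i
    exact ⟨intervalIntegrable_const.1.indicator (hset i),
      intervalIntegrable_const.2.indicator (hset i)⟩
  have h2 : ∀ i ∈ Z, ∫ t in (a - 1)..(b + 1),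
      (Set.Icc (γ i - s) (γ i + s)).indicator (fun _ => w i * η) t = w i * (2 * s * η) := by
    intro i hi
    have hi' := hγ i hi
    rw [intervalIntegral.integral_of_le (by linarith), ← integral_Icc_eq_integral_Ioc,
      setIntegral_indicator (hset i), Set.inter_eq_right.2, setIntegral_const]
    · simp only [Measure.real, Real.volume_Icc, smul_eq_mul]
      rw [ENNReal.toReal_ofReal (by linarith)]
      ring
    · exact Set.Icc_subset_Icc (by linarith [hi'.1]) (by linarith [hi'.2])
  rw [Finset.sum_mul, ← Finset.sum_congr rfl h2, ← intervalIntegral.integral_finsetSum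
    fun i _ => hint i]
  refine intervalIntegral.integral_mono_on (by linarith) ?_ (hF.intervalIntegrable _ _) ?_
  · simpa only [Finset.sum_fn] using IntervalIntegrable.sum Z fun i _ => hint i
  · intro t ht
    rw [← h1]
    exact h t ht

/-- Laplace's method at θ = π: by 1 − cos x ≥ 2x²/π² the integral is dominated by a Gaussian of
width about L^(-1/2). -/
theorem integral_exp_neg_one_add_cos_le {L : ℝ} (hL : 0 < L) :
    ∫ θ in 0..(2 * Real.pi), Real.exp (-(4 * L * (1 + Real.cos θ))) ≤ 2 * Real.pi / √L := by
  have hpi := Real.pi_pos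
  set b : ℝ := 8 / Real.pi ^ 2 * L with hb
  have hb0 : 0 < b := by positivity
  have h1 : ∫ θ in 0..(2 * Real.pi), Real.exp (-(4 * L * (1 + Real.cos θ))) =
      ∫ x in (-Real.pi)..Real.pi, Real.exp (-(4 * L * (1 - Real.cos x))) := by
    have := intervalIntegral.integral_comp_add_right (a := -Real.pi) (b := Real.pi)
      (fun θ : ℝ => Real.exp (-(4 * L * (1 + Real.cos θ)))) Real.pi
    simp only [Real.cos_add_pi] at this
    rw [neg_add_cancel, ← two_mul] at this
    rw [← this]
    simp only [sub_eq_add_neg]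
  rw [h1]
  calc ∫ x in (-Real.pi)..Real.pi, Real.exp (-(4 * L * (1 - Real.cos x)))
      ≤ ∫ x in (-Real.pi)..Real.pi, Real.exp (-b * x ^ 2) := by
        refine intervalIntegral.integral_mono_on (by linarith)
          (by apply Continuous.intervalIntegrable; fun_prop)
          (by apply Continuous.intervalIntegrable; fun_prop) fun x hx => ?_
        apply Real.exp_le_exp.2
        have := Real.cos_le_one_sub_mul_cos_sq (abs_le.2 hx)
        have h2 : b * x ^ 2 = 4 * L * (2 / Real.pi ^ 2 * x ^ 2) := by rw [hb]; ring
        rw [neg_mul, h2, neg_le_neg_iff]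
        gcongr
        linarith
    _ ≤ ∫ x : ℝ, Real.exp (-b * x ^ 2) := by
        rw [intervalIntegral.integral_of_le (by linarith)]
        exact setIntegral_le_integral (integrable_exp_neg_mul_sq hb0)
          (Filter.Eventually.of_forall fun x => (Real.exp_pos _).le)
    _ = √(Real.pi / b) := integral_gaussian b
    _ ≤ 2 * Real.pi / √L := by
        rw [← Real.sqrt_sq (by positivity : 0 ≤ 2 * Real.pi), ← Real.sqrt_div (by positivity)]
        apply Real.sqrt_le_sqrt
        rw [hb, div_le_div_iff₀ (by positivity) hL]
        field_simp
        nlinarith [Real.pi_lt_four, Real.pi_gt_three]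

end Window

/-! ### Zeros with ordinates in one block -/

section Block
open MeasureTheory Complex Metric

/-- The circle average contributes C and the term at the centre 2C, the latter crudely since g has
mean square O(N^(-3) L²) at σ = 3. The condition A ≥ 4 keeps circles of radius at most 3 within the
heights [A, 9A]. -/
theorem integral_jensen_majorant_le {N : ℕ} {L C α δ r A : ℝ} (hN : 8 ≤ N)
    (hL : L = Real.log N) (hδ : δ = 1 / L) (hC : 0 < C) (hα : 1 / 2 < α) (hα1 : α ≤ 1)
    (hr : r = 3 - (α - δ)) (hL2 : 2 ≤ L) (hA4 : 4 ≤ A)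
    (hg2 : ∀ σ : ℝ, 1 / 2 - 1 / L ≤ σ → 0 ≤ σ → σ ≤ 6 →
      ∫ t in A..(9 * A), ‖mollifiedError N (σ + t * I)‖ ^ 2 ≤ C * ((N : ℝ) ^ (3 - 2 * σ) * L ^ 2)) :
    ∫ t in (2 * A - 1)..(8 * A + 1),
      (Real.circleAverage (fun z => ‖mollifiedError N z‖ ^ 2) ((3 : ℝ) + t * I) r +
        2 * ‖mollifiedError N ((3 : ℝ) + t * I)‖ ^ 2) ≤
      3 * C * ((N : ℝ) ^ (3 - 2 * (α - δ)) * L ^ 2) / √L := by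
  have hN0 : (0 : ℝ) < N := by positivity
  have hN1 : (1 : ℝ) ≤ N := by exact_mod_cast (by omega : 1 ≤ N)
  have hδ0 : 0 < δ := by rw [hδ]; positivity
  have hδ1 : δ ≤ 1 / 2 := by rw [hδ]; exact one_div_le_one_div_of_le (by norm_num) hL2
  have hL0 : 0 < L := by linarith
  have hsL : 0 < √L := Real.sqrt_pos.2 hL0
  have hg := (differentiable_mollifiedError N).continuous
  set G : ℂ → ℝ := fun z => ‖mollifiedError N z‖ ^ 2 with hGdef
  have hG : Continuous G := by fun_prop
  have hG0 : ∀ z, 0 ≤ G z := fun z => by positivity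
  set K := (N : ℝ) ^ (3 - 2 * (α - δ)) * L ^ 2 with hK
  have hK0 : 0 < K := by positivity
  have hcirc : ∫ t in (2 * A - 1)..(8 * A + 1), Real.circleAverage G ((3 : ℝ) + t * I) r ≤
      C * K / √L := by
    refine le_trans (integral_circleAverage_le (A := A) (A' := 9 * A)
      (B := fun θ => C * K * Real.exp (-(4 * L * (1 + Real.cos θ)))) hG hG0
      (by linarith) (by linarith) (by linarith) (by linarith) (by fun_prop) ?_) ?_
    · intro θ
      have hc := Real.neg_one_le_cos θ
      have hc' := Real.cos_le_one θ
      have hσ : 3 + r * Real.cos θ = (α - δ) + r * (1 + Real.cos θ) := by rw [hr]; ring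
      have hrc : 0 ≤ r * (1 + Real.cos θ) := mul_nonneg (by linarith) (by linarith)
      refine le_trans (hg2 (3 + r * Real.cos θ) ?_ ?_ ?_) ?_
      · rw [hσ, ← hδ]; linarith
      · rw [hσ]; linarith
      · have : r * Real.cos θ ≤ r := mul_le_of_le_one_right (by linarith) hc'
        linarith
      · rw [mul_assoc C, hK]
        refine mul_le_mul_of_nonneg_left ?_ hC.le
        rw [mul_right_comm]
        refine mul_le_mul_of_nonneg_right ?_ (by positivity)
        -- The excess of σ over α − δ is r(1 + cos θ), and r ≥ 2, so N^(-2σ) supplies the decay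
        -- e^(-4L(1 + cos θ)).
        rw [hσ, show 3 - 2 * ((α - δ) + r * (1 + Real.cos θ)) =
          3 - 2 * (α - δ) + (-(2 * r * (1 + Real.cos θ))) by ring, Real.rpow_add hN0]
        refine mul_le_mul_of_nonneg_left ?_ (by positivity)
        rw [Real.rpow_def_of_pos hN0, ← hL]
        apply Real.exp_le_exp.2
        have : 2 * (1 + Real.cos θ) * L ≤ r * (1 + Real.cos θ) * L :=
          mul_le_mul_of_nonneg_right (mul_le_mul_of_nonneg_right (by linarith) (by linarith)) hL0.le
        linarith
    · rw [intervalIntegral.integral_const_mul]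
      calc (2 * Real.pi)⁻¹ * (C * K * ∫ θ in 0..(2 * Real.pi),
            Real.exp (-(4 * L * (1 + Real.cos θ))))
          ≤ (2 * Real.pi)⁻¹ * (C * K * (2 * Real.pi / √L)) := by
            gcongr
            exact integral_exp_neg_one_add_cos_le hL0
        _ = C * K / √L := by
            have := Real.pi_pos
            field_simp
  have hcen : ∫ t in (2 * A - 1)..(8 * A + 1), 2 * G ((3 : ℝ) + t * I) ≤ 2 * (C * K / √L) := by
    rw [intervalIntegral.integral_const_mul]
    refine mul_le_mul_of_nonneg_left ?_ (by norm_num)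
    calc ∫ t in (2 * A - 1)..(8 * A + 1), G ((3 : ℝ) + t * I)
        ≤ ∫ t in A..(9 * A), G ((3 : ℝ) + t * I) := by
          refine intervalIntegral.integral_mono_interval (by linarith) (by linarith) (by linarith)
            (Filter.Eventually.of_forall fun t => hG0 _) ?_
          apply Continuous.intervalIntegrable
          fun_prop
      _ ≤ C * ((N : ℝ) ^ (3 - 2 * (3 : ℝ)) * L ^ 2) :=
          hg2 3 (by linarith [show 0 < 1 / L by positivity]) (by norm_num) (by norm_num)
      _ ≤ C * K / √L := by
          rw [mul_div_assoc, hK, mul_div_right_comm]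
          refine mul_le_mul_of_nonneg_left (mul_le_mul_of_nonneg_right ?_ (by positivity)) hC.le
          rw [le_div_iff₀ hsL]
          have h1 : √L ≤ (N : ℝ) ^ (1 : ℝ) := by
            rw [Real.rpow_one]
            refine le_trans (Real.sqrt_le_iff.2 ⟨hL0.le, by nlinarith⟩ : √L ≤ L) ?_
            rw [hL]
            exact (Real.log_le_sub_one_of_pos hN0).trans (by linarith)
          calc (N : ℝ) ^ (3 - 2 * (3 : ℝ)) * √L ≤ (N : ℝ) ^ (3 - 2 * (3 : ℝ)) * (N : ℝ) ^ (1 : ℝ) := by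
                gcongr
            _ = (N : ℝ) ^ (3 - 2 * (3 : ℝ) + 1) := (Real.rpow_add hN0 _ _).symm
            _ ≤ _ := Real.rpow_le_rpow_of_exponent_le hN1 (by linarith)
  have hi : Continuous fun t : ℝ => Real.circleAverage G ((3 : ℝ) + t * I) r := by
    simp only [Real.circleAverage_def, smul_eq_mul]
    refine continuous_const.mul ?_
    apply intervalIntegral.continuous_parametric_intervalIntegral_of_continuous'
    have : Continuous fun p : ℝ × ℝ => circleMap (((3 : ℝ) : ℂ) + p.1 * I) r p.2 := by
      unfold circleMap; fun_prop
    exact hG.comp this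
  have hi2 : Continuous fun t : ℝ => 2 * G ((3 : ℝ) + t * I) := by fun_prop
  rw [intervalIntegral.integral_add (hi.intervalIntegrable _ _) (hi2.intervalIntegrable _ _)]
  calc _ ≤ C * K / √L + 2 * (C * K / √L) := add_le_add hcirc hcen
    _ = _ := by ring

/-- Zeros with ordinates in a block, counted with multiplicity. -/
theorem exists_sum_analyticOrderNatAt_block_le : ∃ C : ℝ, 0 < C ∧ ∃ N₁ : ℕ, 8 ≤ N₁ ∧ ∀ N : ℕ,
    N₁ ≤ N → ∀ α : ℝ, 1 / 2 < α → α ≤ 1 → ∀ Z : Finset ℂ,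
    (∀ ρ ∈ Z, ρ.re ∈ Set.Icc α 1 ∧ ρ.im ∈ Set.Icc (2 * (2 * Real.pi * (N : ℝ) ^ 2))
      (8 * (2 * Real.pi * (N : ℝ) ^ 2))) →
    ∑ ρ ∈ Z, (analyticOrderNatAt riemannAux ρ : ℝ) ≤
      C * ((N : ℝ) ^ (3 - 2 * α) * Real.log N ^ 3) := by
  obtain ⟨C, hC, hg2⟩ := exists_integral_norm_sq_mollifiedError_le
  obtain ⟨N₀, hN₀, hg3⟩ := exists_norm_mollifiedError_three_le
  refine ⟨12 * C * Real.exp 2, by positivity, max N₀ 8, le_max_right _ _, ?_⟩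
  intro N hN α hα hα1 Z hZ
  have hN8 : 8 ≤ N := le_trans (le_max_right _ _) hN
  have hN3 : N₀ ≤ N := le_trans (le_max_left _ _) hN
  have hN0 : (0 : ℝ) < N := by exact_mod_cast (by omega : 0 < N)
  set L := Real.log N with hL
  have hL2 : 2 ≤ L := by
    have h1 : Real.log 8 ≤ L := Real.log_le_log (by norm_num) (by exact_mod_cast hN8)
    have h2 : Real.log 8 = 3 * Real.log 2 := by
      rw [show (8 : ℝ) = 2 ^ 3 by norm_num, Real.log_pow]; norm_num
    linarith [Real.log_two_gt_d9]
  have hL0 : 0 < L := by linarith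
  set A := 2 * Real.pi * (N : ℝ) ^ 2 with hA
  have hA4 : 4 ≤ A := by
    have h1 : (8 : ℝ) ≤ N := by exact_mod_cast hN8
    have h2 : (1 : ℝ) ≤ (N : ℝ) ^ 2 := by nlinarith
    nlinarith [Real.pi_gt_three]
  set δ := 1 / L with hδ
  have hδ0 : 0 < δ := by positivity
  have hδ1 : δ ≤ 1 / 2 := one_div_le_one_div_of_le (by norm_num) hL2
  set r := 3 - (α - δ) with hr
  have hmaj := integral_jensen_majorant_le hN8 hL hδ hC hα hα1 hr hL2 hA4
    (fun σ h1 h2 h3 => hg2 N (by omega) σ h1 h2 h3)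
  have hd := differentiable_mollifiedError N
  have hwin := sum_mul_le_integral_of_window Z
    (fun ρ => (analyticOrderNatAt riemannAux ρ : ℝ)) (fun ρ => ρ.im)
    (a := 2 * A) (b := 8 * A) (s := √δ) (η := δ / 8)
    (F := fun t : ℝ => Real.circleAverage (fun z => ‖mollifiedError N z‖ ^ 2) ((3 : ℝ) + t * I) r +
        2 * ‖mollifiedError N ((3 : ℝ) + t * I)‖ ^ 2)
    (Real.sqrt_nonneg _) (Real.sqrt_le_iff.2 ⟨zero_le_one, by linarith⟩) (fun ρ hρ => (hZ ρ hρ).2)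
    (by linarith) ?_ ?_
  · have h1 := hwin.trans hmaj
    have hsL : 0 < √L := Real.sqrt_pos.2 hL0
    have hδs : √δ = 1 / √L := by rw [hδ, Real.sqrt_div zero_le_one, Real.sqrt_one]
    -- N^(2δ) = e² because δ = 1/log N.
    have hNδ : (N : ℝ) ^ (3 - 2 * (α - δ)) = (N : ℝ) ^ (3 - 2 * α) * Real.exp 2 := by
      rw [show 3 - 2 * (α - δ) = 3 - 2 * α + 2 * δ by ring, Real.rpow_add hN0]
      congr 1
      rw [Real.rpow_def_of_pos hN0, ← hL, hδ]
      congr 1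
      field_simp
    rw [hδs, hNδ] at h1
    rw [hδ] at h1
    -- The 1/√L from the window height √δ cancels the 1/√L from the short arc. The weight δ/8 leaves
    -- one factor L, which together with L² gives L³.
    set S := ∑ ρ ∈ Z, (analyticOrderNatAt riemannAux ρ : ℝ)
    have h2 : S * (2 * (1 / √L) * (1 / L / 8)) = (S / (4 * L)) / √L := by
      field_simp; ring
    rw [h2, div_le_div_iff_of_pos_right hsL, div_le_iff₀ (by positivity)] at h1
    refine h1.trans (le_of_eq ?_)
    ring
  · have hg := hd.continuous
    have hi : Continuous fun t : ℝ =>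
        Real.circleAverage (fun z => ‖mollifiedError N z‖ ^ 2) ((3 : ℝ) + t * I) r := by
      simp only [Real.circleAverage_def, smul_eq_mul]
      refine continuous_const.mul ?_
      apply intervalIntegral.continuous_parametric_intervalIntegral_of_continuous'
      have h1 : Continuous fun p : ℝ × ℝ => circleMap (((3 : ℝ) : ℂ) + p.1 * I) r p.2 := by
        unfold circleMap; fun_prop
      have h2 : Continuous fun z => ‖mollifiedError N z‖ ^ 2 := by fun_prop
      exact h2.comp h1
    exact hi.add (by fun_prop)
  · intro t ht
    have hw := fun ρ (hρ : ρ ∈ Z.filter fun ρ => |ρ.im - t| ≤ √δ) =>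
      le_log_of_mem_window (t₀ := t) hα hα1 hδ0 hδ1 hr
        (hZ ρ (Finset.mem_filter.1 hρ).1).1.1 (hZ ρ (Finset.mem_filter.1 hρ).1).1.2
        (Finset.mem_filter.1 hρ).2
    refine Differentiable.sum_analyticOrderNatAt_le_circleAverage
      (k := fun z => mollifier N z * (2 - riemannAux z * mollifier N z))
      differentiable_riemannAux hd ?_ ?_ (hg3 N hN3 t ⟨?_, ?_⟩) (by linarith) _
      (fun ρ hρ => (hw ρ hρ).1) (fun ρ hρ => (hw ρ hρ).2) (by positivity)
    · have h1 := differentiable_mollifier N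
      have h2 := differentiable_riemannAux
      fun_prop
    · intro z
      rw [mollifiedError]; ring
    · linarith [ht.1]
    · linarith [ht.2]

end Block

/-! ### Summation over dyadic blocks -/

section Count
open MeasureTheory Complex Metric

/-- If R vanished identically, the mollified error would be −1, contradicting its bound 1/2 at σ =
3. This makes all vanishing orders finite. -/
theorem exists_riemannAux_ne_zero : ∃ c : ℂ, riemannAux c ≠ 0 := by
  obtain ⟨N, hN, h⟩ := exists_norm_mollifiedError_three_le
  have hA : 0 < 2 * Real.pi * (N : ℝ) ^ 2 := by
    have : 0 < N := by omega
    positivity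
  by_contra! h0
  have h1 := h N le_rfl (9 * (2 * Real.pi * (N : ℝ) ^ 2)) ⟨by linarith, le_rfl⟩
  rw [mollifiedError, h0] at h1
  norm_num at h1

/-- The zeros of an entire function in a ball have bounded total multiplicity. -/
theorem Differentiable.exists_sum_analyticOrderNatAt_le {f : ℂ → ℂ} (hf : Differentiable ℂ f)
    {c : ℂ} (hc : f c ≠ 0) (z₀ : ℂ) (r : ℝ) : ∃ B : ℝ, 0 ≤ B ∧ ∀ Z : Finset ℂ,
    (∀ u ∈ Z, u ∈ closedBall z₀ r) → ∑ u ∈ Z, (analyticOrderNatAt f u : ℝ) ≤ B := by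
  classical
  set D := MeromorphicOn.divisor f (closedBall z₀ r) with hD
  have hfin := D.finiteSupport (isCompact_closedBall z₀ r)
  refine ⟨∑ u ∈ hfin.toFinset, (analyticOrderNatAt f u : ℝ), by positivity, fun Z hZ => ?_⟩
  rw [← Finset.sum_filter_ne_zero]
  refine Finset.sum_le_sum_of_subset_of_nonneg (fun u hu => ?_) fun _ _ _ => by positivity
  rw [Finset.mem_filter] at hu
  rw [Set.Finite.mem_toFinset, Function.mem_support, hD, hf.divisor_closedBall_eq hc (hZ u hu.1)]
  exact_mod_cast hu.2

/-- With N = 2^J the block is [4π4^J, 4π4^(J+1)]. As 3 − 2α ≥ 1, the bound at least doubles from J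
to J + 1, so earlier blocks plus the new one fit under the same C, uniformly in α. -/
theorem sum_analyticOrderNatAt_le_of_im_le {C B α : ℝ} {N₁ j₀ : ℕ} (hC : 0 < C) (hα1 : α ≤ 1)
    (hj₀ : N₁ ≤ 2 ^ j₀)
    (hblock : ∀ N : ℕ, N₁ ≤ N → ∀ Z : Finset ℂ,
      (∀ ρ ∈ Z, ρ.re ∈ Set.Icc α 1 ∧ ρ.im ∈ Set.Icc (2 * (2 * Real.pi * (N : ℝ) ^ 2))
        (8 * (2 * Real.pi * (N : ℝ) ^ 2))) →
      ∑ ρ ∈ Z, (analyticOrderNatAt riemannAux ρ : ℝ) ≤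
        C * ((N : ℝ) ^ (3 - 2 * α) * Real.log N ^ 3))
    (hbase : ∀ Z : Finset ℂ, (∀ ρ ∈ Z, ρ.re ∈ Set.Icc α 1 ∧
      ρ.im ∈ Set.Icc 0 (4 * Real.pi * 4 ^ j₀)) →
      ∑ ρ ∈ Z, (analyticOrderNatAt riemannAux ρ : ℝ) ≤ B) (J : ℕ) (hJ : j₀ ≤ J) :
    ∀ Z : Finset ℂ, (∀ ρ ∈ Z, ρ.re ∈ Set.Icc α 1 ∧ ρ.im ∈ Set.Icc 0 (4 * Real.pi * 4 ^ J)) →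
      ∑ ρ ∈ Z, (analyticOrderNatAt riemannAux ρ : ℝ) ≤
        B + C * ((2 ^ J : ℝ) ^ (3 - 2 * α) * Real.log (2 ^ J) ^ 3) := by
  classical
  induction J, hJ using Nat.le_induction with
  | base =>
    intro Z hZ
    have h0 : 0 ≤ Real.log (2 ^ j₀ : ℝ) := Real.log_nonneg (one_le_pow₀ (by norm_num))
    have h1 : 0 ≤ C * ((2 ^ j₀ : ℝ) ^ (3 - 2 * α) * Real.log (2 ^ j₀) ^ 3) := by positivity
    linarith [hbase Z hZ]
  | succ J hJ ih =>
    intro Z hZ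
    have h4 : (4 : ℝ) ^ J = ((2 ^ J : ℕ) : ℝ) ^ 2 := by
      push_cast
      rw [← pow_mul, mul_comm, pow_mul]; norm_num
    rw [← Finset.sum_filter_add_sum_filter_not Z (fun ρ => ρ.im ≤ 4 * Real.pi * 4 ^ J)]
    have h1 := ih (Z.filter fun ρ => ρ.im ≤ 4 * Real.pi * 4 ^ J) fun ρ hρ => by
      rw [Finset.mem_filter] at hρ
      exact ⟨(hZ ρ hρ.1).1, (hZ ρ hρ.1).2.1, hρ.2⟩
    have h2 := hblock (2 ^ J) (hj₀.trans (Nat.pow_le_pow_right (by norm_num) hJ))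
      (Z.filter fun ρ => ¬ ρ.im ≤ 4 * Real.pi * 4 ^ J) fun ρ hρ => by
        rw [Finset.mem_filter] at hρ
        refine ⟨(hZ ρ hρ.1).1, ?_, ?_⟩
        · rw [← h4]; linarith [not_le.1 hρ.2]
        · have := (hZ ρ hρ.1).2.2
          rw [pow_succ] at this
          rw [← h4]; linarith
    push_cast at h2
    have h0 : 0 ≤ Real.log (2 ^ J : ℝ) := Real.log_nonneg (one_le_pow₀ (by norm_num))
    have hlog : Real.log (2 ^ J : ℝ) ≤ Real.log (2 ^ (J + 1)) :=
      Real.log_le_log (by positivity) (pow_le_pow_right₀ (by norm_num) (by omega))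
    have hpow : 2 * (2 ^ J : ℝ) ^ (3 - 2 * α) ≤ (2 ^ (J + 1) : ℝ) ^ (3 - 2 * α) := by
      rw [pow_succ, Real.mul_rpow (by positivity) (by norm_num), mul_comm]
      refine mul_le_mul_of_nonneg_left ?_ (by positivity)
      calc (2 : ℝ) = 2 ^ (1 : ℝ) := (Real.rpow_one 2).symm
        _ ≤ _ := Real.rpow_le_rpow_of_exponent_le (by norm_num) (by linarith)
    have h3 : 2 * ((2 ^ J : ℝ) ^ (3 - 2 * α) * Real.log (2 ^ J) ^ 3) ≤
        (2 ^ (J + 1) : ℝ) ^ (3 - 2 * α) * Real.log (2 ^ (J + 1)) ^ 3 := by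
      rw [← mul_assoc]
      exact mul_le_mul hpow (pow_le_pow_left₀ h0 hlog 3) (by positivity) (by positivity)
    have h5 := mul_le_mul_of_nonneg_left h3 hC.le
    linarith

theorem exists_sum_analyticOrderNatAt_riemannAux_le : ∃ C : ℝ, 0 < C ∧ ∀ α : ℝ, 1 / 2 < α →
    α ≤ 1 → ∀ T : ℝ, 2 ≤ T → ∀ Z : Finset ℂ, (∀ ρ ∈ Z, ρ.re ∈ Set.Icc α 1 ∧ ρ.im ∈ Set.Icc 0 T) →
    ∑ ρ ∈ Z, (analyticOrderNatAt riemannAux ρ : ℝ) ≤ C * T ^ (3 / 2 - α) * Real.log T ^ 3 := by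
  obtain ⟨C, hC, N₁, -, hblock⟩ := exists_sum_analyticOrderNatAt_block_le
  obtain ⟨j₀, hj₀⟩ : ∃ j₀ : ℕ, N₁ ≤ 2 ^ j₀ := ⟨N₁, Nat.lt_two_pow_self.le⟩
  obtain ⟨c, hc⟩ := exists_riemannAux_ne_zero
  obtain ⟨B, hB, hball⟩ := differentiable_riemannAux.exists_sum_analyticOrderNatAt_le hc 0
    (1 + 4 * Real.pi * 4 ^ j₀)
  have hbase : ∀ α : ℝ, 1 / 2 < α → ∀ Z : Finset ℂ, (∀ ρ ∈ Z, ρ.re ∈ Set.Icc α 1 ∧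
      ρ.im ∈ Set.Icc 0 (4 * Real.pi * 4 ^ j₀)) →
      ∑ ρ ∈ Z, (analyticOrderNatAt riemannAux ρ : ℝ) ≤ B := by
    intro α hα Z hZ
    refine hball Z fun ρ hρ => ?_
    obtain ⟨h1, h2⟩ := hZ ρ hρ
    rw [mem_closedBall, dist_zero_right]
    refine (Complex.norm_le_abs_re_add_abs_im ρ).trans (add_le_add ?_ ?_)
    · rw [abs_of_nonneg (by linarith [h1.1])]; exact h1.2
    · rw [abs_of_nonneg h2.1]; exact h2.2
  -- B bounds the zeros below a fixed height, where the block estimate is unavailable. For T ≥ 2 the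
  -- target expression without its constant is at least 1/8, so 8B absorbs them.
  refine ⟨8 * B + C, by positivity, fun α hα hα1 T hT Z hZ => ?_⟩
  have hT0 : 0 < T := by linarith
  have hlogT : 1 / 2 ≤ Real.log T := by
    linarith [Real.log_two_gt_d9, Real.log_le_log (by norm_num) hT]
  have hX : 1 / 8 ≤ T ^ (3 / 2 - α) * Real.log T ^ 3 := by
    have h1 : 1 ≤ T ^ (3 / 2 - α) := Real.one_le_rpow (by linarith) (by linarith)
    have h2 : (1 / 2 : ℝ) ^ 3 ≤ Real.log T ^ 3 := pow_le_pow_left₀ (by norm_num) hlogT 3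
    nlinarith
  have hBX := mul_le_mul_of_nonneg_left hX hB
  have hCX : 0 ≤ C * (T ^ (3 / 2 - α) * Real.log T ^ 3) := mul_nonneg hC.le (by linarith)
  have hex : ∃ J : ℕ, T ≤ 4 * Real.pi * 4 ^ J := by
    obtain ⟨J, hJ⟩ := pow_unbounded_of_one_lt T (by norm_num : (1 : ℝ) < 4)
    refine ⟨J, ?_⟩
    nlinarith [Real.pi_gt_three]
  classical
  by_cases hle : T ≤ 4 * Real.pi * 4 ^ j₀
  · have := hbase α hα Z fun ρ hρ => ⟨(hZ ρ hρ).1, (hZ ρ hρ).2.1, (hZ ρ hρ).2.2.trans hle⟩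
    linarith
  · have hJ := Nat.find_spec hex
    have hJmin := fun j hj => Nat.find_min hex (m := j) hj
    set J := Nat.find hex
    have hjJ : j₀ < J := by
      by_contra h
      exact hle (hJ.trans (by gcongr; norm_num; omega))
    have hprev := not_le.1 (hJmin (J - 1) (by omega))
    have h4 : (4 : ℝ) ^ J = 4 * 4 ^ (J - 1) := by
      rw [← pow_succ']; congr 1; omega
    -- By minimality of J, T exceeds 4π4^(J-1) = π4^J.
    have h5 : ((2 : ℝ) ^ J) ^ (2 : ℝ) ≤ T := by
      rw [Real.rpow_two, ← pow_mul, mul_comm, pow_mul]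
      norm_num1
      nlinarith [Real.pi_gt_three, pow_pos (by norm_num : (0 : ℝ) < 4) (J - 1)]
    have h6 : ((2 : ℝ) ^ J) ^ (3 - 2 * α) ≤ T ^ (3 / 2 - α) := by
      rw [show 3 - 2 * α = 2 * (3 / 2 - α) by ring, Real.rpow_mul (by positivity)]
      exact Real.rpow_le_rpow (by positivity) h5 (by linarith)
    have h1J : (1 : ℝ) ≤ 2 ^ J := one_le_pow₀ (by norm_num)
    have h7 : Real.log (2 ^ J) ≤ Real.log T := by
      refine Real.log_le_log (by positivity) (le_trans ?_ h5)
      rw [Real.rpow_two]; nlinarith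
    have h8 := sum_analyticOrderNatAt_le_of_im_le hC hα1 hj₀ (fun N hN => hblock N hN α hα hα1)
      (hbase α hα) J hjJ.le Z fun ρ hρ => ⟨(hZ ρ hρ).1, (hZ ρ hρ).2.1, (hZ ρ hρ).2.2.trans hJ⟩
    have h9 : ((2 : ℝ) ^ J) ^ (3 - 2 * α) * Real.log (2 ^ J) ^ 3 ≤
        T ^ (3 / 2 - α) * Real.log T ^ 3 :=
      mul_le_mul h6 (pow_le_pow_left₀ (Real.log_nonneg h1J) h7 3)
        (pow_nonneg (Real.log_nonneg h1J) 3) (by positivity)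
    have h10 := mul_le_mul_of_nonneg_left h9 hC.le
    linarith

end Count

end Preparation

theorem mainTheorem4 :
    ∃ C : ℝ, 0 < C ∧ ∀ α : ℝ, 1 / 2 < α → α ≤ 1 → ∀ T : ℝ, 2 ≤ T →
      riemannAuxZeroCount α T ≤
        ENNReal.ofReal (C * T ^ (3 / 2 - α) * Real.log T ^ 3) := by
  obtain ⟨C, hC, h⟩ := exists_sum_analyticOrderNatAt_riemannAux_le
  obtain ⟨c, hc⟩ := exists_riemannAux_ne_zero
  refine ⟨C, hC, fun α hα hα1 T hT => ?_⟩
  -- The count is the supremum of its finite partial sums, so a bound uniform over finite sets of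
  -- zeros also yields finiteness.
  rw [riemannAuxZeroCount, ENNReal.tsum_eq_iSup_sum]
  refine iSup_le fun s => ?_
  have h1 := h α hα hα1 T hT (s.map (Function.Embedding.subtype _)) fun ρ hρ => by
    rw [Finset.mem_map] at hρ
    obtain ⟨x, -, rfl⟩ := hρ
    exact ⟨x.2.2.1, x.2.2.2⟩
  rw [Finset.sum_map] at h1
  refine le_trans (le_of_eq ?_) (ENNReal.ofReal_le_ofReal h1)
  rw [ENNReal.ofReal_sum_of_nonneg fun _ _ => by positivity]
  refine Finset.sum_congr rfl fun x _ => ?_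
  rw [ENNReal.ofReal_natCast, ← Nat.cast_analyticOrderNatAt
    (differentiable_riemannAux.analyticOrderAt_ne_top hc x)]
  simp
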